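/- **Setting.** All Lie algebras are over $\mathbb C$. Let $\mathbb A$ be one of the four normed algebras $\mathbb R,\mathbb C,\mathbb H,\mathbb O$, complexified, of dimension $a=1,2,4,8$. Let $\mathfrak t(\mathbb A)$ be its triality algebra $$\mathfrak t(\mathbb A)=\{(\theta_1,\theta_2,\theta_3)\in\mathfrak{so}(\mathbb A)^3:\ \theta_3(xy)=\theta_1(x)y+x\theta_2(y)\ \ \forall x,y\in\mathbb A\},$$ and let $\mathbb A_i$ be $\mathbb A$ with the action of $\mathfrak t(\mathbb A)$ through $\theta_i$. In particular $\mathfrak t(\mathbb O)\simeq\mathfrak{so}_8$. The triality model is the Lie algebra $$\tilde{\mathfrak g}(\mathbb A,\mathbb O)=\mathfrak t(\mathbb A)\times\mathfrak t(\mathbb O)\oplus(\mathbb A_1\otimes\mathbb O_1)\oplus(\mathbb A_2\otimes\mathbb O_2)\oplus(\mathbb A_3\otimes\mathbb O_3).$$ For $a=1,2,4,8$ it is $\mathfrak f_4,\mathfrak e_6,\mathfrak e_7,\mathfrak e_8$. The inclusion $\mathbb R\subset\mathbb A$ induces $\mathfrak f_4=\tilde{\mathfrak g}(\mathbb R,\mathbb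 O)\subset\tilde{\mathfrak g}(\mathbb A,\mathbb O)$. For a nilpotent $X\in\mathfrak f_4$ let $\mathcal O_a$ be the orbit of $X$ under the adjoint group of $\tilde{\mathfrak g}(\mathbb A,\mathbb O)$; the $\mathcal O_a$ form the series defined by the orbit $\mathcal O_1$. Let $\mathfrak t\subset\mathfrak t(\mathbb O)=\mathfrak{so}_8$ be the standard Cartan subalgebra, and let $\omega_1,\dots,\omega_4$ be the fundamental weights of $\mathfrak{so}_8$ (Bourbaki numbering), where $\mathbb O_1,\mathbb O_2,\mathbb O_3$ have the highest weights $\omega_1,\omega_3,\omega_4$. Put $$\omega(\mathfrak g)=\omega_2,\qquad \omega(\mathfrak g_2)=\omega_1+\omega_3+\omega_4,\qquad \omega(\mathfrak g_3)=2\omega_1+2\omega_3,\qquad \omega(\mathfrak g_Q)=2\omega_1 .$$ Let $(\cdot,\cdot)$ be the invariant scalar product on $\mathfrak t^*$ for which the roots of $\mathfrak{so}_8$ have square length $2$. **Diagram of a weight.** We say that the weighted Dynkin diagram of $\mathcal O_a$ *corresponds to the weight* $\lambda\in\mathfrak t^*$ if there are a Cartan subalgebra $T\supset\mathfrak t$ of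 $\tilde{\mathfrak g}(\mathbb A,\mathbb O)$, a system of simple roots $\alpha_i$ with respect to $T$, and an $\mathfrak{sl}_2$-triple $(e,h,f)$ (zero if $X=0$) with $e\in\mathcal O_a$ and $h\in T$, such that the labels $\alpha_i(h)$ of the diagram are non-negative integers and $$\alpha_i(h)=(\lambda,\alpha_i|_{\mathfrak t})\qquad\text{for all } i.$$ **Proposition 2.3.** Let $p,q,r,s$ be non-negative integers and $\lambda=p\,\omega(\mathfrak g)+q\,\omega(\mathfrak g_2)+r\,\omega(\mathfrak g_3)+s\,\omega(\mathfrak g_Q)$. Suppose that the weighted Dynkin diagram of the nilpotent orbit $\mathcal O_1$ in $\mathfrak f_4$ corresponds to $\lambda$, its labels on the diagram $F_4$ being $(p,q,r,s)$. Then $\tilde{\mathfrak g}(\mathbb A,\mathbb O)$ is semisimple of type $E_6,E_7,E_8$ for $a=2,4,8$, and the weighted Dynkin diagram of $\mathcal O_a$ corresponds to the same weight $\lambda$. In Bourbaki's numbering its labels are $$E_6:\ (s,p,r,q,r,s),\qquad E_7:\ (p,0,q,r,0,s,0),\qquad E_8:\ (s,0,0,0,0,r,q,p).$$ -/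

import Mathlib

open scoped TensorProduct

set_option linter.unusedSimpArgs false
set_option linter.unusedSectionVars false

noncomputable section

namespace TrialitySeries

/-- A Hurwitz (unital composition) algebra over `ℂ`: a bilinear product with a unit and a
nondegenerate symmetric form `(x, y)` such that `(xy, xy) = (x, x)(y, y)`. The complexifications of
`ℝ, ℂ, ℍ, 𝕆` are constructed below. -/
class HurwitzAlgebra (V : Type) [AddCommGroup V] [Module ℂ V] where
  /-- the product -/
  mul : V →ₗ[ℂ] V →ₗ[ℂ] V
  /-- the unit -/
  one : V
  /-- the bilinear form of the norm -/
  form : V →ₗ[ℂ] V →ₗ[ℂ] ℂ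
  form_symm : ∀ x y, form x y = form y x
  form_nondeg : ∀ x, (∀ y, form x y = 0) → x = 0
  form_one : form one one = 1
  one_mul : ∀ x, mul one x = x
  mul_one : ∀ x, mul x one = x
  form_mul : ∀ x y, form (mul x y) (mul x y) = form x x * form y y

namespace HurwitzAlgebra

attribute [local instance] LieRing.ofAssociativeRing


section Basic

variable {V : Type} [AddCommGroup V] [Module ℂ V] [HurwitzAlgebra V]

/-- The conjugation `x ↦ 2 (1, x) 1 - x`, the orthogonal symmetry with respect to the unit. -/
def conj : V →ₗ[ℂ] V := (2 : ℂ) • (form (one : V)).smulRight one - LinearMap.id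

lemma conj_apply (x : V) : conj x = (2 * form one x) • one - x := by
  simp [conj, mul_smul]

lemma ext_form {x y : V} (h : ∀ z, form x z = form y z) : x = y :=
  sub_eq_zero.1 (form_nondeg _ fun z => by simp [h z])

lemma form_mul_left (x y z : V) : form (mul x y) (mul x z) = form x x * form y z := by
  have h := form_mul x (y + z)
  simp only [LinearMap.map_add, LinearMap.add_apply, form_mul] at h
  linear_combination h / 2 + form_symm (mul x y) (mul x z) / 2 - form x x * form_symm y z / 2

lemma form_mul_right (x y z : V) : form (mul x z) (mul y z) = form x y * form z z := by
  have h := form_mul (x + y) z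
  simp only [LinearMap.map_add, LinearMap.add_apply, form_mul] at h
  linear_combination h / 2 + form_symm (mul x z) (mul y z) / 2 - form z z * form_symm x y / 2

/-- Linearised multiplicativity of the norm. -/
lemma form_mul_mul (x y z w : V) :
    form (mul x y) (mul z w) + form (mul x w) (mul z y) = 2 * form x z * form y w := by
  have h := form_mul_left (x + z) y w
  simp only [LinearMap.map_add, LinearMap.add_apply, form_mul_left] at h
  linear_combination h - form_symm (mul z y) (mul x w) - form y w * form_symm x z

lemma form_conj (x y : V) : form (conj x) y = form x (conj y) := by
  simp only [conj_apply, LinearMap.map_sub, LinearMap.map_smul, LinearMap.sub_apply, LinearMap.smul_apply, smul_eq_mul]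
  rw [form_symm x one]; ring

lemma conj_conj (x : V) : conj (conj x) = x := by
  simp only [conj_apply, LinearMap.map_sub, LinearMap.map_smul, smul_eq_mul, form_one]
  module

lemma form_conj_conj (x y : V) : form (conj x) (conj y) = form x y := by
  rw [form_conj, conj_conj]

lemma conj_one : conj (one : V) = one := by
  rw [conj_apply, form_one]; module

/-- The adjoint of left multiplication. -/
lemma form_mul_adj_left (x y z : V) : form (mul x y) z = form y (mul (conj x) z) := by
  have h := form_mul_mul x y one z
  simp only [one_mul] at h
  rw [conj_apply]
  simp only [LinearMap.map_sub, LinearMap.map_smul, LinearMap.sub_apply, LinearMap.smul_apply, smul_eq_mul, one_mul]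
  rw [form_symm one x, form_symm y (mul x z)]
  linear_combination h

/-- The adjoint of right multiplication. -/
lemma form_mul_adj_right (x y z : V) : form (mul x y) z = form x (mul z (conj y)) := by
  have h := form_mul_mul x y z one
  simp only [mul_one] at h
  rw [conj_apply]
  simp only [LinearMap.map_sub, LinearMap.map_smul, LinearMap.sub_apply, LinearMap.smul_apply, smul_eq_mul, mul_one]
  rw [form_symm one y]
  linear_combination h

/-- Rewriting rules for moving a factor to the other side of the form. -/
lemma form_right_adj_left (x y z : V) : form z (mul x y) = form (mul (conj x) z) y := by
  rw [form_symm, form_mul_adj_left, form_symm]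

lemma form_right_adj_right (x y z : V) : form z (mul x y) = form (mul z (conj y)) x := by
  rw [form_symm, form_mul_adj_right, form_symm]

lemma conj_mul (x y : V) : conj (mul x y) = mul (conj y) (conj x) := by
  refine ext_form fun z => ?_
  rw [form_conj, form_mul_adj_left (conj y), conj_conj, form_right_adj_right y z,
    form_mul_adj_left, form_symm]

lemma conj_mul_mul (u v z : V) :
    mul (conj u) (mul v z) + mul (conj v) (mul u z) = (2 * form u v) • z := by
  refine ext_form fun w => ?_
  simp only [LinearMap.map_add, LinearMap.add_apply, LinearMap.map_smul, LinearMap.smul_apply, smul_eq_mul]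
  rw [form_mul_adj_left (conj u), conj_conj, form_mul_adj_left (conj v), conj_conj, form_symm u v]
  linear_combination form_mul_mul v z u w + form_symm (mul u z) (mul v w)

lemma mul_mul_conj (u v z : V) :
    mul (mul z u) (conj v) + mul (mul z v) (conj u) = (2 * form u v) • z := by
  refine ext_form fun w => ?_
  simp only [LinearMap.map_add, LinearMap.add_apply, LinearMap.map_smul, LinearMap.smul_apply, smul_eq_mul]
  rw [form_mul_adj_right _ (conj v), conj_conj, form_mul_adj_right _ (conj u), conj_conj]
  linear_combination form_mul_mul z u w v

lemma mul_conj_mul (u v z : V) :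
    mul u (mul (conj v) z) + mul v (mul (conj u) z) = (2 * form u v) • z := by
  simpa [conj_conj, form_conj_conj] using conj_mul_mul (conj u) (conj v) z

lemma mul_conj_mul' (u v z : V) :
    mul (mul z (conj u)) v + mul (mul z (conj v)) u = (2 * form u v) • z := by
  simpa [conj_conj, form_conj_conj] using mul_mul_conj (conj u) (conj v) z


/-- An endomorphism which is skew for the form, i.e. an element of `so(V)`. -/
def IsSkew (f : Module.End ℂ V) : Prop := ∀ x y, form (f x) y = -form x (f y)

lemma IsSkew.lie {f g : Module.End ℂ V} (hf : IsSkew f) (hg : IsSkew g) : IsSkew ⁅f, g⁆ := by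
  intro x y
  simp only [LieRing.of_associative_ring_bracket, LinearMap.sub_apply, Module.End.mul_apply,
    LinearMap.map_sub, hf _ _, hg _ _]
  ring

variable (V) in
/-- The triality algebra
`t(V) = {(θ₁, θ₂, θ₃) ∈ so(V)³ | θ₃(xy) = θ₁(x) y + x θ₂(y)}`. -/
def trialityAlgebra :
    LieSubalgebra ℂ (Module.End ℂ V × Module.End ℂ V × Module.End ℂ V) where
  carrier := {θ | IsSkew θ.1 ∧ IsSkew θ.2.1 ∧ IsSkew θ.2.2 ∧
    ∀ x y, θ.2.2 (mul x y) = mul (θ.1 x) y + mul x (θ.2.1 y)}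
  zero_mem' := by simp [IsSkew]
  add_mem' := by
    rintro a b ⟨h1, h2, h3, h⟩ ⟨k1, k2, k3, k⟩
    refine ⟨fun x y => ?_, fun x y => ?_, fun x y => ?_, fun x y => ?_⟩
    · simp [h1 x y, k1 x y]; ring
    · simp [h2 x y, k2 x y]; ring
    · simp [h3 x y, k3 x y]; ring
    · simp [h x y, k x y]; abel
  smul_mem' := by
    rintro c a ⟨h1, h2, h3, h⟩
    refine ⟨fun x y => ?_, fun x y => ?_, fun x y => ?_, fun x y => ?_⟩
    · simp [h1 x y]
    · simp [h2 x y]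
    · simp [h3 x y]
    · simp [h x y]
  lie_mem' := by
    rintro a b ⟨h1, h2, h3, h⟩ ⟨k1, k2, k3, k⟩
    refine ⟨h1.lie k1, h2.lie k2, h3.lie k3, fun x y => ?_⟩
    simp [LieRing.of_associative_ring_bracket, h, k]
    abel

/-- The component `θ₁` of a triality `θ`. -/
def comp₁ : trialityAlgebra V →ₗ[ℂ] Module.End ℂ V :=
  LinearMap.fst ℂ _ _ ∘ₗ (trialityAlgebra V).toSubmodule.subtype

/-- The component `θ₂` of a triality `θ`. -/
def comp₂ : trialityAlgebra V →ₗ[ℂ] Module.End ℂ V :=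
  LinearMap.fst ℂ _ _ ∘ₗ LinearMap.snd ℂ _ _ ∘ₗ (trialityAlgebra V).toSubmodule.subtype

/-- The component `θ₃` of a triality `θ`. -/
def comp₃ : trialityAlgebra V →ₗ[ℂ] Module.End ℂ V :=
  LinearMap.snd ℂ _ _ ∘ₗ LinearMap.snd ℂ _ _ ∘ₗ (trialityAlgebra V).toSubmodule.subtype

section
variable (θ η : trialityAlgebra V) (u v x y z : V)

lemma skew₁ : form (comp₁ θ x) y = -form x (comp₁ θ y) := θ.2.1 x y
lemma skew₂ : form (comp₂ θ x) y = -form x (comp₂ θ y) := θ.2.2.1 x y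
lemma skew₃ : form (comp₃ θ x) y = -form x (comp₃ θ y) := θ.2.2.2.1 x y

lemma comp₃_mul : comp₃ θ (mul x y) = mul (comp₁ θ x) y + mul x (comp₂ θ y) := θ.2.2.2.2 x y

lemma comp₁_mul : comp₁ θ (mul x (conj y)) =
    mul (comp₃ θ x) (conj y) + mul x (conj (comp₂ θ y)) := by
  refine ext_form fun w => ?_
  have h := congrArg (form x) (comp₃_mul θ w y)
  simp only [LinearMap.map_add, LinearMap.map_sub, LinearMap.map_neg, LinearMap.add_apply, LinearMap.sub_apply,
    LinearMap.neg_apply] at h ⊢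
  rw [skew₁, form_mul_adj_right, conj_conj, form_mul_adj_right, conj_conj, form_mul_adj_right,
    conj_conj, skew₃, h]
  ring

lemma comp₂_mul : comp₂ θ (mul (conj x) y) =
    mul (conj (comp₁ θ x)) y + mul (conj x) (comp₃ θ y) := by
  refine ext_form fun w => ?_
  have h := congrArg (form y) (comp₃_mul θ x w)
  simp only [LinearMap.map_add, LinearMap.add_apply] at h ⊢
  rw [skew₂, form_mul_adj_left, conj_conj, form_mul_adj_left, conj_conj, form_mul_adj_left,
    conj_conj, skew₃, h]
  ring

lemma comp₁_lie : comp₁ ⁅θ, η⁆ = ⁅comp₁ θ, comp₁ η⁆ := rfl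
lemma comp₂_lie : comp₂ ⁅θ, η⁆ = ⁅comp₂ θ, comp₂ η⁆ := rfl
lemma comp₃_lie : comp₃ ⁅θ, η⁆ = ⁅comp₃ θ, comp₃ η⁆ := rfl

end

variable {θ η : trialityAlgebra V}

lemma triality_ext (h1 : ∀ z, comp₁ θ z = comp₁ η z) (h2 : ∀ z, comp₂ θ z = comp₂ η z)
    (h3 : ∀ z, comp₃ θ z = comp₃ η z) : θ = η :=
  Subtype.ext (Prod.ext (LinearMap.ext h1) (Prod.ext (LinearMap.ext h2) (LinearMap.ext h3)))

/-- The rotation `z ↦ 4 ((u, z) v - (v, z) u)` of `so(V)`. -/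
def rot (u v : V) : Module.End ℂ V :=
  (4 : ℂ) • ((form u).smulRight v - (form v).smulRight u)

/-- `z ↦ v (ū z) - u (v̄ z)` -/
def opA (u v : V) : Module.End ℂ V := mul v ∘ₗ mul (conj u) - mul u ∘ₗ mul (conj v)

/-- `z ↦ v̄ (u z) - ū (v z)` -/
def opB (u v : V) : Module.End ℂ V := mul (conj v) ∘ₗ mul u - mul (conj u) ∘ₗ mul v

/-- `z ↦ (z ū) v - (z v̄) u` -/
def opC (u v : V) : Module.End ℂ V :=
  mul.flip v ∘ₗ mul.flip (conj u) - mul.flip u ∘ₗ mul.flip (conj v)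

/-- `z ↦ (z u) v̄ - (z v) ū` -/
def opD (u v : V) : Module.End ℂ V :=
  mul.flip (conj v) ∘ₗ mul.flip u - mul.flip (conj u) ∘ₗ mul.flip v

section
variable (u v x y z : V)

lemma rot_apply : rot u v z = (4 * form u z) • v - (4 * form v z) • u := by
  simp [rot, smul_sub, mul_smul]
lemma opA_apply : opA u v z = mul v (mul (conj u) z) - mul u (mul (conj v) z) := rfl
lemma opB_apply : opB u v z = mul (conj v) (mul u z) - mul (conj u) (mul v z) := rfl
lemma opC_apply : opC u v z = mul (mul z (conj u)) v - mul (mul z (conj v)) u := rfl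
lemma opD_apply : opD u v z = mul (mul z u) (conj v) - mul (mul z v) (conj u) := rfl

lemma isSkew_rot : IsSkew (rot u v) := by
  intro x y
  simp only [rot_apply, LinearMap.map_sub, LinearMap.map_smul, LinearMap.sub_apply, LinearMap.smul_apply, smul_eq_mul]
  rw [form_symm x v, form_symm x u]; ring

lemma isSkew_opA : IsSkew (opA u v) := by
  intro x y
  simp only [opA_apply, LinearMap.map_sub, LinearMap.sub_apply]
  rw [form_mul_adj_left v, form_mul_adj_left (conj u), form_mul_adj_left u,
    form_mul_adj_left (conj v)]
  simp only [conj_conj]; ring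

lemma isSkew_opB : IsSkew (opB u v) := by
  intro x y
  simp only [opB_apply, LinearMap.map_sub, LinearMap.sub_apply]
  rw [form_mul_adj_left (conj v), form_mul_adj_left u, form_mul_adj_left (conj u),
    form_mul_adj_left v]
  simp only [conj_conj]; ring

lemma isSkew_opC : IsSkew (opC u v) := by
  intro x y
  simp only [opC_apply, LinearMap.map_sub, LinearMap.sub_apply]
  rw [form_mul_adj_right _ v, form_mul_adj_right _ (conj u), form_mul_adj_right _ u,
    form_mul_adj_right _ (conj v)]
  simp only [conj_conj]; ring

lemma isSkew_opD : IsSkew (opD u v) := by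
  intro x y
  simp only [opD_apply, LinearMap.map_sub, LinearMap.sub_apply]
  rw [form_mul_adj_right _ (conj v), form_mul_adj_right _ u, form_mul_adj_right _ (conj u),
    form_mul_adj_right _ v]
  simp only [conj_conj]; ring

/-- `ū(xy) = 2(u,x) y - x̄(uy)` -/
lemma conj_mul_mul' : mul (conj u) (mul x y) = (2 * form u x) • y - mul (conj x) (mul u y) :=
  eq_sub_of_add_eq (conj_mul_mul u x y)
lemma mul_mul_conj_eq : mul (mul x y) (conj u) = (2 * form y u) • x - mul (mul x u) (conj y) :=
  eq_sub_of_add_eq (mul_mul_conj y u x)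
lemma mul_conj_mul_eq : mul u (mul (conj x) y) = (2 * form u x) • y - mul x (mul (conj u) y) :=
  eq_sub_of_add_eq (mul_conj_mul u x y)
lemma mul_conj_mul_eq' : mul (mul x (conj y)) u = (2 * form y u) • x - mul (mul x (conj u)) y :=
  eq_sub_of_add_eq (mul_conj_mul' y u x)

lemma triality₁ : opA u v (mul x y) = mul (rot u v x) y + mul x (opB u v y) := by
  have e : ∀ u v : V, mul v (mul (conj u) (mul x y)) =
      (2 * form u x) • mul v y - (2 * form v x) • mul u y + mul x (mul (conj v) (mul u y)) := by
    intro u v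
    rw [conj_mul_mul', LinearMap.map_sub, LinearMap.map_smul, mul_conj_mul_eq v x (mul u y)]
    module
  rw [opA_apply, e, e v u, opB_apply, rot_apply]
  simp only [LinearMap.map_sub, LinearMap.map_smul, LinearMap.sub_apply, LinearMap.smul_apply]
  module

lemma triality₂ : opC u v (mul x y) = mul (opD u v x) y + mul x (rot u v y) := by
  have e : ∀ u v : V, mul (mul (mul x y) (conj u)) v =
      (2 * form u y) • mul x v - (2 * form v y) • mul x u + mul (mul (mul x u) (conj v)) y := by
    intro u v
    rw [mul_mul_conj_eq, LinearMap.map_sub, LinearMap.map_smul, LinearMap.sub_apply, LinearMap.smul_apply,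
      mul_conj_mul_eq' v (mul x u) y, form_symm y u, form_symm y v]
    module
  rw [opC_apply, e, e v u, opD_apply, rot_apply]
  simp only [LinearMap.map_sub, LinearMap.map_smul, LinearMap.sub_apply]
  module

lemma triality₃ : rot u v (mul x y) = mul (opA u v x) y + mul x (opC u v y) := by
  refine ext_form fun w => ?_
  have e : ∀ u v : V, form (mul (mul v (mul (conj u) x)) y) w + form (mul x (mul (mul y (conj u)) v)) w
      = 4 * form v w * form u (mul x y) - form (mul v (conj y)) (mul w (mul (conj u) x))
        - form (mul u (conj y)) (mul w (mul (conj v) x)) := by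
    intro u v
    have h1 := form_mul_mul v (mul (conj u) x) w (conj y)
    have h2 := form_mul_mul (mul y (conj u)) v (conj x) w
    have h3 : form (mul (conj u) x) (conj y) = form u (mul x y) := by
      rw [form_mul_adj_left, conj_conj, form_right_adj_right, conj_conj, form_symm]
    have h4 : form (mul y (conj u)) (conj x) = form u (mul x y) := by
      rw [← form_conj_conj, conj_mul, conj_conj, conj_conj, form_mul_adj_right, conj_conj]
    have h5 : form (mul (mul y (conj u)) w) (mul (conj x) v) =
        form (mul u (conj y)) (mul w (mul (conj v) x)) := by
      rw [form_right_adj_left w, ← form_conj_conj]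
      simp only [conj_mul, conj_conj]
    rw [form_mul_adj_right _ y, form_mul_adj_left x]
    rw [h3] at h1
    rw [h4, h5] at h2
    linear_combination h1 + h2
  have h1 := e u v
  have h2 := e v u
  simp only [opA_apply, opC_apply, rot_apply, LinearMap.map_add, LinearMap.map_sub, LinearMap.map_smul, LinearMap.add_apply,
    LinearMap.sub_apply, LinearMap.smul_apply, smul_eq_mul]
  linear_combination h2 - h1

end

/-- The values of the map `Ψ₁` below. -/
def psi₁Aux (u v : V) : trialityAlgebra V :=
  ⟨(rot u v, opB u v, opA u v), isSkew_rot u v, isSkew_opB u v, isSkew_opA u v, triality₁ u v⟩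

lemma comp₁_psi₁Aux (u v : V) : comp₁ (psi₁Aux u v) = rot u v := rfl
lemma comp₂_psi₁Aux (u v : V) : comp₂ (psi₁Aux u v) = opB u v := rfl
lemma comp₃_psi₁Aux (u v : V) : comp₃ (psi₁Aux u v) = opA u v := rfl

/-- The map `Ψ₁ : Λ²V → t(V)`, dual to the action of `t(V)` on the first copy of `V`. -/
def psi₁ : V →ₗ[ℂ] V →ₗ[ℂ] trialityAlgebra V :=
  LinearMap.mk₂ ℂ psi₁Aux
    (by
      intro a b c
      apply triality_ext <;> intro z <;>
      simp only [LinearMap.map_add, LinearMap.map_smul, LinearMap.add_apply, LinearMap.smul_apply, smul_eq_mul,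
        comp₁_psi₁Aux, comp₂_psi₁Aux, comp₃_psi₁Aux, rot_apply, opB_apply, opA_apply] <;>
      module)
    (by
      intro a b c
      apply triality_ext <;> intro z <;>
      simp only [LinearMap.map_add, LinearMap.map_smul, LinearMap.add_apply, LinearMap.smul_apply, smul_eq_mul,
        comp₁_psi₁Aux, comp₂_psi₁Aux, comp₃_psi₁Aux, rot_apply, opB_apply, opA_apply] <;>
      module)
    (by
      intro a b c
      apply triality_ext <;> intro z <;>
      simp only [LinearMap.map_add, LinearMap.map_smul, LinearMap.add_apply, LinearMap.smul_apply, smul_eq_mul,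
        comp₁_psi₁Aux, comp₂_psi₁Aux, comp₃_psi₁Aux, rot_apply, opB_apply, opA_apply] <;>
      module)
    (by
      intro a b c
      apply triality_ext <;> intro z <;>
      simp only [LinearMap.map_add, LinearMap.map_smul, LinearMap.add_apply, LinearMap.smul_apply, smul_eq_mul,
        comp₁_psi₁Aux, comp₂_psi₁Aux, comp₃_psi₁Aux, rot_apply, opB_apply, opA_apply] <;>
      module)

lemma comp₁_psi₁ (u v : V) : comp₁ (psi₁ u v) = rot u v := rfl
lemma comp₂_psi₁ (u v : V) : comp₂ (psi₁ u v) = opB u v := rfl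
lemma comp₃_psi₁ (u v : V) : comp₃ (psi₁ u v) = opA u v := rfl

/-- The values of the map `Ψ₂` below. -/
def psi₂Aux (u v : V) : trialityAlgebra V :=
  ⟨(opD u v, rot u v, opC u v), isSkew_opD u v, isSkew_rot u v, isSkew_opC u v, triality₂ u v⟩

lemma comp₁_psi₂Aux (u v : V) : comp₁ (psi₂Aux u v) = opD u v := rfl
lemma comp₂_psi₂Aux (u v : V) : comp₂ (psi₂Aux u v) = rot u v := rfl
lemma comp₃_psi₂Aux (u v : V) : comp₃ (psi₂Aux u v) = opC u v := rfl

/-- The map `Ψ₂ : Λ²V → t(V)`, dual to the action of `t(V)` on the second copy of `V`. -/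
def psi₂ : V →ₗ[ℂ] V →ₗ[ℂ] trialityAlgebra V :=
  LinearMap.mk₂ ℂ psi₂Aux
    (by
      intro a b c
      apply triality_ext <;> intro z <;>
      simp only [LinearMap.map_add, LinearMap.map_smul, LinearMap.add_apply, LinearMap.smul_apply, smul_eq_mul,
        comp₁_psi₂Aux, comp₂_psi₂Aux, comp₃_psi₂Aux, opD_apply, rot_apply, opC_apply] <;>
      module)
    (by
      intro a b c
      apply triality_ext <;> intro z <;>
      simp only [LinearMap.map_add, LinearMap.map_smul, LinearMap.add_apply, LinearMap.smul_apply, smul_eq_mul,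
        comp₁_psi₂Aux, comp₂_psi₂Aux, comp₃_psi₂Aux, opD_apply, rot_apply, opC_apply] <;>
      module)
    (by
      intro a b c
      apply triality_ext <;> intro z <;>
      simp only [LinearMap.map_add, LinearMap.map_smul, LinearMap.add_apply, LinearMap.smul_apply, smul_eq_mul,
        comp₁_psi₂Aux, comp₂_psi₂Aux, comp₃_psi₂Aux, opD_apply, rot_apply, opC_apply] <;>
      module)
    (by
      intro a b c
      apply triality_ext <;> intro z <;>
      simp only [LinearMap.map_add, LinearMap.map_smul, LinearMap.add_apply, LinearMap.smul_apply, smul_eq_mul,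
        comp₁_psi₂Aux, comp₂_psi₂Aux, comp₃_psi₂Aux, opD_apply, rot_apply, opC_apply] <;>
      module)

lemma comp₁_psi₂ (u v : V) : comp₁ (psi₂ u v) = opD u v := rfl
lemma comp₂_psi₂ (u v : V) : comp₂ (psi₂ u v) = rot u v := rfl
lemma comp₃_psi₂ (u v : V) : comp₃ (psi₂ u v) = opC u v := rfl

/-- The values of the map `Ψ₃` below. -/
def psi₃Aux (u v : V) : trialityAlgebra V :=
  ⟨(opA u v, opC u v, rot u v), isSkew_opA u v, isSkew_opC u v, isSkew_rot u v, triality₃ u v⟩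

lemma comp₁_psi₃Aux (u v : V) : comp₁ (psi₃Aux u v) = opA u v := rfl
lemma comp₂_psi₃Aux (u v : V) : comp₂ (psi₃Aux u v) = opC u v := rfl
lemma comp₃_psi₃Aux (u v : V) : comp₃ (psi₃Aux u v) = rot u v := rfl

/-- The map `Ψ₃ : Λ²V → t(V)`, dual to the action of `t(V)` on the third copy of `V`. -/
def psi₃ : V →ₗ[ℂ] V →ₗ[ℂ] trialityAlgebra V :=
  LinearMap.mk₂ ℂ psi₃Aux
    (by
      intro a b c
      apply triality_ext <;> intro z <;>
      simp only [LinearMap.map_add, LinearMap.map_smul, LinearMap.add_apply, LinearMap.smul_apply, smul_eq_mul,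
        comp₁_psi₃Aux, comp₂_psi₃Aux, comp₃_psi₃Aux, opA_apply, opC_apply, rot_apply] <;>
      module)
    (by
      intro a b c
      apply triality_ext <;> intro z <;>
      simp only [LinearMap.map_add, LinearMap.map_smul, LinearMap.add_apply, LinearMap.smul_apply, smul_eq_mul,
        comp₁_psi₃Aux, comp₂_psi₃Aux, comp₃_psi₃Aux, opA_apply, opC_apply, rot_apply] <;>
      module)
    (by
      intro a b c
      apply triality_ext <;> intro z <;>
      simp only [LinearMap.map_add, LinearMap.map_smul, LinearMap.add_apply, LinearMap.smul_apply, smul_eq_mul,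
        comp₁_psi₃Aux, comp₂_psi₃Aux, comp₃_psi₃Aux, opA_apply, opC_apply, rot_apply] <;>
      module)
    (by
      intro a b c
      apply triality_ext <;> intro z <;>
      simp only [LinearMap.map_add, LinearMap.map_smul, LinearMap.add_apply, LinearMap.smul_apply, smul_eq_mul,
        comp₁_psi₃Aux, comp₂_psi₃Aux, comp₃_psi₃Aux, opA_apply, opC_apply, rot_apply] <;>
      module)

lemma comp₁_psi₃ (u v : V) : comp₁ (psi₃ u v) = opA u v := rfl
lemma comp₂_psi₃ (u v : V) : comp₂ (psi₃ u v) = opC u v := rfl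
lemma comp₃_psi₃ (u v : V) : comp₃ (psi₃ u v) = rot u v := rfl

lemma psi₁_swap (u v : V) : psi₁ u v = -psi₁ v u := by
  apply triality_ext <;> intro z <;>
  simp only [LinearMap.map_neg, LinearMap.neg_apply, comp₁_psi₁, comp₂_psi₁, comp₃_psi₁, rot_apply, opA_apply, opB_apply] <;>
  module

lemma psi₂_swap (u v : V) : psi₂ u v = -psi₂ v u := by
  apply triality_ext <;> intro z <;>
  simp only [LinearMap.map_neg, LinearMap.neg_apply, comp₁_psi₂, comp₂_psi₂, comp₃_psi₂, rot_apply, opC_apply, opD_apply] <;>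
  module

lemma psi₃_swap (u v : V) : psi₃ u v = -psi₃ v u := by
  apply triality_ext <;> intro z <;>
  simp only [LinearMap.map_neg, LinearMap.neg_apply, comp₁_psi₃, comp₂_psi₃, comp₃_psi₃, rot_apply, opA_apply, opC_apply] <;>
  module

lemma lie_end_apply (f g : Module.End ℂ V) (z : V) : ⁅f, g⁆ z = f (g z) - g (f z) := rfl

lemma lie_psi₁ (θ : trialityAlgebra V) (u v : V) :
    ⁅θ, psi₁ u v⁆ = psi₁ (comp₁ θ u) v + psi₁ u (comp₁ θ v) := by
  apply triality_ext <;> intro z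
  · simp only [comp₁_lie, LinearMap.map_add, LinearMap.add_apply, comp₁_psi₁, lie_end_apply, rot_apply,
      LinearMap.map_sub, LinearMap.map_smul, skew₁ θ _ z]
    module
  · simp only [comp₂_lie, LinearMap.map_add, LinearMap.add_apply, comp₂_psi₁, lie_end_apply, opB_apply,
      LinearMap.map_sub, comp₂_mul, comp₃_mul]
    abel
  · simp only [comp₃_lie, LinearMap.map_add, LinearMap.add_apply, comp₃_psi₁, lie_end_apply, opA_apply,
      LinearMap.map_sub, comp₂_mul, comp₃_mul]
    abel

lemma lie_psi₂ (θ : trialityAlgebra V) (u v : V) :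
    ⁅θ, psi₂ u v⁆ = psi₂ (comp₂ θ u) v + psi₂ u (comp₂ θ v) := by
  apply triality_ext <;> intro z
  · simp only [comp₁_lie, LinearMap.map_add, LinearMap.add_apply, comp₁_psi₂, lie_end_apply, opD_apply,
      LinearMap.map_sub, comp₁_mul, comp₃_mul]
    abel
  · simp only [comp₂_lie, LinearMap.map_add, LinearMap.add_apply, comp₂_psi₂, lie_end_apply, rot_apply,
      LinearMap.map_sub, LinearMap.map_smul, skew₂ θ _ z]
    module
  · simp only [comp₃_lie, LinearMap.map_add, LinearMap.add_apply, comp₃_psi₂, lie_end_apply, opC_apply,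
      LinearMap.map_sub, comp₁_mul, comp₃_mul]
    abel

lemma opA_eq (u v z : V) : opA u v z =
    mul v (conj (mul (conj z) u)) - mul u (conj (mul (conj z) v)) := by
  simp only [opA_apply, conj_mul, conj_conj]

lemma opC_eq (u v z : V) : opC u v z =
    mul (conj (mul u (conj z))) v - mul (conj (mul v (conj z))) u := by
  simp only [opC_apply, conj_mul, conj_conj]

lemma lie_psi₃ (θ : trialityAlgebra V) (u v : V) :
    ⁅θ, psi₃ u v⁆ = psi₃ (comp₃ θ u) v + psi₃ u (comp₃ θ v) := by
  apply triality_ext <;> intro z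
  · simp only [comp₁_lie, LinearMap.map_add, LinearMap.add_apply, comp₁_psi₃, lie_end_apply, opA_eq,
      LinearMap.map_sub, comp₁_mul, comp₂_mul]
    abel
  · simp only [comp₂_lie, LinearMap.map_add, LinearMap.add_apply, comp₂_psi₃, lie_end_apply, opC_eq,
      LinearMap.map_sub, comp₁_mul, comp₂_mul]
    abel
  · simp only [comp₃_lie, LinearMap.map_add, LinearMap.add_apply, comp₃_psi₃, lie_end_apply, rot_apply,
      LinearMap.map_sub, LinearMap.map_smul, skew₃ θ _ z]
    module

lemma rot_opA_opC (a b c z : V) :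
    rot (mul a b) c z + opA (mul c (conj b)) a z + opC (mul (conj a) c) b z = 0 := by
  have e1 : mul a (mul (mul b (conj c)) z) + mul (mul z (mul (conj c) a)) b =
      (2 * form c z) • mul a b - (2 * form (mul a b) z) • c + (2 * form c (mul a b)) • z := by
    refine ext_form fun w => ?_
    simp only [LinearMap.map_add, LinearMap.map_sub, LinearMap.map_smul, LinearMap.add_apply, LinearMap.sub_apply,
      LinearMap.smul_apply, smul_eq_mul]
    have h1 := form_mul_mul z (mul (conj c) a) w (conj b)
    have h2 : form (mul (conj c) a) (conj b) = form c (mul a b) := by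
      rw [form_mul_adj_right, form_conj, conj_mul, conj_conj, conj_conj]
    have h3 := form_mul_mul b (conj c) (mul (conj a) w) (conj z)
    have h4 : form b (mul (conj a) w) = form (mul a b) w := (form_mul_adj_left a b w).symm
    have h5 : form (mul z (conj b)) (mul w (mul (conj c) a)) =
        form (mul b (conj z)) (mul (mul (conj a) c) (conj w)) := by
      rw [← form_conj_conj]; simp only [conj_mul, conj_conj]
    have h6 := congrArg (form (mul b (conj z))) (mul_mul_conj c w (conj a))
    have h7 : form (mul b (conj z)) (conj a) = form (mul a b) z := by
      rw [form_mul_adj_right, conj_conj, form_mul_adj_left]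
    simp only [LinearMap.map_add, LinearMap.map_smul, smul_eq_mul, h7] at h6
    rw [h2] at h1
    rw [h4, form_conj_conj] at h3
    rw [form_mul_adj_left a, form_mul_adj_right _ z, form_mul_adj_right _ b]
    linear_combination h1 + h3 - h5 - h6
  have e2 : mul (mul c (conj b)) (mul (conj a) z) + mul (mul z (conj b)) (mul (conj a) c) =
      (2 * form c (mul a b)) • z + (2 * form (mul a b) z) • c - (2 * form c z) • mul a b := by
    refine ext_form fun w => ?_
    have h : ∀ z c : V, form (mul (mul c (conj b)) (mul (conj a) z)) w =
        2 * form c w * form (mul a b) z - form (mul c (mul (conj z) a)) (mul w (conj b)) := by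
      intro z c
      have h1 := form_mul_mul c (conj b) w (mul (conj z) a)
      have h2 : form (conj b) (mul (conj z) a) = form (mul a b) z := by
        rw [← form_conj_conj, conj_mul, conj_conj, conj_conj, ← form_mul_adj_left]
      rw [h2] at h1
      rw [form_mul_adj_right, conj_mul, conj_conj]
      linear_combination h1
    have h3 := congrArg (fun t => form t (mul w (conj b))) (mul_conj_mul c z a)
    have h4 : form a (mul w (conj b)) = form (mul a b) w := (form_mul_adj_right a b w).symm
    simp only [LinearMap.map_add, LinearMap.map_sub, LinearMap.map_smul, LinearMap.add_apply, LinearMap.sub_apply,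
      LinearMap.smul_apply, smul_eq_mul, h4] at h3 ⊢
    rw [h z c, h c z, form_symm c (mul a b)]
    linear_combination -h3
  rw [rot_apply, opA_apply, opC_apply]
  simp only [conj_mul, conj_conj]
  linear_combination (norm := module) e1 - e2

lemma psi_cyclic (a b c : V) :
    psi₃ (mul a b) c + psi₁ (mul c (conj b)) a + psi₂ (mul (conj a) c) b = 0 := by
  apply triality_ext <;> intro z
  · have h := rot_opA_opC c (conj b) a z
    simp only [LinearMap.map_add, LinearMap.map_zero, LinearMap.add_apply, LinearMap.zero_apply, comp₁_psi₁,
      comp₁_psi₂, comp₁_psi₃, opA_apply, opC_apply, opD_apply, conj_mul, conj_conj] at h ⊢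
    linear_combination (norm := module) h
  · have h := rot_opA_opC (conj a) c b z
    simp only [LinearMap.map_add, LinearMap.map_zero, LinearMap.add_apply, LinearMap.zero_apply, comp₂_psi₁,
      comp₂_psi₂, comp₂_psi₃, opA_apply, opC_apply, opB_apply, conj_mul, conj_conj] at h ⊢
    linear_combination (norm := module) h
  · simpa only [LinearMap.map_add, LinearMap.map_zero, LinearMap.add_apply, LinearMap.zero_apply, comp₃_psi₁,
      comp₃_psi₂, comp₃_psi₃, ← add_assoc] using rot_opA_opC a b c z

end Basic
end HurwitzAlgebra

open HurwitzAlgebra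

section Model

variable (A B : Type) [AddCommGroup A] [Module ℂ A] [HurwitzAlgebra A]
  [AddCommGroup B] [Module ℂ B] [HurwitzAlgebra B]

attribute [local instance] LieRing.ofAssociativeRing

/-- The triality model
`g̃(A, B) = t(A) × t(B) ⊕ (A₁ ⊗ B₁) ⊕ (A₂ ⊗ B₂) ⊕ (A₃ ⊗ B₃)`, where `Aᵢ`, `Bᵢ` denote
`A`, `B` with the action of the `i`-th component of a triality. -/
@[ext]
structure TrialityModel where
  /-- the component in `t(A) × t(B)` -/
  tri : trialityAlgebra A × trialityAlgebra B
  /-- the component in `A₁ ⊗ B₁` -/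
  one : A ⊗[ℂ] B
  /-- the component in `A₂ ⊗ B₂` -/
  two : A ⊗[ℂ] B
  /-- the component in `A₃ ⊗ B₃` -/
  three : A ⊗[ℂ] B

namespace TrialityModel

/-- The vector space structure of the triality model is that of a direct sum. -/
def equivProd : TrialityModel A B ≃
    (trialityAlgebra A × trialityAlgebra B) × (A ⊗[ℂ] B) × (A ⊗[ℂ] B) × (A ⊗[ℂ] B) where
  toFun x := (x.tri, x.one, x.two, x.three)
  invFun p := ⟨p.1, p.2.1, p.2.2.1, p.2.2.2⟩

instance : AddCommGroup (TrialityModel A B) := (equivProd A B).addCommGroup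

instance : Module ℂ (TrialityModel A B) := (equivProd A B).module ℂ

instance [Module.Finite ℂ A] [Module.Finite ℂ B] : Module.Finite ℂ (TrialityModel A B) :=
  haveI : Module.Finite ℂ (trialityAlgebra A) :=
    inferInstanceAs (Module.Finite ℂ (trialityAlgebra A).toSubmodule)
  haveI : Module.Finite ℂ (trialityAlgebra B) :=
    inferInstanceAs (Module.Finite ℂ (trialityAlgebra B).toSubmodule)
  Module.Finite.equiv ((equivProd A B).linearEquiv ℂ).symm

variable {A B}

/-- The action of `t(A) × t(B)` on `A₁ ⊗ B₁`. -/
def act₁ : trialityAlgebra A × trialityAlgebra B →ₗ[ℂ] Module.End ℂ (A ⊗[ℂ] B) :=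
  (LinearMap.rTensorHom B ∘ₗ comp₁).coprod (LinearMap.lTensorHom A ∘ₗ comp₁)

/-- The action of `t(A) × t(B)` on `A₂ ⊗ B₂`. -/
def act₂ : trialityAlgebra A × trialityAlgebra B →ₗ[ℂ] Module.End ℂ (A ⊗[ℂ] B) :=
  (LinearMap.rTensorHom B ∘ₗ comp₂).coprod (LinearMap.lTensorHom A ∘ₗ comp₂)

/-- The action of `t(A) × t(B)` on `A₃ ⊗ B₃`. -/
def act₃ : trialityAlgebra A × trialityAlgebra B →ₗ[ℂ] Module.End ℂ (A ⊗[ℂ] B) :=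
  (LinearMap.rTensorHom B ∘ₗ comp₃).coprod (LinearMap.lTensorHom A ∘ₗ comp₃)

/-- The product `(A₁ ⊗ B₁) × (A₂ ⊗ B₂) → A₃ ⊗ B₃`, `(x, y) ↦ xy`. -/
def prod₁₂ : A ⊗[ℂ] B →ₗ[ℂ] A ⊗[ℂ] B →ₗ[ℂ] A ⊗[ℂ] B := TensorProduct.map₂ mul mul

/-- The product `(A₂ ⊗ B₂) × (A₃ ⊗ B₃) → A₁ ⊗ B₁`, `(x, y) ↦ y x̄`. -/
def prod₂₃ : A ⊗[ℂ] B →ₗ[ℂ] A ⊗[ℂ] B →ₗ[ℂ] A ⊗[ℂ] B :=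
  TensorProduct.map₂ (mul.flip ∘ₗ conj) (mul.flip ∘ₗ conj)

/-- The product `(A₃ ⊗ B₃) × (A₁ ⊗ B₁) → A₂ ⊗ B₂`, `(x, y) ↦ ȳ x`. -/
def prod₃₁ : A ⊗[ℂ] B →ₗ[ℂ] A ⊗[ℂ] B →ₗ[ℂ] A ⊗[ℂ] B :=
  TensorProduct.map₂ (mul ∘ₗ conj).flip (mul ∘ₗ conj).flip

/-- For bilinear maps `f : A × A → t(A)` and `g : B × B → t(B)`, the bilinear map
`(a ⊗ b, a' ⊗ b') ↦ ((b, b') f(a, a'), (a, a') g(b, b'))`. -/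
def pairing (f : A →ₗ[ℂ] A →ₗ[ℂ] trialityAlgebra A) (g : B →ₗ[ℂ] B →ₗ[ℂ] trialityAlgebra B) :
    A ⊗[ℂ] B →ₗ[ℂ] A ⊗[ℂ] B →ₗ[ℂ] trialityAlgebra A × trialityAlgebra B :=
  (TensorProduct.map₂ f form).compr₂
      (LinearMap.inl ℂ _ _ ∘ₗ (TensorProduct.rid ℂ (trialityAlgebra A)).toLinearMap) +
    (TensorProduct.map₂ form g).compr₂
      (LinearMap.inr ℂ _ _ ∘ₗ (TensorProduct.lid ℂ (trialityAlgebra B)).toLinearMap)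

/-- The bracket `(A₁ ⊗ B₁) × (A₁ ⊗ B₁) → t(A) × t(B)`. -/
def pair₁ : A ⊗[ℂ] B →ₗ[ℂ] A ⊗[ℂ] B →ₗ[ℂ] trialityAlgebra A × trialityAlgebra B :=
  pairing psi₁ psi₁

/-- The bracket `(A₂ ⊗ B₂) × (A₂ ⊗ B₂) → t(A) × t(B)`. -/
def pair₂ : A ⊗[ℂ] B →ₗ[ℂ] A ⊗[ℂ] B →ₗ[ℂ] trialityAlgebra A × trialityAlgebra B :=
  pairing psi₂ psi₂

/-- The bracket `(A₃ ⊗ B₃) × (A₃ ⊗ B₃) → t(A) × t(B)`. -/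
def pair₃ : A ⊗[ℂ] B →ₗ[ℂ] A ⊗[ℂ] B →ₗ[ℂ] trialityAlgebra A × trialityAlgebra B :=
  pairing psi₃ psi₃

section Identities

variable (θ η : trialityAlgebra A × trialityAlgebra B) (a a' : A) (b b' : B)
  (x y z : A ⊗[ℂ] B)

lemma act₁_tmul : act₁ θ (a ⊗ₜ b) = comp₁ θ.1 a ⊗ₜ b + a ⊗ₜ comp₁ θ.2 b := by simp [act₁]
lemma act₂_tmul : act₂ θ (a ⊗ₜ b) = comp₂ θ.1 a ⊗ₜ b + a ⊗ₜ comp₂ θ.2 b := by simp [act₂]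
lemma act₃_tmul : act₃ θ (a ⊗ₜ b) = comp₃ θ.1 a ⊗ₜ b + a ⊗ₜ comp₃ θ.2 b := by simp [act₃]

lemma prod₁₂_tmul : prod₁₂ (a ⊗ₜ b) (a' ⊗ₜ b') = mul a a' ⊗ₜ mul b b' := rfl
lemma prod₂₃_tmul :
    prod₂₃ (a ⊗ₜ b) (a' ⊗ₜ b') = mul a' (conj a) ⊗ₜ mul b' (conj b) := rfl
lemma prod₃₁_tmul :
    prod₃₁ (a ⊗ₜ b) (a' ⊗ₜ b') = mul (conj a') a ⊗ₜ mul (conj b') b := rfl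

lemma pairing_tmul (f : A →ₗ[ℂ] A →ₗ[ℂ] trialityAlgebra A)
    (g : B →ₗ[ℂ] B →ₗ[ℂ] trialityAlgebra B) : pairing f g (a ⊗ₜ b) (a' ⊗ₜ b') =
    (form b b' • f a a', form a a' • g b b') := by
  simp [pairing]

lemma pair₁_tmul : pair₁ (a ⊗ₜ b) (a' ⊗ₜ b') = (form b b' • psi₁ a a', form a a' • psi₁ b b') :=
  pairing_tmul ..
lemma pair₂_tmul : pair₂ (a ⊗ₜ b) (a' ⊗ₜ b') = (form b b' • psi₂ a a', form a a' • psi₂ b b') :=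
  pairing_tmul ..
lemma pair₃_tmul : pair₃ (a ⊗ₜ b) (a' ⊗ₜ b') = (form b b' • psi₃ a a', form a a' • psi₃ b b') :=
  pairing_tmul ..

/-- Reduction of identities to pure tensors. -/
lemma ind₁ {P : A ⊗[ℂ] B → Prop} (h0 : P 0) (hadd : ∀ x y, P x → P y → P (x + y))
    (h : ∀ a b, P (a ⊗ₜ b)) : ∀ x, P x := fun x =>
  TensorProduct.induction_on x h0 h hadd

lemma act₁_lie : act₁ ⁅θ, η⁆ x = act₁ θ (act₁ η x) - act₁ η (act₁ θ x) := by
  revert x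
  refine ind₁ ?_ (fun x y hx hy => ?_) (fun a b => ?_)
  · simp
  · simp only [LinearMap.map_add, hx, hy]; abel
  simp only [act₁_tmul, LinearMap.map_add, LieAlgebra.Prod.bracket_apply, comp₁_lie, lie_end_apply,
    TensorProduct.sub_tmul, TensorProduct.tmul_sub]
  abel

lemma act₂_lie : act₂ ⁅θ, η⁆ x = act₂ θ (act₂ η x) - act₂ η (act₂ θ x) := by
  revert x
  refine ind₁ ?_ (fun x y hx hy => ?_) (fun a b => ?_)
  · simp
  · simp only [LinearMap.map_add, hx, hy]; abel
  simp only [act₂_tmul, LinearMap.map_add, LieAlgebra.Prod.bracket_apply, comp₂_lie, lie_end_apply,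
    TensorProduct.sub_tmul, TensorProduct.tmul_sub]
  abel

lemma act₃_lie : act₃ ⁅θ, η⁆ x = act₃ θ (act₃ η x) - act₃ η (act₃ θ x) := by
  revert x
  refine ind₁ ?_ (fun x y hx hy => ?_) (fun a b => ?_)
  · simp
  · simp only [LinearMap.map_add, hx, hy]; abel
  simp only [act₃_tmul, LinearMap.map_add, LieAlgebra.Prod.bracket_apply, comp₃_lie, lie_end_apply,
    TensorProduct.sub_tmul, TensorProduct.tmul_sub]
  abel

/-- Two bilinear maps agreeing on pure tensors are equal. -/
lemma ind₂ {P : A ⊗[ℂ] B → A ⊗[ℂ] B → Prop} (h0 : ∀ y, P 0 y) (h0' : ∀ x, P x 0)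
    (hadd : ∀ x x' y, P x y → P x' y → P (x + x') y)
    (hadd' : ∀ x y y', P x y → P x y' → P x (y + y'))
    (h : ∀ a b a' b', P (a ⊗ₜ b) (a' ⊗ₜ b')) : ∀ x y, P x y := fun x y =>
  ind₁ (P := fun x => P x y) (h0 y) (fun x x' => hadd x x' y)
    (fun a b => ind₁ (h0' _) (hadd' _) (fun a' b' => h a b a' b') y) x

lemma ind₃ {P : A ⊗[ℂ] B → A ⊗[ℂ] B → A ⊗[ℂ] B → Prop} (h0 : ∀ y z, P 0 y z)
    (h0' : ∀ x z, P x 0 z) (h0'' : ∀ x y, P x y 0)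
    (hadd : ∀ x x' y z, P x y z → P x' y z → P (x + x') y z)
    (hadd' : ∀ x y y' z, P x y z → P x y' z → P x (y + y') z)
    (hadd'' : ∀ x y z z', P x y z → P x y z' → P x y (z + z'))
    (h : ∀ a b a' b' a'' b'', P (a ⊗ₜ b) (a' ⊗ₜ b') (a'' ⊗ₜ b'')) : ∀ x y z, P x y z :=
  fun x y z => ind₁ (P := fun x => P x y z) (h0 y z) (fun x x' => hadd x x' y z)
    (fun a b => ind₂ (P := fun y z => P (a ⊗ₜ b) y z) (h0' _) (h0'' _) (hadd' _) (hadd'' _)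
      (fun a' b' a'' b'' => h a b a' b' a'' b'') y z) x

lemma act₃_prod₁₂ : act₃ θ (prod₁₂ x y) = prod₁₂ (act₁ θ x) y + prod₁₂ x (act₂ θ y) := by
  revert x y
  refine ind₂ ?_ ?_ (fun x x' y h h' => ?_) (fun x y y' h h' => ?_)
    (fun a b a' b' => ?_)
  · intros; simp only [LinearMap.map_zero, LinearMap.zero_apply, add_zero, sub_zero, neg_zero,
      lie_zero]
  · intros; simp only [LinearMap.map_zero, LinearMap.zero_apply, add_zero, sub_zero, neg_zero,
      lie_zero]
  · simp only [LinearMap.map_add, LinearMap.add_apply, h, h']; abel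
  · simp only [LinearMap.map_add, LinearMap.add_apply, h, h']; abel
  · simp only [act₁_tmul, act₂_tmul, act₃_tmul, prod₁₂_tmul, LinearMap.map_add, LinearMap.add_apply,
      comp₃_mul, TensorProduct.add_tmul, TensorProduct.tmul_add]
    abel

lemma act₁_prod₂₃ : act₁ θ (prod₂₃ x y) = prod₂₃ (act₂ θ x) y + prod₂₃ x (act₃ θ y) := by
  revert x y
  refine ind₂ ?_ ?_ (fun x x' y h h' => ?_) (fun x y y' h h' => ?_)
    (fun a b a' b' => ?_)
  · intros; simp only [LinearMap.map_zero, LinearMap.zero_apply, add_zero, sub_zero, neg_zero,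
      lie_zero]
  · intros; simp only [LinearMap.map_zero, LinearMap.zero_apply, add_zero, sub_zero, neg_zero,
      lie_zero]
  · simp only [LinearMap.map_add, LinearMap.add_apply, h, h']; abel
  · simp only [LinearMap.map_add, LinearMap.add_apply, h, h']; abel
  · simp only [act₁_tmul, act₂_tmul, act₃_tmul, prod₂₃_tmul, LinearMap.map_add, LinearMap.add_apply,
      comp₁_mul, TensorProduct.add_tmul, TensorProduct.tmul_add]
    abel

lemma act₂_prod₃₁ : act₂ θ (prod₃₁ x y) = prod₃₁ (act₃ θ x) y + prod₃₁ x (act₁ θ y) := by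
  revert x y
  refine ind₂ ?_ ?_ (fun x x' y h h' => ?_) (fun x y y' h h' => ?_)
    (fun a b a' b' => ?_)
  · intros; simp only [LinearMap.map_zero, LinearMap.zero_apply, add_zero, sub_zero, neg_zero,
      lie_zero]
  · intros; simp only [LinearMap.map_zero, LinearMap.zero_apply, add_zero, sub_zero, neg_zero,
      lie_zero]
  · simp only [LinearMap.map_add, LinearMap.add_apply, h, h']; abel
  · simp only [LinearMap.map_add, LinearMap.add_apply, h, h']; abel
  · simp only [act₁_tmul, act₂_tmul, act₃_tmul, prod₃₁_tmul, LinearMap.map_add, LinearMap.add_apply,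
      comp₂_mul, TensorProduct.add_tmul, TensorProduct.tmul_add]
    abel

lemma pair₁_swap : pair₁ x y = -pair₁ y x := by
  revert x y
  refine ind₂ ?_ ?_ (fun x x' y h h' => ?_) (fun x y y' h h' => ?_)
    (fun a b a' b' => ?_)
  · intros; simp only [LinearMap.map_zero, LinearMap.zero_apply, add_zero, sub_zero, neg_zero,
      lie_zero]
  · intros; simp only [LinearMap.map_zero, LinearMap.zero_apply, add_zero, sub_zero, neg_zero,
      lie_zero]
  · simp only [LinearMap.map_add, LinearMap.add_apply, h, h']; abel
  · simp only [LinearMap.map_add, LinearMap.add_apply, h, h']; abel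
  · rw [pair₁_tmul, pair₁_tmul, psi₁_swap a, psi₁_swap b, form_symm a, form_symm b]
    ext1 <;> simp

lemma pair₂_swap : pair₂ x y = -pair₂ y x := by
  revert x y
  refine ind₂ ?_ ?_ (fun x x' y h h' => ?_) (fun x y y' h h' => ?_)
    (fun a b a' b' => ?_)
  · intros; simp only [LinearMap.map_zero, LinearMap.zero_apply, add_zero, sub_zero, neg_zero,
      lie_zero]
  · intros; simp only [LinearMap.map_zero, LinearMap.zero_apply, add_zero, sub_zero, neg_zero,
      lie_zero]
  · simp only [LinearMap.map_add, LinearMap.add_apply, h, h']; abel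
  · simp only [LinearMap.map_add, LinearMap.add_apply, h, h']; abel
  · rw [pair₂_tmul, pair₂_tmul, psi₂_swap a, psi₂_swap b, form_symm a, form_symm b]
    ext1 <;> simp

lemma pair₃_swap : pair₃ x y = -pair₃ y x := by
  revert x y
  refine ind₂ ?_ ?_ (fun x x' y h h' => ?_) (fun x y y' h h' => ?_)
    (fun a b a' b' => ?_)
  · intros; simp only [LinearMap.map_zero, LinearMap.zero_apply, add_zero, sub_zero, neg_zero,
      lie_zero]
  · intros; simp only [LinearMap.map_zero, LinearMap.zero_apply, add_zero, sub_zero, neg_zero,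
      lie_zero]
  · simp only [LinearMap.map_add, LinearMap.add_apply, h, h']; abel
  · simp only [LinearMap.map_add, LinearMap.add_apply, h, h']; abel
  · rw [pair₃_tmul, pair₃_tmul, psi₃_swap a, psi₃_swap b, form_symm a, form_symm b]
    ext1 <;> simp

lemma lie_pair₁ : ⁅θ, pair₁ x y⁆ = pair₁ (act₁ θ x) y + pair₁ x (act₁ θ y) := by
  revert x y
  refine ind₂ ?_ ?_ (fun x x' y h h' => ?_) (fun x y y' h h' => ?_)
    (fun a b a' b' => ?_)
  · intros; simp only [LinearMap.map_zero, LinearMap.zero_apply, add_zero, sub_zero, neg_zero,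
      lie_zero]
  · intros; simp only [LinearMap.map_zero, LinearMap.zero_apply, add_zero, sub_zero, neg_zero,
      lie_zero]
  · simp only [LinearMap.map_add, LinearMap.add_apply, lie_add, h, h']; abel
  · simp only [LinearMap.map_add, LinearMap.add_apply, lie_add, h, h']; abel
  · simp only [act₁_tmul, pair₁_tmul, LinearMap.map_add, LinearMap.add_apply]
    ext1
    · simp only [LieAlgebra.Prod.bracket_apply, lie_smul, lie_psi₁, Prod.fst_add, skew₁ θ.2 b b',
        skew₁ θ.1 a a']
      module
    · simp only [LieAlgebra.Prod.bracket_apply, lie_smul, lie_psi₁, Prod.snd_add, skew₁ θ.2 b b',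
        skew₁ θ.1 a a']
      module

lemma lie_pair₂ : ⁅θ, pair₂ x y⁆ = pair₂ (act₂ θ x) y + pair₂ x (act₂ θ y) := by
  revert x y
  refine ind₂ ?_ ?_ (fun x x' y h h' => ?_) (fun x y y' h h' => ?_)
    (fun a b a' b' => ?_)
  · intros; simp only [LinearMap.map_zero, LinearMap.zero_apply, add_zero, sub_zero, neg_zero,
      lie_zero]
  · intros; simp only [LinearMap.map_zero, LinearMap.zero_apply, add_zero, sub_zero, neg_zero,
      lie_zero]
  · simp only [LinearMap.map_add, LinearMap.add_apply, lie_add, h, h']; abel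
  · simp only [LinearMap.map_add, LinearMap.add_apply, lie_add, h, h']; abel
  · simp only [act₂_tmul, pair₂_tmul, LinearMap.map_add, LinearMap.add_apply]
    ext1
    · simp only [LieAlgebra.Prod.bracket_apply, lie_smul, lie_psi₂, Prod.fst_add, skew₂ θ.2 b b',
        skew₂ θ.1 a a']
      module
    · simp only [LieAlgebra.Prod.bracket_apply, lie_smul, lie_psi₂, Prod.snd_add, skew₂ θ.2 b b',
        skew₂ θ.1 a a']
      module

lemma lie_pair₃ : ⁅θ, pair₃ x y⁆ = pair₃ (act₃ θ x) y + pair₃ x (act₃ θ y) := by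
  revert x y
  refine ind₂ ?_ ?_ (fun x x' y h h' => ?_) (fun x y y' h h' => ?_)
    (fun a b a' b' => ?_)
  · intros; simp only [LinearMap.map_zero, LinearMap.zero_apply, add_zero, sub_zero, neg_zero,
      lie_zero]
  · intros; simp only [LinearMap.map_zero, LinearMap.zero_apply, add_zero, sub_zero, neg_zero,
      lie_zero]
  · simp only [LinearMap.map_add, LinearMap.add_apply, lie_add, h, h']; abel
  · simp only [LinearMap.map_add, LinearMap.add_apply, lie_add, h, h']; abel
  · simp only [act₃_tmul, pair₃_tmul, LinearMap.map_add, LinearMap.add_apply]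
    ext1
    · simp only [LieAlgebra.Prod.bracket_apply, lie_smul, lie_psi₃, Prod.fst_add, skew₃ θ.2 b b',
        skew₃ θ.1 a a']
      module
    · simp only [LieAlgebra.Prod.bracket_apply, lie_smul, lie_psi₃, Prod.snd_add, skew₃ θ.2 b b',
        skew₃ θ.1 a a']
      module

lemma act₁_pair₁ : act₁ (pair₁ x y) z + act₁ (pair₁ y z) x + act₁ (pair₁ z x) y = 0 := by
  revert x y z
  refine ind₃ ?_ ?_ ?_ (fun x x' y z h h' => ?_) (fun x y y' z h h' => ?_)
    (fun x y z z' h h' => ?_) (fun a b a' b' a'' b'' => ?_)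
  · intros; simp only [LinearMap.map_zero, LinearMap.zero_apply, add_zero, sub_zero, neg_zero,
      lie_zero]
  · intros; simp only [LinearMap.map_zero, LinearMap.zero_apply, add_zero, sub_zero, neg_zero,
      lie_zero]
  · intros; simp only [LinearMap.map_zero, LinearMap.zero_apply, add_zero, sub_zero, neg_zero,
      lie_zero]
  · simp only [LinearMap.map_add, LinearMap.add_apply]; linear_combination (norm := module) h + h'
  · simp only [LinearMap.map_add, LinearMap.add_apply]; linear_combination (norm := module) h + h'
  · simp only [LinearMap.map_add, LinearMap.add_apply]; linear_combination (norm := module) h + h'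
  · simp only [act₁_tmul, pair₁_tmul, LinearMap.map_smul, LinearMap.smul_apply, comp₁_psi₁, rot_apply,
      TensorProduct.sub_tmul, TensorProduct.tmul_sub, TensorProduct.tmul_smul, smul_sub,
      ← TensorProduct.smul_tmul', form_symm a'' , form_symm b'', form_symm a' a, form_symm b' b]
    module

lemma act₂_pair₂ : act₂ (pair₂ x y) z + act₂ (pair₂ y z) x + act₂ (pair₂ z x) y = 0 := by
  revert x y z
  refine ind₃ ?_ ?_ ?_ (fun x x' y z h h' => ?_) (fun x y y' z h h' => ?_)
    (fun x y z z' h h' => ?_) (fun a b a' b' a'' b'' => ?_)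
  · intros; simp only [LinearMap.map_zero, LinearMap.zero_apply, add_zero, sub_zero, neg_zero,
      lie_zero]
  · intros; simp only [LinearMap.map_zero, LinearMap.zero_apply, add_zero, sub_zero, neg_zero,
      lie_zero]
  · intros; simp only [LinearMap.map_zero, LinearMap.zero_apply, add_zero, sub_zero, neg_zero,
      lie_zero]
  · simp only [LinearMap.map_add, LinearMap.add_apply]; linear_combination (norm := module) h + h'
  · simp only [LinearMap.map_add, LinearMap.add_apply]; linear_combination (norm := module) h + h'
  · simp only [LinearMap.map_add, LinearMap.add_apply]; linear_combination (norm := module) h + h'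
  · simp only [act₂_tmul, pair₂_tmul, LinearMap.map_smul, LinearMap.smul_apply, comp₂_psi₂, rot_apply,
      TensorProduct.sub_tmul, TensorProduct.tmul_sub, TensorProduct.tmul_smul, smul_sub,
      ← TensorProduct.smul_tmul', form_symm a'' , form_symm b'', form_symm a' a, form_symm b' b]
    module

lemma act₃_pair₃ : act₃ (pair₃ x y) z + act₃ (pair₃ y z) x + act₃ (pair₃ z x) y = 0 := by
  revert x y z
  refine ind₃ ?_ ?_ ?_ (fun x x' y z h h' => ?_) (fun x y y' z h h' => ?_)
    (fun x y z z' h h' => ?_) (fun a b a' b' a'' b'' => ?_)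
  · intros; simp only [LinearMap.map_zero, LinearMap.zero_apply, add_zero, sub_zero, neg_zero,
      lie_zero]
  · intros; simp only [LinearMap.map_zero, LinearMap.zero_apply, add_zero, sub_zero, neg_zero,
      lie_zero]
  · intros; simp only [LinearMap.map_zero, LinearMap.zero_apply, add_zero, sub_zero, neg_zero,
      lie_zero]
  · simp only [LinearMap.map_add, LinearMap.add_apply]; linear_combination (norm := module) h + h'
  · simp only [LinearMap.map_add, LinearMap.add_apply]; linear_combination (norm := module) h + h'
  · simp only [LinearMap.map_add, LinearMap.add_apply]; linear_combination (norm := module) h + h'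
  · simp only [act₃_tmul, pair₃_tmul, LinearMap.map_smul, LinearMap.smul_apply, comp₃_psi₃, rot_apply,
      TensorProduct.sub_tmul, TensorProduct.tmul_sub, TensorProduct.tmul_smul, smul_sub,
      ← TensorProduct.smul_tmul', form_symm a'' , form_symm b'', form_symm a' a, form_symm b' b]
    module

lemma act₂_pair₁ : act₂ (pair₁ x y) z = prod₃₁ (prod₁₂ x z) y - prod₃₁ (prod₁₂ y z) x := by
  revert x y z
  refine ind₃ ?_ ?_ ?_ (fun x x' y z h h' => ?_) (fun x y y' z h h' => ?_)
    (fun x y z z' h h' => ?_) (fun a b a' b' a'' b'' => ?_)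
  · intros; simp only [LinearMap.map_zero, LinearMap.zero_apply, add_zero, sub_zero, neg_zero,
      lie_zero]
  · intros; simp only [LinearMap.map_zero, LinearMap.zero_apply, add_zero, sub_zero, neg_zero,
      lie_zero]
  · intros; simp only [LinearMap.map_zero, LinearMap.zero_apply, add_zero, sub_zero, neg_zero,
      lie_zero]
  · simp only [LinearMap.map_add, LinearMap.add_apply, h, h']; abel
  · simp only [LinearMap.map_add, LinearMap.add_apply, h, h']; abel
  · simp only [LinearMap.map_add, LinearMap.add_apply, h, h']; abel
  · have e1 := eq_sub_of_add_eq (conj_mul_mul a a' a'')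
    have e2 := eq_sub_of_add_eq (conj_mul_mul b b' b'')
    simp only [act₂_tmul, pair₁_tmul, LinearMap.map_smul, LinearMap.smul_apply, comp₂_psi₁, opB_apply,
      prod₁₂_tmul, prod₂₃_tmul, prod₃₁_tmul, HurwitzAlgebra.conj_mul, conj_conj]
    rw [e1, e2]
    simp only [TensorProduct.sub_tmul, TensorProduct.tmul_sub, TensorProduct.tmul_smul, smul_sub,
      ← TensorProduct.smul_tmul']
    module

lemma act₃_pair₁ : act₃ (pair₁ x y) z = prod₁₂ y (prod₃₁ z x) - prod₁₂ x (prod₃₁ z y) := by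
  revert x y z
  refine ind₃ ?_ ?_ ?_ (fun x x' y z h h' => ?_) (fun x y y' z h h' => ?_)
    (fun x y z z' h h' => ?_) (fun a b a' b' a'' b'' => ?_)
  · intros; simp only [LinearMap.map_zero, LinearMap.zero_apply, add_zero, sub_zero, neg_zero,
      lie_zero]
  · intros; simp only [LinearMap.map_zero, LinearMap.zero_apply, add_zero, sub_zero, neg_zero,
      lie_zero]
  · intros; simp only [LinearMap.map_zero, LinearMap.zero_apply, add_zero, sub_zero, neg_zero,
      lie_zero]
  · simp only [LinearMap.map_add, LinearMap.add_apply, h, h']; abel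
  · simp only [LinearMap.map_add, LinearMap.add_apply, h, h']; abel
  · simp only [LinearMap.map_add, LinearMap.add_apply, h, h']; abel
  · have e1 := eq_sub_of_add_eq (mul_conj_mul a a' a'')
    have e2 := eq_sub_of_add_eq (mul_conj_mul b b' b'')
    simp only [act₃_tmul, pair₁_tmul, LinearMap.map_smul, LinearMap.smul_apply, comp₃_psi₁, opA_apply,
      prod₁₂_tmul, prod₂₃_tmul, prod₃₁_tmul, HurwitzAlgebra.conj_mul, conj_conj]
    rw [e1, e2]
    simp only [TensorProduct.sub_tmul, TensorProduct.tmul_sub, TensorProduct.tmul_smul, smul_sub,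
      ← TensorProduct.smul_tmul']
    module

lemma act₃_pair₂ : act₃ (pair₂ x y) z = prod₁₂ (prod₂₃ x z) y - prod₁₂ (prod₂₃ y z) x := by
  revert x y z
  refine ind₃ ?_ ?_ ?_ (fun x x' y z h h' => ?_) (fun x y y' z h h' => ?_)
    (fun x y z z' h h' => ?_) (fun a b a' b' a'' b'' => ?_)
  · intros; simp only [LinearMap.map_zero, LinearMap.zero_apply, add_zero, sub_zero, neg_zero,
      lie_zero]
  · intros; simp only [LinearMap.map_zero, LinearMap.zero_apply, add_zero, sub_zero, neg_zero,
      lie_zero]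
  · intros; simp only [LinearMap.map_zero, LinearMap.zero_apply, add_zero, sub_zero, neg_zero,
      lie_zero]
  · simp only [LinearMap.map_add, LinearMap.add_apply, h, h']; abel
  · simp only [LinearMap.map_add, LinearMap.add_apply, h, h']; abel
  · simp only [LinearMap.map_add, LinearMap.add_apply, h, h']; abel
  · have e1 := eq_sub_of_add_eq (mul_conj_mul' a a' a'')
    have e2 := eq_sub_of_add_eq (mul_conj_mul' b b' b'')
    simp only [act₃_tmul, pair₂_tmul, LinearMap.map_smul, LinearMap.smul_apply, comp₃_psi₂, opC_apply,
      prod₁₂_tmul, prod₂₃_tmul, prod₃₁_tmul, HurwitzAlgebra.conj_mul, conj_conj]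
    rw [e1, e2]
    simp only [TensorProduct.sub_tmul, TensorProduct.tmul_sub, TensorProduct.tmul_smul, smul_sub,
      ← TensorProduct.smul_tmul']
    module

lemma act₁_pair₂ : act₁ (pair₂ x y) z = prod₂₃ y (prod₁₂ z x) - prod₂₃ x (prod₁₂ z y) := by
  revert x y z
  refine ind₃ ?_ ?_ ?_ (fun x x' y z h h' => ?_) (fun x y y' z h h' => ?_)
    (fun x y z z' h h' => ?_) (fun a b a' b' a'' b'' => ?_)
  · intros; simp only [LinearMap.map_zero, LinearMap.zero_apply, add_zero, sub_zero, neg_zero,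
      lie_zero]
  · intros; simp only [LinearMap.map_zero, LinearMap.zero_apply, add_zero, sub_zero, neg_zero,
      lie_zero]
  · intros; simp only [LinearMap.map_zero, LinearMap.zero_apply, add_zero, sub_zero, neg_zero,
      lie_zero]
  · simp only [LinearMap.map_add, LinearMap.add_apply, h, h']; abel
  · simp only [LinearMap.map_add, LinearMap.add_apply, h, h']; abel
  · simp only [LinearMap.map_add, LinearMap.add_apply, h, h']; abel
  · have e1 := eq_sub_of_add_eq (mul_mul_conj a a' a'')
    have e2 := eq_sub_of_add_eq (mul_mul_conj b b' b'')
    simp only [act₁_tmul, pair₂_tmul, LinearMap.map_smul, LinearMap.smul_apply, comp₁_psi₂, opD_apply,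
      prod₁₂_tmul, prod₂₃_tmul, prod₃₁_tmul, HurwitzAlgebra.conj_mul, conj_conj]
    rw [e1, e2]
    simp only [TensorProduct.sub_tmul, TensorProduct.tmul_sub, TensorProduct.tmul_smul, smul_sub,
      ← TensorProduct.smul_tmul']
    module

lemma act₁_pair₃ : act₁ (pair₃ x y) z = prod₂₃ (prod₃₁ x z) y - prod₂₃ (prod₃₁ y z) x := by
  revert x y z
  refine ind₃ ?_ ?_ ?_ (fun x x' y z h h' => ?_) (fun x y y' z h h' => ?_)
    (fun x y z z' h h' => ?_) (fun a b a' b' a'' b'' => ?_)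
  · intros; simp only [LinearMap.map_zero, LinearMap.zero_apply, add_zero, sub_zero, neg_zero,
      lie_zero]
  · intros; simp only [LinearMap.map_zero, LinearMap.zero_apply, add_zero, sub_zero, neg_zero,
      lie_zero]
  · intros; simp only [LinearMap.map_zero, LinearMap.zero_apply, add_zero, sub_zero, neg_zero,
      lie_zero]
  · simp only [LinearMap.map_add, LinearMap.add_apply, h, h']; abel
  · simp only [LinearMap.map_add, LinearMap.add_apply, h, h']; abel
  · simp only [LinearMap.map_add, LinearMap.add_apply, h, h']; abel
  · have e1 := eq_sub_of_add_eq (mul_conj_mul a a' a'')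
    have e2 := eq_sub_of_add_eq (mul_conj_mul b b' b'')
    simp only [act₁_tmul, pair₃_tmul, LinearMap.map_smul, LinearMap.smul_apply, comp₁_psi₃, opA_apply,
      prod₁₂_tmul, prod₂₃_tmul, prod₃₁_tmul, HurwitzAlgebra.conj_mul, conj_conj]
    rw [e1, e2]
    simp only [TensorProduct.sub_tmul, TensorProduct.tmul_sub, TensorProduct.tmul_smul, smul_sub,
      ← TensorProduct.smul_tmul']
    module

lemma act₂_pair₃ : act₂ (pair₃ x y) z = prod₃₁ y (prod₂₃ z x) - prod₃₁ x (prod₂₃ z y) := by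
  revert x y z
  refine ind₃ ?_ ?_ ?_ (fun x x' y z h h' => ?_) (fun x y y' z h h' => ?_)
    (fun x y z z' h h' => ?_) (fun a b a' b' a'' b'' => ?_)
  · intros; simp only [LinearMap.map_zero, LinearMap.zero_apply, add_zero, sub_zero, neg_zero,
      lie_zero]
  · intros; simp only [LinearMap.map_zero, LinearMap.zero_apply, add_zero, sub_zero, neg_zero,
      lie_zero]
  · intros; simp only [LinearMap.map_zero, LinearMap.zero_apply, add_zero, sub_zero, neg_zero,
      lie_zero]
  · simp only [LinearMap.map_add, LinearMap.add_apply, h, h']; abel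
  · simp only [LinearMap.map_add, LinearMap.add_apply, h, h']; abel
  · simp only [LinearMap.map_add, LinearMap.add_apply, h, h']; abel
  · have e1 := eq_sub_of_add_eq (mul_conj_mul' a a' a'')
    have e2 := eq_sub_of_add_eq (mul_conj_mul' b b' b'')
    simp only [act₂_tmul, pair₃_tmul, LinearMap.map_smul, LinearMap.smul_apply, comp₂_psi₃, opC_apply,
      prod₁₂_tmul, prod₂₃_tmul, prod₃₁_tmul, HurwitzAlgebra.conj_mul, conj_conj]
    rw [e1, e2]
    simp only [TensorProduct.sub_tmul, TensorProduct.tmul_sub, TensorProduct.tmul_smul, smul_sub,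
      ← TensorProduct.smul_tmul']
    module

lemma pair_cyclic : pair₃ (prod₁₂ x y) z + pair₁ (prod₂₃ y z) x + pair₂ (prod₃₁ z x) y = 0 := by
  revert x y z
  refine ind₃ ?_ ?_ ?_ (fun x x' y z h h' => ?_) (fun x y y' z h h' => ?_)
    (fun x y z z' h h' => ?_) (fun a b a' b' a'' b'' => ?_)
  · intros; simp only [LinearMap.map_zero, LinearMap.zero_apply, add_zero, sub_zero, neg_zero,
      lie_zero]
  · intros; simp only [LinearMap.map_zero, LinearMap.zero_apply, add_zero, sub_zero, neg_zero,
      lie_zero]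
  · intros; simp only [LinearMap.map_zero, LinearMap.zero_apply, add_zero, sub_zero, neg_zero,
      lie_zero]
  · simp only [LinearMap.map_add, LinearMap.add_apply]; linear_combination (norm := module) h + h'
  · simp only [LinearMap.map_add, LinearMap.add_apply]; linear_combination (norm := module) h + h'
  · simp only [LinearMap.map_add, LinearMap.add_apply]; linear_combination (norm := module) h + h'
  · have e1 : ∀ {V : Type} [AddCommGroup V] [Module ℂ V] [HurwitzAlgebra V] (a b c : V),
        form (mul c (conj b)) a = form (mul a b) c := fun a b c => by
      rw [form_mul_adj_right, conj_conj, form_symm]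
    have e2 : ∀ {V : Type} [AddCommGroup V] [Module ℂ V] [HurwitzAlgebra V] (a b c : V),
        form (mul (conj a) c) b = form (mul a b) c := fun a b c => by
      rw [form_mul_adj_left, conj_conj, form_symm]
    simp only [prod₁₂_tmul, prod₂₃_tmul, prod₃₁_tmul, pair₁_tmul, pair₂_tmul, pair₃_tmul, e1, e2]
    ext1
    · simp only [Prod.fst_add, Prod.fst_zero, ← smul_add, psi_cyclic, smul_zero]
    · simp only [Prod.snd_add, Prod.snd_zero, ← smul_add, psi_cyclic, smul_zero]

end Identities

/-- The Lie bracket of the triality model. -/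
instance : Bracket (TrialityModel A B) (TrialityModel A B) where
  bracket x y :=
    ⟨⁅x.tri, y.tri⁆ + pair₁ x.one y.one + pair₂ x.two y.two + pair₃ x.three y.three,
      act₁ x.tri y.one - act₁ y.tri x.one + prod₂₃ x.two y.three - prod₂₃ y.two x.three,
      act₂ x.tri y.two - act₂ y.tri x.two + prod₃₁ x.three y.one - prod₃₁ y.three x.one,
      act₃ x.tri y.three - act₃ y.tri x.three + prod₁₂ x.one y.two - prod₁₂ y.one x.two⟩

section
variable (x y : TrialityModel A B)

lemma bracket_zero : (⁅x, y⁆ : TrialityModel A B).tri =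
    ⁅x.tri, y.tri⁆ + pair₁ x.one y.one + pair₂ x.two y.two + pair₃ x.three y.three := rfl
lemma bracket_one : (⁅x, y⁆ : TrialityModel A B).one =
    act₁ x.tri y.one - act₁ y.tri x.one + prod₂₃ x.two y.three - prod₂₃ y.two x.three := rfl
lemma bracket_two : (⁅x, y⁆ : TrialityModel A B).two =
    act₂ x.tri y.two - act₂ y.tri x.two + prod₃₁ x.three y.one - prod₃₁ y.three x.one := rfl
lemma bracket_three : (⁅x, y⁆ : TrialityModel A B).three =
    act₃ x.tri y.three - act₃ y.tri x.three + prod₁₂ x.one y.two - prod₁₂ y.one x.two := rfl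

lemma add_zero' : (x + y).tri = x.tri + y.tri := rfl
lemma add_one' : (x + y).one = x.one + y.one := rfl
lemma add_two' : (x + y).two = x.two + y.two := rfl
lemma add_three' : (x + y).three = x.three + y.three := rfl
lemma smul_zero' (c : ℂ) : (c • x).tri = c • x.tri := rfl
lemma smul_one' (c : ℂ) : (c • x).one = c • x.one := rfl
lemma smul_two' (c : ℂ) : (c • x).two = c • x.two := rfl
lemma smul_three' (c : ℂ) : (c • x).three = c • x.three := rfl

lemma self_eq_zero {M : Type} [AddCommGroup M] [Module ℂ M] {m : M} (h : m = -m) : m = 0 := by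
  have h2 : (2 : ℂ) • m = 0 := by rw [two_smul]; nth_rewrite 1 [h]; simp
  simpa using h2

end

lemma pair₁_lie (θ : trialityAlgebra A × trialityAlgebra B) (x y : A ⊗[ℂ] B) :
    ⁅pair₁ x y, θ⁆ = -(pair₁ (act₁ θ x) y + pair₁ x (act₁ θ y)) := by
  rw [← lie_pair₁, lie_skew]

lemma pair₂_lie (θ : trialityAlgebra A × trialityAlgebra B) (x y : A ⊗[ℂ] B) :
    ⁅pair₂ x y, θ⁆ = -(pair₂ (act₂ θ x) y + pair₂ x (act₂ θ y)) := by
  rw [← lie_pair₂, lie_skew]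

lemma pair₃_lie (θ : trialityAlgebra A × trialityAlgebra B) (x y : A ⊗[ℂ] B) :
    ⁅pair₃ x y, θ⁆ = -(pair₃ (act₃ θ x) y + pair₃ x (act₃ θ y)) := by
  rw [← lie_pair₃, lie_skew]

instance : LieRing (TrialityModel A B) where
  add_lie x y z := by
    apply TrialityModel.ext <;>
    simp only [bracket_zero, bracket_one, bracket_two, bracket_three, add_zero', add_one',
      add_two', add_three', LinearMap.map_add, LinearMap.add_apply, add_lie] <;>
    abel
  lie_add x y z := by
    apply TrialityModel.ext <;>
    simp only [bracket_zero, bracket_one, bracket_two, bracket_three, add_zero', add_one',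
      add_two', add_three', LinearMap.map_add, LinearMap.add_apply, lie_add] <;>
    abel
  lie_self x := by
    apply TrialityModel.ext
    · rw [bracket_zero, lie_self, self_eq_zero (pair₁_swap x.one x.one),
        self_eq_zero (pair₂_swap x.two x.two), self_eq_zero (pair₃_swap x.three x.three)]
      simp only [add_zero]; rfl
    · rw [bracket_one]; simp only [sub_self, zero_add]; rfl
    · rw [bracket_two]; simp only [sub_self, zero_add]; rfl
    · rw [bracket_three]; simp only [sub_self, zero_add]; rfl
  leibniz_lie x y z := by
    obtain ⟨D, x1, x2, x3⟩ := x
    obtain ⟨E, y1, y2, y3⟩ := y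
    obtain ⟨F, z1, z2, z3⟩ := z
    apply TrialityModel.ext
    · have h1 := pair_cyclic x1 y2 z3
      have h2 := pair_cyclic x1 z2 y3
      have h3 := pair_cyclic y1 x2 z3
      have h4 := pair_cyclic y1 z2 x3
      have h5 := pair_cyclic z1 x2 y3
      have h6 := pair_cyclic z1 y2 x3
      have h7 := leibniz_lie D E F
      simp only [add_zero', bracket_zero, bracket_one, bracket_two, bracket_three, LinearMap.map_add,
        LinearMap.map_sub, LinearMap.add_apply, LinearMap.sub_apply, lie_add, add_lie, lie_pair₁, lie_pair₂,
        lie_pair₃, pair₁_lie, pair₂_lie, pair₃_lie]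
      simp only [pair₁_swap x1, pair₁_swap y1, pair₂_swap x2, pair₂_swap y2, pair₃_swap x3,
        pair₃_swap y3]
      linear_combination (norm := abel) h2 - h1 + h3 - h4 - h5 + h6 + h7
    · have h := act₁_pair₁ x1 y1 z1
      rw [pair₁_swap z1 x1] at h
      simp only [add_one', bracket_zero, bracket_one, bracket_two, bracket_three, LinearMap.map_add,
        LinearMap.map_sub, LinearMap.add_apply, LinearMap.sub_apply, LinearMap.map_neg, LinearMap.neg_apply,
        act₁_lie, act₁_prod₂₃, act₁_pair₂, act₁_pair₃] at h ⊢
      linear_combination (norm := abel) -h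
    · have h := act₂_pair₂ x2 y2 z2
      rw [pair₂_swap z2 x2] at h
      simp only [add_two', bracket_zero, bracket_one, bracket_two, bracket_three, LinearMap.map_add,
        LinearMap.map_sub, LinearMap.add_apply, LinearMap.sub_apply, LinearMap.map_neg, LinearMap.neg_apply,
        act₂_lie, act₂_prod₃₁, act₂_pair₁, act₂_pair₃] at h ⊢
      linear_combination (norm := abel) -h
    · have h := act₃_pair₃ x3 y3 z3
      rw [pair₃_swap z3 x3] at h
      simp only [add_three', bracket_zero, bracket_one, bracket_two, bracket_three, LinearMap.map_add,
        LinearMap.map_sub, LinearMap.add_apply, LinearMap.sub_apply, LinearMap.map_neg, LinearMap.neg_apply,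
        act₃_lie, act₃_prod₁₂, act₃_pair₁, act₃_pair₂] at h ⊢
      linear_combination (norm := abel) -h

instance : LieAlgebra ℂ (TrialityModel A B) where
  lie_smul c x y := by
    apply TrialityModel.ext <;>
    simp only [bracket_zero, bracket_one, bracket_two, bracket_three, smul_zero', smul_one',
      smul_two', smul_three', LinearMap.map_smul, LinearMap.smul_apply, lie_smul] <;>
    module

end TrialityModel

end Model

section Doubling

/-- The complexification `ℂ` of the normed algebra `ℝ`, with the norm `x ↦ x²`. -/
instance : HurwitzAlgebra ℂ where
  mul := LinearMap.mul ℂ ℂ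
  one := 1
  form := LinearMap.mul ℂ ℂ
  form_symm x y := by simp [mul_comm]
  form_nondeg x h := by simpa using h 1
  form_one := by simp
  one_mul x := by simp
  mul_one x := by simp
  form_mul x y := by simp; ring

variable (V : Type) [AddCommGroup V] [Module ℂ V] [HurwitzAlgebra V]

/-- The algebra `V` is associative. -/
class IsAssoc : Prop where
  assoc : ∀ x y z : V, mul (mul x y) z = mul x (mul y z)

/-- The algebra `V` is commutative. -/
class IsComm : Prop where
  comm : ∀ x y : V, mul x y = mul y x

/-- The conjugation of `V` is trivial. -/
class IsSelfConj : Prop where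
  conj_eq : ∀ x : V, conj x = x

variable {V}

lemma form_cross [IsAssoc V] (a b c d : V) :
    form (mul a c) (mul (conj d) b) = form (mul d a) (mul b (conj c)) := by
  rw [form_right_adj_left, conj_conj, ← IsAssoc.assoc, form_mul_adj_right]

/-- The Cayley-Dickson doubling `V ⊕ V` of an associative Hurwitz algebra `V`, with the product
`(a, b)(c, d) = (a c - d̄ b, d a + b c̄)`. -/
instance [IsAssoc V] : HurwitzAlgebra (V × V) where
  mul := LinearMap.mk₂ ℂ
    (fun x y => (mul x.1 y.1 - mul (conj y.2) x.2, mul y.2 x.1 + mul x.2 (conj y.1)))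
    (by intro a b c; ext1 <;> simp <;> abel)
    (by intro a b c; ext1 <;> simp [smul_sub])
    (by intro a b c; ext1 <;> simp <;> abel)
    (by intro a b c; ext1 <;> simp [smul_sub])
  one := (one, 0)
  form := LinearMap.mk₂ ℂ (fun x y => form x.1 y.1 + form x.2 y.2)
    (by intro a b c; simp; ring)
    (by intro a b c; simp; ring)
    (by intro a b c; simp; ring)
    (by intro a b c; simp; ring)
  form_symm x y := by simp [form_symm x.1, form_symm x.2]
  form_nondeg x h := by
    ext1
    · exact form_nondeg _ fun y => by simpa using h (y, 0)
    · exact form_nondeg _ fun y => by simpa using h (0, y)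
  form_one := by simp [form_one]
  one_mul x := by ext1 <;> simp [HurwitzAlgebra.one_mul, HurwitzAlgebra.mul_one]
  mul_one x := by ext1 <;> simp [HurwitzAlgebra.one_mul, HurwitzAlgebra.mul_one, conj_one]
  form_mul := by
    rintro ⟨a, b⟩ ⟨c, d⟩
    have h := form_cross a b c d
    simp only [LinearMap.mk₂_apply, LinearMap.map_add, LinearMap.map_sub, LinearMap.add_apply, LinearMap.sub_apply]
    rw [form_symm (mul (conj d) b) (mul a c), form_symm (mul b (conj c)) (mul d a), h]
    simp only [form_mul, form_conj_conj]
    ring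

lemma double_mul [IsAssoc V] (a b c d : V) : mul (a, b) (c, d) =
    (mul a c - mul (conj d) b, mul d a + mul b (conj c)) := rfl

lemma double_form [IsAssoc V] (a b c d : V) : form (a, b) (c, d) = form a c + form b d := rfl

lemma double_one [IsAssoc V] : (one : V × V) = (one, 0) := rfl

lemma double_conj [IsAssoc V] (a b : V) : conj (a, b) = (conj a, -b) := by
  rw [conj_apply, double_one, double_form, conj_apply]
  ext1 <;> simp

instance : IsAssoc ℂ := ⟨mul_assoc⟩
instance : IsComm ℂ := ⟨mul_comm⟩
instance : IsSelfConj ℂ := ⟨fun x => by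
  rw [conj_apply]
  change (2 * (1 * x)) • (1 : ℂ) - x = x
  simp only [smul_eq_mul]; ring⟩

instance [IsAssoc V] [IsComm V] [IsSelfConj V] : IsComm (V × V) := ⟨by
  rintro ⟨a, b⟩ ⟨c, d⟩
  simp only [double_mul, IsSelfConj.conj_eq]
  rw [IsComm.comm a c, IsComm.comm d b, IsComm.comm d a, IsComm.comm b c, add_comm]⟩

instance [IsAssoc V] [IsComm V] : IsAssoc (V × V) := ⟨by
  have k : ∀ x y z : V, mul x (mul y z) = mul z (mul x y) := fun x y z => by
    rw [← IsAssoc.assoc, IsComm.comm]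
  rintro ⟨a, b⟩ ⟨c, d⟩ ⟨e, f⟩
  simp only [double_mul, LinearMap.map_add, LinearMap.map_sub, LinearMap.add_apply, LinearMap.sub_apply,
    HurwitzAlgebra.conj_mul, conj_conj, IsAssoc.assoc]
  ext1
  · simp only
    rw [k (conj d) b e, k (conj f) d a, k (conj f) b (conj c)]
    abel
  · simp only
    rw [IsComm.comm c a, k f (conj d) b, IsComm.comm f (conj d), IsComm.comm a (conj e),
      IsComm.comm (conj c) (conj e)]
    abel⟩

end Doubling

/-- The complexification of the normed algebra `ℝ`. -/
abbrev AlgR : Type := ℂ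
/-- The complexification of the normed algebra `ℂ`, the double of that of `ℝ`. -/
abbrev AlgC : Type := AlgR × AlgR
/-- The complexification of the normed algebra `ℍ`, the double of that of `ℂ`. -/
abbrev AlgH : Type := AlgC × AlgC
/-- The complexified Cayley algebra, the double of the complexification of `ℍ`. -/
abbrev AlgO : Type := AlgH × AlgH

/-- The exceptional Lie algebra `f₄ = g̃(ℝ, 𝕆)`. -/
abbrev LieF₄ : Type := TrialityModel AlgR AlgO
/-- The exceptional Lie algebra `e₆ = g̃(ℂ, 𝕆)`. -/
abbrev LieE₆ : Type := TrialityModel AlgC AlgO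
/-- The exceptional Lie algebra `e₇ = g̃(ℍ, 𝕆)`. -/
abbrev LieE₇ : Type := TrialityModel AlgH AlgO
/-- The exceptional Lie algebra `e₈ = g̃(𝕆, 𝕆)`. -/
abbrev LieE₈ : Type := TrialityModel AlgO AlgO

section Inclusion

variable (A B : Type) [AddCommGroup A] [Module ℂ A] [HurwitzAlgebra A]
  [AddCommGroup B] [Module ℂ B] [HurwitzAlgebra B]

attribute [local instance] LieRing.ofAssociativeRing

instance : Subsingleton (trialityAlgebra AlgR) := by
  have key : ∀ f : Module.End ℂ ℂ, IsSkew f → f = 0 := by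
    intro f hf
    have h := hf (1 : ℂ) (1 : ℂ)
    have h1 : f 1 = 0 := by
      change f 1 * 1 = -(1 * f 1) at h
      linear_combination h / 2
    ext
    simpa using h1
  refine ⟨fun θ η => triality_ext (fun z => ?_) (fun z => ?_) (fun z => ?_)⟩
  · rw [key _ (skew₁ θ), key _ (skew₁ η)]
  · rw [key _ (skew₂ θ), key _ (skew₂ η)]
  · rw [key _ (skew₃ θ), key _ (skew₃ η)]

/-- The map `ℂ ⊗ B → A ⊗ B` induced by `z ↦ z 1`. -/
def unitMap : AlgR ⊗[ℂ] B →ₗ[ℂ] A ⊗[ℂ] B :=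
  LinearMap.rTensor B (LinearMap.toSpanSingleton ℂ A one)

variable {A B}

lemma unitMap_tmul (z : ℂ) (b : B) : unitMap A B (z ⊗ₜ b) = (z • one) ⊗ₜ b := rfl

lemma psi_one_one : psi₁ (one : A) one = 0 ∧ psi₂ (one : A) one = 0 ∧ psi₃ (one : A) one = 0 :=
  ⟨TrialityModel.self_eq_zero (psi₁_swap _ _), TrialityModel.self_eq_zero (psi₂_swap _ _),
    TrialityModel.self_eq_zero (psi₃_swap _ _)⟩

lemma formR (z w : AlgR) : form z w = z * w := rfl
lemma mulR (z w : AlgR) : mul z w = z * w := rfl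
lemma conjR (z : AlgR) : conj z = z := IsSelfConj.conj_eq z

open TrialityModel

lemma act₁_unitMap (θ : trialityAlgebra AlgR × trialityAlgebra B) (x : AlgR ⊗[ℂ] B) :
    unitMap A B (act₁ θ x) = act₁ (0, θ.2) (unitMap A B x) := by
  revert x
  refine ind₁ ?_ (fun x y hx hy => ?_) (fun z b => ?_)
  · simp
  · simp only [LinearMap.map_add, hx, hy]
  · rw [act₁_tmul, unitMap_tmul, act₁_tmul, Subsingleton.elim θ.1 0]
    simp [unitMap_tmul]

lemma pair₁_unitMap (x y : AlgR ⊗[ℂ] B) :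
    pair₁ (unitMap A B x) (unitMap A B y) = (0, (pair₁ x y).2) := by
  revert x y
  refine ind₂ ?_ ?_ (fun x x' y h h' => ?_) (fun x y y' h h' => ?_) (fun z b z' b' => ?_)
  · intro y; simp; rfl
  · intro y; simp; rfl
  · simp only [LinearMap.map_add, LinearMap.add_apply, h, h', Prod.snd_add]; ext1 <;> simp
  · simp only [LinearMap.map_add, LinearMap.add_apply, h, h', Prod.snd_add]; ext1 <;> simp
  · rw [unitMap_tmul, unitMap_tmul, pair₁_tmul, pair₁_tmul]
    simp only [LinearMap.map_smul, LinearMap.smul_apply, psi_one_one.1, form_one, smul_zero, formR]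
    ext1
    · rfl
    · simp only [smul_eq_mul, _root_.mul_one]

lemma act₂_unitMap (θ : trialityAlgebra AlgR × trialityAlgebra B) (x : AlgR ⊗[ℂ] B) :
    unitMap A B (act₂ θ x) = act₂ (0, θ.2) (unitMap A B x) := by
  revert x
  refine ind₁ ?_ (fun x y hx hy => ?_) (fun z b => ?_)
  · simp
  · simp only [LinearMap.map_add, hx, hy]
  · rw [act₂_tmul, unitMap_tmul, act₂_tmul, Subsingleton.elim θ.1 0]
    simp [unitMap_tmul]

lemma pair₂_unitMap (x y : AlgR ⊗[ℂ] B) :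
    pair₂ (unitMap A B x) (unitMap A B y) = (0, (pair₂ x y).2) := by
  revert x y
  refine ind₂ ?_ ?_ (fun x x' y h h' => ?_) (fun x y y' h h' => ?_) (fun z b z' b' => ?_)
  · intro y; simp; rfl
  · intro y; simp; rfl
  · simp only [LinearMap.map_add, LinearMap.add_apply, h, h', Prod.snd_add]; ext1 <;> simp
  · simp only [LinearMap.map_add, LinearMap.add_apply, h, h', Prod.snd_add]; ext1 <;> simp
  · rw [unitMap_tmul, unitMap_tmul, pair₂_tmul, pair₂_tmul]
    simp only [LinearMap.map_smul, LinearMap.smul_apply, psi_one_one.2.1, form_one, smul_zero, formR]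
    ext1
    · rfl
    · simp only [smul_eq_mul, _root_.mul_one]

lemma act₃_unitMap (θ : trialityAlgebra AlgR × trialityAlgebra B) (x : AlgR ⊗[ℂ] B) :
    unitMap A B (act₃ θ x) = act₃ (0, θ.2) (unitMap A B x) := by
  revert x
  refine ind₁ ?_ (fun x y hx hy => ?_) (fun z b => ?_)
  · simp
  · simp only [LinearMap.map_add, hx, hy]
  · rw [act₃_tmul, unitMap_tmul, act₃_tmul, Subsingleton.elim θ.1 0]
    simp [unitMap_tmul]

lemma pair₃_unitMap (x y : AlgR ⊗[ℂ] B) :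
    pair₃ (unitMap A B x) (unitMap A B y) = (0, (pair₃ x y).2) := by
  revert x y
  refine ind₂ ?_ ?_ (fun x x' y h h' => ?_) (fun x y y' h h' => ?_) (fun z b z' b' => ?_)
  · intro y; simp; rfl
  · intro y; simp; rfl
  · simp only [LinearMap.map_add, LinearMap.add_apply, h, h', Prod.snd_add]; ext1 <;> simp
  · simp only [LinearMap.map_add, LinearMap.add_apply, h, h', Prod.snd_add]; ext1 <;> simp
  · rw [unitMap_tmul, unitMap_tmul, pair₃_tmul, pair₃_tmul]
    simp only [LinearMap.map_smul, LinearMap.smul_apply, psi_one_one.2.2, form_one, smul_zero, formR]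
    ext1
    · rfl
    · simp only [smul_eq_mul, _root_.mul_one]

lemma prod₁₂_unitMap (x y : AlgR ⊗[ℂ] B) :
    unitMap A B (prod₁₂ x y) = prod₁₂ (unitMap A B x) (unitMap A B y) := by
  revert x y
  refine ind₂ ?_ ?_ (fun x x' y h h' => ?_) (fun x y y' h h' => ?_) (fun z b z' b' => ?_)
  · intro y; simp
  · intro y; simp
  · simp only [LinearMap.map_add, LinearMap.add_apply, h, h']
  · simp only [LinearMap.map_add, LinearMap.add_apply, h, h']
  · simp only [unitMap_tmul, prod₁₂_tmul, LinearMap.map_smul, LinearMap.smul_apply, conj_one, conjR,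
      HurwitzAlgebra.one_mul, mulR, mul_smul, smul_comm z' z]

lemma prod₂₃_unitMap (x y : AlgR ⊗[ℂ] B) :
    unitMap A B (prod₂₃ x y) = prod₂₃ (unitMap A B x) (unitMap A B y) := by
  revert x y
  refine ind₂ ?_ ?_ (fun x x' y h h' => ?_) (fun x y y' h h' => ?_) (fun z b z' b' => ?_)
  · intro y; simp
  · intro y; simp
  · simp only [LinearMap.map_add, LinearMap.add_apply, h, h']
  · simp only [LinearMap.map_add, LinearMap.add_apply, h, h']
  · simp only [unitMap_tmul, prod₂₃_tmul, LinearMap.map_smul, LinearMap.smul_apply, conj_one, conjR,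
      HurwitzAlgebra.one_mul, mulR, mul_smul, smul_comm z' z]

lemma prod₃₁_unitMap (x y : AlgR ⊗[ℂ] B) :
    unitMap A B (prod₃₁ x y) = prod₃₁ (unitMap A B x) (unitMap A B y) := by
  revert x y
  refine ind₂ ?_ ?_ (fun x x' y h h' => ?_) (fun x y y' h h' => ?_) (fun z b z' b' => ?_)
  · intro y; simp
  · intro y; simp
  · simp only [LinearMap.map_add, LinearMap.add_apply, h, h']
  · simp only [LinearMap.map_add, LinearMap.add_apply, h, h']
  · simp only [unitMap_tmul, prod₃₁_tmul, LinearMap.map_smul, LinearMap.smul_apply, conj_one, conjR,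
      HurwitzAlgebra.one_mul, mulR, mul_smul, smul_comm z' z]

variable (A B)

/-- The inclusion `g̃(ℝ, B) ⊂ g̃(A, B)` induced by `ℝ ⊂ A` (recall that `t(ℝ) = 0`). -/
def inclusion : TrialityModel AlgR B →ₗ⁅ℂ⁆ TrialityModel A B where
  toFun x := ⟨(0, x.tri.2), unitMap A B x.one, unitMap A B x.two, unitMap A B x.three⟩
  map_add' x y := by
    apply TrialityModel.ext <;>
    simp only [TrialityModel.add_zero', TrialityModel.add_one', TrialityModel.add_two',
      TrialityModel.add_three', LinearMap.map_add, Prod.snd_add]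
    ext1 <;> simp
  map_smul' c x := by
    apply TrialityModel.ext <;>
    simp only [TrialityModel.smul_zero', TrialityModel.smul_one', TrialityModel.smul_two',
      TrialityModel.smul_three', LinearMap.map_smul, Prod.smul_snd, RingHom.id_apply]
    ext1 <;> simp
  map_lie' := by
    intro x y
    apply TrialityModel.ext
    · simp only [TrialityModel.bracket_zero, pair₁_unitMap, pair₂_unitMap, pair₃_unitMap]
      ext1 <;> simp
    · simp only [TrialityModel.bracket_one, LinearMap.map_add, LinearMap.map_sub, act₁_unitMap, prod₂₃_unitMap]
    · simp only [TrialityModel.bracket_two, LinearMap.map_add, LinearMap.map_sub, act₂_unitMap, prod₃₁_unitMap]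
    · simp only [TrialityModel.bracket_three, LinearMap.map_add, LinearMap.map_sub, act₃_unitMap, prod₁₂_unitMap]

end Inclusion

section LieTheory

open LieAlgebra LieAlgebra.IsKilling

variable (L : Type) [LieRing L] [LieAlgebra ℂ L]

/-- The adjoint group of a (semisimple) complex Lie algebra `L`: the subgroup of `GL(L)` generated
by the exponentials `exp(ad x)` of the nilpotent endomorphisms `ad x`. -/
def adjointGroup : Subgroup (L ≃ₗ[ℂ] L) :=
  Subgroup.closure {g | ∃ (x : L) (N : ℕ), (ad ℂ L x) ^ N = 0 ∧
    (g : L →ₗ[ℂ] L) = ∑ k ∈ Finset.range N, ((k.factorial : ℂ)⁻¹) • (ad ℂ L x) ^ k}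

variable {L}

/-- The orbit of `x` under the adjoint group. -/
def adjointOrbit (x : L) : Set L := {y | ∃ g ∈ adjointGroup L, g x = y}

/-- `(e, h, f)` is an `sl₂`-triple (the zero triple is allowed, for the zero orbit). -/
def IsSl2 (e h f : L) : Prop := ⁅e, f⁆ = h ∧ ⁅h, e⁆ = (2 : ℂ) • e ∧ ⁅h, f⁆ = -((2 : ℂ) • f)

/-- Relative to a Cartan subalgebra `T` of the semisimple Lie algebra `L` and a system of simple
roots `b`, the weighted Dynkin diagram of the orbit `O` has the label `d i` at the simple root
`i`: some `e ∈ O` lies in an `sl₂`-triple `(e, h, f)` with `h ∈ T` and `αᵢ(h) = d i` for all `i`.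
-/
def IsWeightedDiagram [FiniteDimensional ℂ L] [IsKilling ℂ L] (T : LieSubalgebra ℂ L)
    [T.IsCartanSubalgebra] (b : (rootSystem T).Base) (O : Set L) (d : b.support → ℕ) : Prop :=
  ∃ e ∈ O, ∃ (h : T) (f : L), IsSl2 e (h : L) f ∧
    ∀ i : b.support, (rootSystem T).root i h = (d i : ℂ)

end LieTheory

section Weights

/-- The four coordinate planes of the octonions, for `𝕆 = ℂ ⊕ ℂ ⊕ ℂ ⊕ ℂ` (iterated doubling). -/
def plane : Fin 4 → AlgC → AlgO :=
  ![fun z => ((z, 0), (0, 0)), fun z => ((0, z), (0, 0)),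
    fun z => ((0, 0), (z, 0)), fun z => ((0, 0), (0, z))]

/-- The standard Cartan subalgebra `t` of `t(𝕆) = so₈`: the trialities whose first component
preserves each of the four coordinate planes. -/
def torus : Submodule ℂ (trialityAlgebra AlgO) where
  carrier := {θ | ∀ j z, ∃ w, comp₁ θ (plane j z) = plane j w}
  zero_mem' j z := ⟨0, by fin_cases j <;> simp [plane] <;> rfl⟩
  add_mem' := by
    intro θ η hθ hη j z
    obtain ⟨w, hw⟩ := hθ j z
    obtain ⟨w', hw'⟩ := hη j z
    refine ⟨w + w', ?_⟩
    rw [LinearMap.map_add, LinearMap.add_apply, hw, hw']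
    fin_cases j <;> simp [plane]
  smul_mem' := by
    intro c θ hθ j z
    obtain ⟨w, hw⟩ := hθ j z
    refine ⟨c • w, ?_⟩
    rw [LinearMap.map_smul, LinearMap.smul_apply, hw]
    fin_cases j <;> simp [plane]

/-- The weight `εⱼ` of `so₈`: an element `θ` of `t` acts on the `j`-th coordinate plane of `𝕆₁`
with the eigenvalues `± εⱼ(θ)`. The sign of the last one is such that the half-spin
representations `𝕆₂` and `𝕆₃` have the highest weights `ω₃` and `ω₄` below. -/
def eps (j : Fin 4) : Module.Dual ℂ torus where
  toFun θ := (![1, 1, 1, -1] : Fin 4 → ℂ) j * Complex.I *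
    form (comp₁ θ.1 (plane j (1, 0))) (plane j (0, 1))
  map_add' θ η := by
    rw [Submodule.coe_add, LinearMap.map_add, LinearMap.add_apply, LinearMap.map_add, LinearMap.add_apply, mul_add]
  map_smul' c θ := by
    rw [Submodule.coe_smul, LinearMap.map_smul, LinearMap.smul_apply, LinearMap.map_smul, LinearMap.smul_apply,
      smul_eq_mul, RingHom.id_apply, smul_eq_mul, mul_left_comm]

/-- The fundamental weight `ω₁ = ε₁` of `so₈`, with respect to the simple roots
`α₁ = ε₁ - ε₂`, `α₂ = ε₂ - ε₃`, `α₃ = ε₃ - ε₄`, `α₄ = ε₃ + ε₄`. -/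
def ω₁ : Module.Dual ℂ torus := eps 0
/-- The fundamental weight `ω₂ = ε₁ + ε₂` of `so₈`. -/
def ω₂ : Module.Dual ℂ torus := eps 0 + eps 1
/-- The fundamental weight `ω₃ = (ε₁ + ε₂ + ε₃ - ε₄) / 2` of `so₈`. -/
def ω₃ : Module.Dual ℂ torus := (1 / 2 : ℂ) • (eps 0 + eps 1 + eps 2 - eps 3)
/-- The fundamental weight `ω₄ = (ε₁ + ε₂ + ε₃ + ε₄) / 2` of `so₈`. -/
def ω₄ : Module.Dual ℂ torus := (1 / 2 : ℂ) • (eps 0 + eps 1 + eps 2 + eps 3)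

/-- The weight `ω(g) = ω₂`. -/
def ωg : Module.Dual ℂ torus := ω₂
/-- The weight `ω(g₂) = ω₁ + ω₃ + ω₄`. -/
def ωg₂ : Module.Dual ℂ torus := ω₁ + ω₃ + ω₄
/-- The weight `ω(g₃) = 2 ω₁ + 2 ω₃`. -/
def ωg₃ : Module.Dual ℂ torus := 2 • ω₁ + 2 • ω₃
/-- The weight `ω(g_Q) = 2 ω₁`. -/
def ωgQ : Module.Dual ℂ torus := 2 • ω₁

/-- The invariant form `(θ, η) ↦ tr(θ₁ η₁) / 2` of `so₈`, for which all roots of `so₈` have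
square length `2`, on the Cartan subalgebra `t`. -/
def torusForm (θ η : torus) : ℂ :=
  (1 / 2 : ℂ) * LinearMap.trace ℂ AlgO (comp₁ θ.1 ∘ₗ comp₁ η.1)

variable (A : Type) [AddCommGroup A] [Module ℂ A] [HurwitzAlgebra A]

/-- The inclusion of `t ⊂ t(𝕆)` into `g̃(A, 𝕆)`. -/
def torusInclusion (θ : torus) : TrialityModel A AlgO := ⟨(0, θ.1), 0, 0, 0⟩

variable {A}
open LieAlgebra LieAlgebra.IsKilling

/-- The orbit of `X` in `g̃(A, 𝕆)` has a weighted Dynkin diagram which corresponds to the weight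
`lam` of `so₈`, and this diagram is the Dynkin diagram with Cartan matrix `C`, labelled by `d`.

That is, `g̃(A, 𝕆)` is semisimple and there are a Cartan subalgebra `T` containing the Cartan
subalgebra `t` of `so₈` and a system of simple roots `αᵢ` with Cartan matrix `C` such that the
orbit has the labels `d i`, and `d i` is the scalar product of `lam` with `αᵢ` restricted to `t`,
i.e. the value of `αᵢ` at the element `hlam` of `t` which the invariant form identifies with `lam`.
-/
def DiagramCorrespondsTo [Module.Finite ℂ A] (X : TrialityModel A AlgO)
    (lam : Module.Dual ℂ torus) {n : ℕ} (C : Matrix (Fin n) (Fin n) ℤ) (d : Fin n → ℕ) : Prop :=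
  ∃ (_ : IsKilling ℂ (TrialityModel A AlgO)) (T : LieSubalgebra ℂ (TrialityModel A AlgO))
    (_ : T.IsCartanSubalgebra) (hT : ∀ θ : torus, torusInclusion A θ ∈ T)
    (b : (rootSystem T).Base) (σ : Fin n ≃ b.support) (hlam : torus),
    (∀ i j, b.cartanMatrix (σ i) (σ j) = C i j) ∧
    IsWeightedDiagram T b (adjointOrbit X) (fun i => d (σ.symm i)) ∧
    (∀ θ : torus, torusForm hlam θ = lam θ) ∧
    ∀ i, (rootSystem T).root (σ i) ⟨torusInclusion A hlam, hT hlam⟩ = (d i : ℂ)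

end Weights

end TrialitySeries

end

open TrialitySeries

set_option linter.unusedSimpArgs false
set_option linter.unusedSectionVars false

noncomputable section

/-! Let `t` be the Cartan subalgebra of `so₈` and `h_λ ∈ t` the element dual to `λ`. If the diagram
of the orbit in `f₄` corresponds to `λ`, the semisimple element of the triple and `h_λ` take the
same values on all simple roots, hence coincide (`CorrespondsVia.exists_isSl2`). The inclusion of
`f₄` in `g̃(A, 𝕆)` is a Lie homomorphism compatible with the inclusions of `t`. It therefore carries
the triple to a triple with the same semisimple element `h_λ`, and it maps the orbit of `X` into the
orbit of its image (`map_mem_adjointOrbit`). What remains is to find a Cartan subalgebra of `g̃(A,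
𝕆)` containing `t`, with simple roots whose values at `h_λ` are the stated labels.

Restricted to `t`, the roots of `g̃(A, 𝕆)` that do not vanish there form a system of type F₄. The
long roots are the roots of `so₈`, with multiplicity one. The short roots are the weights of the
`𝕆ᵢ`, with root spaces `Aᵢ ⊗ (weight vector)`. The centraliser of `t` is `t ⊕ t(A)`. The base `ε₂ -
ε₃`, `ε₃ + ε₄`, `-ε₄`, `(ε₁ - ε₂ - ε₃ + ε₄)/2` of F₄ takes the values `p, q, r, s` at `h_λ`. It is
lifted as follows: the two long simple root vectors are kept, the two short weight vectors are
tensored with lowest weight vectors of `A₁` and `A₃`, and the simple root vectors of `t(A)` are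
added. Those of `t(A)` give the labels `0`. When `A` is the complexification of `ℂ`, `t(A)` is a
torus, `A₁` and `A₃` split into two weight lines each, both lines are used, and so `r` and `s` occur
twice.

Neither semisimplicity nor the root system of `g̃(A, 𝕆)` is assumed. Explicit multiplication tables
in isotropic bases (`IsPairFrame`, `IsQuaternionFrame`, `IsOctonionFrame`) show that the vectors
above satisfy Chevalley's relations and generate the algebra (`eq_top_of_mem`). An algebra with such
generators, for a matrix whose inverse is non-negative, has no abelian ideal
(`hasTrivialRadical_of_basis`), and its Cartan subalgebra and base can be read off
(`IsChevalley.exists_base`). -/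

namespace TrialitySeries
open HurwitzAlgebra TrialityModel

section Instances

/-! Shortcuts for instance search. -/

variable (V : Type) [AddCommGroup V] [Module ℂ V] [HurwitzAlgebra V]

instance : AddCommGroup (trialityAlgebra V) := inferInstance
instance : AddCommMonoid (trialityAlgebra V) := inferInstance
instance : AddMonoid (trialityAlgebra V) := inferInstance
instance : AddZeroClass (trialityAlgebra V) := inferInstance
instance : Zero (trialityAlgebra V) := inferInstance
instance : Add (trialityAlgebra V) := inferInstance
instance : Neg (trialityAlgebra V) := inferInstance
instance : Module ℂ (trialityAlgebra V) := inferInstance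
instance : DistribSMul ℂ (trialityAlgebra V) := inferInstance
instance : SMulWithZero ℂ (trialityAlgebra V) := inferInstance
instance : SMulZeroClass ℂ (trialityAlgebra V) := inferInstance
instance : SMul ℂ (trialityAlgebra V) := inferInstance

end Instances

/-! ### Functoriality of adjoint orbits under homomorphisms from a semisimple Lie algebra. -/

section AdjointGroup

open LieAlgebra LieAlgebra.IsKilling

attribute [local instance] LieRing.ofAssociativeRing

/-- An endomorphism `x` of a finite-dimensional space with `[h, x] = x` is nilpotent. -/
lemma isNilpotent_of_mul_sub_mul_eq {M : Type} [AddCommGroup M] [Module ℂ M]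
    [FiniteDimensional ℂ M] {h x : Module.End ℂ M} (hx : h * x - x * h = x) : IsNilpotent x := by
  by_contra hn
  have hpow : ∀ n : ℕ, h * x ^ n - x ^ n * h = (n : ℂ) • x ^ n := by
    intro n
    induction n with
    | zero => simp
    | succ n ih =>
      have e : h * x ^ (n + 1) - x ^ (n + 1) * h
          = (h * x ^ n - x ^ n * h) * x + x ^ n * (h * x - x * h) := by
        rw [pow_succ]; noncomm_ring
      rw [e, ih, hx, pow_succ, smul_mul_assoc]
      push_cast
      module
  -- Bracketing with `h` has `x ^ n` as an eigenvector of eigenvalue `n`. If no power of `x`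
  -- vanished, all natural numbers would be eigenvalues on a finite-dimensional space.
  let T : Module.End ℂ (Module.End ℂ M) := LinearMap.mulLeft ℂ h - LinearMap.mulRight ℂ h
  have hev : ∀ n : ℕ, T.HasEigenvalue (n : ℂ) := fun n =>
    Module.End.hasEigenvalue_of_hasEigenvector (x := x ^ n)
      ⟨Module.End.mem_eigenspace_iff.2 (by simpa [T] using hpow n), fun h0 => hn ⟨n, h0⟩⟩
  exact (Set.infinite_range_of_injective (Nat.cast_injective (R := ℂ))).mono
    (by rintro _ ⟨n, rfl⟩; exact hev n) (Module.End.finite_hasEigenvalue T)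

variable {L L' : Type} [LieRing L] [LieAlgebra ℂ L] [LieRing L'] [LieAlgebra ℂ L']

/-- In a semisimple Lie algebra, an element with nilpotent adjoint action is of the form `[h, x]`. -/
lemma exists_lie_eq_self_of_isNilpotent_ad [FiniteDimensional ℂ L] [IsKilling ℂ L] {x : L}
    (hx : IsNilpotent (ad ℂ L x)) : ∃ h : L, ⁅h, x⁆ = x := by
  -- Otherwise some functional kills the range of `ad x` but not `x`. Write it as the Killing form
  -- with `z`. By invariance `z` commutes with `x`, so `ad z ∘ ad x` is nilpotent and has trace `0`,
  -- which contradicts the value at `x`.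
  suffices h : x ∈ LinearMap.range (ad ℂ L x) by
    obtain ⟨y, hy⟩ := h
    exact ⟨-y, by rw [neg_lie, lie_skew]; exact hy⟩
  by_contra hmem
  obtain ⟨φ, hφx, hφ⟩ := Submodule.exists_dual_map_eq_bot_of_notMem hmem inferInstance
  have hnd := killingForm_nondegenerate ℂ L
  obtain ⟨z, rfl⟩ := (LinearMap.BilinForm.toDual (killingForm ℂ L) hnd).surjective φ
  have hz : ∀ y, killingForm ℂ L z ⁅x, y⁆ = 0 := by
    intro y
    have : LinearMap.BilinForm.toDual (killingForm ℂ L) hnd z ⁅x, y⁆ ∈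
        (LinearMap.range (ad ℂ L x)).map (LinearMap.BilinForm.toDual (killingForm ℂ L) hnd z) :=
      ⟨_, ⟨y, rfl⟩, rfl⟩
    rw [hφ] at this
    simpa [LinearMap.BilinForm.toDual_def] using this
  have hzx : ⁅z, x⁆ = 0 := by
    have hker : ⁅z, x⁆ ∈ LinearMap.ker (killingForm ℂ L) := by
      ext y
      rw [LinearMap.zero_apply, LieModule.traceForm_apply_lie_apply, hz]
    rwa [ker_killingForm_eq_bot] at hker
  have hcomm : Commute (ad ℂ L z) (ad ℂ L x) := by
    rw [commute_iff_lie_eq, ← LieHom.map_lie, hzx, map_zero]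
  apply hφx
  rw [LinearMap.BilinForm.toDual_def, killingForm_apply_apply]
  exact (LinearMap.isNilpotent_trace_of_isNilpotent (hcomm.isNilpotent_mul_left hx)).eq_zero

/-- For general `L` a homomorphism need not preserve ad-nilpotency. For semisimple `L` nilpotency is
witnessed by a relation `[h, x] = x`, which survives any homomorphism and forces nilpotency again in
finite dimension. -/
lemma isNilpotent_ad_map [FiniteDimensional ℂ L] [IsKilling ℂ L] [FiniteDimensional ℂ L']
    (φ : L →ₗ⁅ℂ⁆ L') {x : L} (hx : IsNilpotent (ad ℂ L x)) : IsNilpotent (ad ℂ L' (φ x)) := by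
  obtain ⟨h, hh⟩ := exists_lie_eq_self_of_isNilpotent_ad hx
  refine isNilpotent_of_mul_sub_mul_eq (h := ad ℂ L' (φ h)) ?_
  rw [← LieRing.of_associative_ring_bracket, ← LieHom.map_lie, ← LieHom.map_lie, hh]

/-- All terms but the constant one have a common factor `f`, so a truncated exponential is `1` plus
a nilpotent element, at whatever length it is cut. -/
lemma exists_equiv_eq_sum_of_isNilpotent {M : Type} [AddCommGroup M] [Module ℂ M]
    {f : Module.End ℂ M} (hf : IsNilpotent f) (N : ℕ) :
    ∃ g : M ≃ₗ[ℂ] M, (g : M →ₗ[ℂ] M) =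
      ∑ k ∈ Finset.range (N + 1), ((k.factorial : ℂ)⁻¹) • f ^ k := by
  have hunit : IsUnit (∑ k ∈ Finset.range (N + 1), ((k.factorial : ℂ)⁻¹) • f ^ k) := by
    rw [Finset.sum_range_succ']
    simp only [Nat.factorial_zero, Nat.cast_one, inv_one, pow_zero, one_smul]
    refine IsNilpotent.isUnit_add_one ?_
    have e : ∑ k ∈ Finset.range N, (((k + 1).factorial : ℂ)⁻¹) • f ^ (k + 1) =
        f * ∑ k ∈ Finset.range N, (((k + 1).factorial : ℂ)⁻¹) • f ^ k := by
      rw [Finset.mul_sum]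
      exact Finset.sum_congr rfl fun k _ => by rw [mul_smul_comm, pow_succ']
    rw [e]
    refine Commute.isNilpotent_mul_right ?_ hf
    exact Commute.sum_right _ _ _ fun k _ => ((Commute.refl f).pow_right k).smul_right _
  exact ⟨LinearMap.GeneralLinearGroup.generalLinearEquiv ℂ M hunit.unit, rfl⟩

/-- On generators, `exp (ad x)` is intertwined by `φ` with `exp (ad (φ x))`, which makes sense
because `φ x` is again ad-nilpotent. The property passes to products and inverses. -/
lemma exists_adjointGroup_extend [FiniteDimensional ℂ L] [IsKilling ℂ L] [FiniteDimensional ℂ L']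
    (φ : L →ₗ⁅ℂ⁆ L') {g : L ≃ₗ[ℂ] L} (hg : g ∈ adjointGroup L) :
    ∃ g' ∈ adjointGroup L', ∀ y, φ (g y) = g' (φ y) := by
  induction hg using Subgroup.closure_induction with
  | mem g hg =>
    obtain ⟨x, N, hN, hg⟩ := hg
    have hn : IsNilpotent (ad ℂ L' (φ x)) := isNilpotent_ad_map φ ⟨N, hN⟩
    obtain ⟨N', hN'⟩ := id hn
    obtain ⟨g', hg'⟩ := exists_equiv_eq_sum_of_isNilpotent hn (max N N')
    -- The nilpotency exponents `N` of `ad x` and `N'` of `ad (φ x)` may differ, so both exponential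
    -- sums are brought to one common length. The extra `1` guarantees that the constant term is
    -- present.
    have hsum : ∑ k ∈ Finset.range N, ((k.factorial : ℂ)⁻¹) • ad ℂ L x ^ k =
        ∑ k ∈ Finset.range (max N N' + 1), ((k.factorial : ℂ)⁻¹) • ad ℂ L x ^ k := by
      refine Finset.sum_subset (Finset.range_mono (by omega)) fun k _ hk => ?_
      rw [pow_eq_zero_of_le (by simpa using hk) hN, smul_zero]
    refine ⟨g', Subgroup.subset_closure ⟨_, _, pow_eq_zero_of_le (by omega) hN', hg'⟩, fun y => ?_⟩
    have e : ∀ k : ℕ, φ ((ad ℂ L x ^ k) y) = (ad ℂ L' (φ x) ^ k) (φ y) := by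
      intro k
      induction k with
      | zero => simp
      | succ k ih =>
        rw [pow_succ', pow_succ', Module.End.mul_apply, Module.End.mul_apply, ← ih]
        simp
    rw [← LinearEquiv.coe_coe, ← LinearEquiv.coe_coe, hg, hsum, hg']
    simp [LinearMap.sum_apply, map_sum, e]
  | one => exact ⟨1, one_mem _, fun y => rfl⟩
  | mul g₁ g₂ _ _ h₁ h₂ =>
    obtain ⟨k₁, hk₁, e₁⟩ := h₁
    obtain ⟨k₂, hk₂, e₂⟩ := h₂
    exact ⟨k₁ * k₂, mul_mem hk₁ hk₂, fun y => by
      rw [LinearEquiv.mul_apply, LinearEquiv.mul_apply, e₁, e₂]⟩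
  | inv g _ h =>
    obtain ⟨k, hk, e⟩ := h
    refine ⟨k⁻¹, inv_mem hk, fun y => ?_⟩
    apply k.injective
    rw [← e]
    change φ (g (g.symm y)) = k (k.symm (φ y))
    simp

lemma map_mem_adjointOrbit [FiniteDimensional ℂ L] [IsKilling ℂ L] [FiniteDimensional ℂ L']
    (φ : L →ₗ⁅ℂ⁆ L') {x y : L} (hy : y ∈ adjointOrbit x) : φ y ∈ adjointOrbit (φ x) := by
  obtain ⟨g, hg, rfl⟩ := hy
  obtain ⟨g', hg', e⟩ := exists_adjointGroup_extend φ hg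
  exact ⟨g', hg', (e x).symm⟩

end AdjointGroup

end TrialitySeries

namespace TrialitySeries
open HurwitzAlgebra TrialityModel

/-! ### Semisimplicity of a Lie algebra with Chevalley generators. -/

section ChevalleyGenerators

open LieAlgebra LieModule

variable {n : ℕ} {L : Type} [LieRing L] [LieAlgebra ℂ L] [FiniteDimensional ℂ L]

/-- The weights of a Lie algebra with Chevalley generators are the integral combinations of the
simple roots with coefficients of the same sign. -/
lemma weight_eq_zero_or_pos_or_neg {H : LieSubalgebra ℂ L} (b : LieAlgebra.Basis (Fin n) H)
    (χ : letI := b.isLieAbelian_cartan; Weight ℂ H L) :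
    (χ : H → ℂ) = 0 ∨ (∃ m : Fin n → ℕ, m ≠ 0 ∧ (χ : H → ℂ) = ∑ i, m i • b.baseSupp i) ∨
      (∃ m : Fin n → ℕ, m ≠ 0 ∧ (χ : H → ℂ) = -∑ i, m i • b.baseSupp i) := by
  have := b.isLieAbelian_cartan
  -- The triangular decomposition exhibits the whole algebra as a sum of root spaces indexed by `s`.
  -- As generalised weight spaces are independent, no weight lies outside `s`.
  let s : Set (H → ℂ) := {0} ∪
    {f | ∃ n : Fin n → ℕ, n ≠ 0 ∧ f = -∑ i, n i • b.baseSupp i} ∪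
    {f | ∃ n : Fin n → ℕ, n ≠ 0 ∧ f = ∑ i, n i • b.baseSupp i}
  have hs : ⨆ α ∈ s, rootSpace H α = ⊤ := by
    have := b.iSup_cartan_borelLower_borelUpper_eq_top
    rw [b.borelLower_eq, b.borelUpper_eq, b.cartan_eq] at this
    rw [iSup_union, iSup_union]
    simpa [iSup_and, iSup_comm (ι := H → ℂ)] using this
  have hmem : ⇑χ ∈ s :=
    (iSupIndep_genWeightSpace ℂ H L).mem_of_biSup_eq_top hs χ.genWeightSpace_ne_bot
  rcases hmem with (h | h) | h
  · exact .inl h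
  · exact .inr (.inr h)
  · obtain ⟨m, hm, h⟩ := h
    exact .inr (.inl ⟨m, hm, by rw [h]⟩)

variable {H : LieSubalgebra ℂ L}

lemma eigenvector_eq_zero_or_pos_or_neg (b : LieAlgebra.Basis (Fin n) H) {v : L} (hv : v ≠ 0)
    {χ : Module.Dual ℂ H} (h : ∀ x : H, ⁅(x : L), v⁆ = χ x • v) :
    (χ = 0 ∧ v ∈ H) ∨ (∃ m : Fin n → ℕ, m ≠ 0 ∧ χ = ∑ i, m i • b.baseSupp i) ∨
      (∃ m : Fin n → ℕ, m ≠ 0 ∧ χ = -∑ i, m i • b.baseSupp i) := by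
  have := b.isLieAbelian_cartan
  have hmem : v ∈ genWeightSpace L (χ : H → ℂ) :=
    weightSpace_le_genWeightSpace _ _ ((mem_weightSpace _ _).2 h)
  have hne : genWeightSpace L (χ : H → ℂ) ≠ ⊥ := fun h0 => hv (by simpa [h0] using hmem)
  rcases weight_eq_zero_or_pos_or_neg b ⟨χ, hne⟩ with h | ⟨m, hm, h⟩ | ⟨m, hm, h⟩
  · left
    have h0 : χ = 0 := by ext x; simpa using congrFun h x
    refine ⟨h0, ?_⟩
    have h1 : v ∈ rootSpace H (0 : H → ℂ) := by
      rwa [h0] at hmem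
    rw [← b.cartan_eq] at h1
    exact h1
  · exact .inr (.inl ⟨m, hm, by ext x; simpa using congrFun h x⟩)
  · exact .inr (.inr ⟨m, hm, by ext x; simpa using congrFun h x⟩)

/-- The simple roots are independent and as many as the dimension of `H`, so they span its dual. -/
lemma eq_zero_of_baseSupp_eq_zero (b : LieAlgebra.Basis (Fin n) H) {x : H}
    (hx : ∀ i, b.baseSupp i x = 0) : x = 0 := by
  have hfr : Module.finrank ℂ H = n := by
    have := Module.finrank_eq_card_basis ((Module.Basis.span b.linInd).map
      (LinearEquiv.ofEq _ _ b.coe_cartan_eq_span).symm)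
    rwa [Fintype.card_fin] at this
  have hspan := b.linearIndependent_baseSupp.span_eq_top_of_card_eq_finrank'
    (by rw [Fintype.card_fin, Subspace.dual_finrank_eq, hfr])
  refine (Module.forall_dual_apply_eq_zero_iff ℂ x).1 fun φ => ?_
  have hφ : φ ∈ Submodule.span ℂ (Set.range b.baseSupp) := hspan ▸ Submodule.mem_top
  induction hφ using Submodule.span_induction with
  | mem φ h => obtain ⟨i, rfl⟩ := h; exact hx i
  | zero => rfl
  | add φ ψ _ _ h h' => rw [LinearMap.add_apply, h, h', add_zero]
  | smul c φ _ h => rw [LinearMap.smul_apply, h, smul_zero]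

/-- If a simple root did not vanish at `x`, the ideal would contain `eᵢ` (from `[x, eᵢ]`), then `hᵢ
= [eᵢ, fᵢ]`, and `[hᵢ, eᵢ] = 2 eᵢ` would contradict commutativity. -/
lemma eq_zero_of_mem_abelian_ideal_of_mem_cartan (b : LieAlgebra.Basis (Fin n) H)
    {I : LieIdeal ℂ L} (hI : ∀ x ∈ I, ∀ y ∈ I, ⁅x, y⁆ = 0) {x : L} (hx : x ∈ I) (hxH : x ∈ H) :
    x = 0 := by
  suffices h : (⟨x, hxH⟩ : H) = 0 from congrArg Subtype.val h
  refine eq_zero_of_baseSupp_eq_zero b fun i => ?_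
  by_contra hne
  have he : b.e i ∈ I := by
    have h1 : b.baseSupp i ⟨x, hxH⟩ • b.e i ∈ I := by
      rw [b.baseSupp_apply_smul_e]
      exact lie_mem_left _ _ _ _ _ hx
    exact (Submodule.smul_mem_iff I.toSubmodule hne).1 h1
  have hh : b.h i ∈ I := by
    rw [← (b.sl2 i).lie_e_f]
    exact lie_mem_left _ _ _ _ _ he
  have h2 := (b.sl2 i).lie_h_e_smul ℂ
  rw [hI _ hh _ he] at h2
  exact (b.sl2 i).e_ne_zero (by simpa using h2.symm)

/-- Induction on the height `N` of the weight reduces to a vector killed by all `fⱼ`. Such a lowest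
weight vector has non-positive value on every coroot. A non-negative inverse of the matrix turns
this into `m ≤ 0`, which is impossible for a non-zero positive weight. -/
lemma false_of_pos_weight_abelian_ideal (b : LieAlgebra.Basis (Fin n) H)
    {C : Matrix (Fin n) (Fin n) ℤ} {c : ℤ} (hc : 0 < c) (hC : ∀ i j, 0 ≤ C i j)
    (hAC : b.A * C = c • (1 : Matrix (Fin n) (Fin n) ℤ)) {I : LieIdeal ℂ L}
    (hI : ∀ x ∈ I, ∀ y ∈ I, ⁅x, y⁆ = 0) (N : ℕ) :
    ∀ (m : Fin n → ℕ) (v : L), ∑ i, m i = N → m ≠ 0 → v ∈ I → v ≠ 0 →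
      (∀ x : H, ⁅(x : L), v⁆ = (∑ i, m i • b.baseSupp i) x • v) → False := by
  have hinj : ∀ m m' : Fin n → ℕ, ∑ i, m i • b.baseSupp i = ∑ i, m' i • b.baseSupp i → m = m' :=
    fun m m' h => funext fun i => Fintype.linearIndependent_iffₛ.mp
      (b.linearIndependent_baseSupp.restrict_scalars' ℕ) m m' h i
  induction N using Nat.strong_induction_on with
  | _ N ih =>
  intro m v hN hm hvI hv hwt
  have hsingle : ∀ j, ∑ i, (Pi.single j 1 : Fin n → ℕ) i • b.baseSupp i = b.baseSupp j := by
    intro j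
    rw [Finset.sum_eq_single j (fun i _ hi => by simp [hi]) (by simp)]
    simp
  -- If `[fⱼ, v] ≠ 0`, its weight is `0`, positive or negative. Zero would give a non-zero element
  -- of the ideal in the Cartan subalgebra. A positive weight has smaller height, so the induction
  -- applies. A negative one would write a simple root as a sum of two non-zero non-negative
  -- combinations.
  have hf : ∀ j, ⁅b.f j, v⁆ = 0 := by
    intro j
    by_contra hne
    have hfI : ⁅b.f j, v⁆ ∈ I := lie_mem_right _ _ _ _ _ hvI
    have hw : ∀ x : H, ⁅(x : L), ⁅b.f j, v⁆⁆ =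
        ((∑ i, m i • b.baseSupp i) - b.baseSupp j) x • ⁅b.f j, v⁆ := by
      intro x
      have h1 := b.baseSupp_apply_smul_f j x
      rw [leibniz_lie, hwt, lie_smul]
      simp only [LieSubalgebra.coe_bracket_of_module] at h1
      rw [← neg_eq_iff_eq_neg] at h1
      simp only [LieSubalgebra.coe_bracket_of_module, ← h1, LinearMap.sub_apply, neg_lie, smul_lie,
        sub_smul]
      abel
    rcases eigenvector_eq_zero_or_pos_or_neg b hne hw with ⟨_, h0⟩ | ⟨m', hm', h0⟩ | ⟨m', hm', h0⟩
    · exact hne (eq_zero_of_mem_abelian_ideal_of_mem_cartan b hI hfI h0)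
    · have h1 : m = m' + Pi.single j 1 := by
        refine hinj _ _ ?_
        simp only [Pi.add_apply, add_smul, Finset.sum_add_distrib, hsingle]
        rw [← h0]; abel
      refine ih (∑ i, m' i) ?_ m' _ rfl hm' hfI hne (by rw [← h0]; exact hw)
      rw [← hN, h1]
      simp [Finset.sum_add_distrib]
    · have h1 : m + m' = Pi.single j 1 := by
        refine hinj _ _ ?_
        simp only [Pi.add_apply, add_smul, Finset.sum_add_distrib, hsingle]
        rw [← neg_eq_iff_eq_neg] at h0
        rw [← h0]; abel
      have h2 : ∑ i, m i + ∑ i, m' i = 1 := by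
        rw [← Finset.sum_add_distrib]
        have : ∀ i, m i + m' i = (Pi.single j 1 : Fin n → ℕ) i := fun i => congrFun h1 i
        simp [this]
      have hpos : ∀ k : Fin n → ℕ, k ≠ 0 → 0 < ∑ i, k i := by
        intro k hk
        obtain ⟨i, hi⟩ := Function.ne_iff.1 hk
        exact Finset.sum_pos' (fun _ _ => Nat.zero_le _) ⟨i, Finset.mem_univ _, Nat.pos_of_ne_zero hi⟩
      have := hpos m hm
      have := hpos m' hm'
      omega
  -- For the reversed triple `(fⱼ, -hⱼ, eⱼ)` the vector `v` is primitive, and in finite dimension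
  -- its eigenvalue is a natural number.
  have hnat : ∀ j, ∃ k : ℕ, ∑ i, (m i : ℤ) * b.A i j = -k := by
    intro j
    have hp : IsSl2Triple.HasPrimitiveVectorWith (b.sl2 j).symm v
        (-(∑ i, (m i : ℂ) * (b.A i j : ℂ))) := by
      refine ⟨hv, ?_, hf j⟩
      have := hwt (b.h' j)
      rw [neg_lie, neg_smul, neg_inj]
      change ⁅b.h j, v⁆ = _ at this
      rw [this]
      simp [LinearMap.sum_apply]
    obtain ⟨k, hk⟩ := hp.exists_nat
    refine ⟨k, ?_⟩
    rw [neg_eq_iff_eq_neg] at hk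
    exact_mod_cast hk
  choose k hk using hnat
  refine hm (funext fun l => ?_)
  -- Multiply the row identity `m A = -k` on the right by `C`, with `A C = c`.
  have h1 : c * (m l : ℤ) = -∑ j, (k j : ℤ) * C j l := by
    have h2 : ∀ i, ∑ j, b.A i j * C j l = if i = l then c else 0 := by
      intro i
      have := congrFun (congrFun hAC i) l
      simpa [Matrix.mul_apply, Matrix.one_apply] using this
    calc c * (m l : ℤ) = ∑ i, (m i : ℤ) * ∑ j, b.A i j * C j l := by simp only [h2]; simp [mul_comm]
      _ = ∑ j, (∑ i, (m i : ℤ) * b.A i j) * C j l := by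
        simp only [Finset.mul_sum, Finset.sum_mul, mul_assoc]
        exact Finset.sum_comm
      _ = _ := by simp [hk]
  have h3 : 0 ≤ ∑ j, (k j : ℤ) * C j l :=
    Finset.sum_nonneg fun j _ => mul_nonneg (by positivity) (hC j l)
  have h4 : (m l : ℤ) ≤ 0 := by
    by_contra h5
    have := mul_pos hc (not_le.1 h5)
    omega
  simpa using h4

/-- A Lie algebra with Chevalley generators, for a matrix with a non-negative inverse, is
semisimple. -/
lemma hasTrivialRadical_of_basis (b : LieAlgebra.Basis (Fin n) H)
    {C : Matrix (Fin n) (Fin n) ℤ} {c : ℤ} (hc : 0 < c) (hC : ∀ i j, 0 ≤ C i j)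
    (hAC : b.A * C = c • (1 : Matrix (Fin n) (Fin n) ℤ)) : HasTrivialRadical ℂ L := by
  have := b.isLieAbelian_cartan
  rw [hasTrivialRadical_iff_no_abelian_ideals]
  intro I hIab
  have hI : ∀ x ∈ I, ∀ y ∈ I, ⁅x, y⁆ = 0 := fun x hx y hy =>
    congrArg Subtype.val (hIab.trivial (⟨x, hx⟩ : I) ⟨y, hy⟩)
  by_contra hne
  have : Nontrivial I := (LieSubmodule.nontrivial_iff_ne_bot ℂ L L).2 hne
  obtain ⟨χ, hχ⟩ := exists_nontrivial_weightSpace_of_isNilpotent ℂ H I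
  obtain ⟨⟨v, hv⟩, hv0⟩ := exists_ne (0 : weightSpace I χ)
  rw [mem_weightSpace] at hv
  have hv1 : ∀ x : H, ⁅(x : L), (v : L)⁆ = χ x • (v : L) := fun x => congrArg Subtype.val (hv x)
  have hv2 : (v : L) ≠ 0 := fun h => hv0 (by ext; exact h)
  rcases eigenvector_eq_zero_or_pos_or_neg b hv2 hv1 with ⟨_, h⟩ | ⟨m, hm, h⟩ | ⟨m, hm, h⟩
  · exact hv2 (eq_zero_of_mem_abelian_ideal_of_mem_cartan b hI v.2 h)
  · exact false_of_pos_weight_abelian_ideal b hc hC hAC hI _ m v rfl hm v.2 hv2 (by rw [← h]; exact hv1)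
  -- Exchanging the `eᵢ` with the `fᵢ` negates the simple roots and keeps the matrix, so a negative
  -- weight becomes a positive one.
  · refine false_of_pos_weight_abelian_ideal b.symm hc hC hAC hI _ m v rfl hm v.2 hv2 ?_
    simp only [b.symm_baseSupp, Pi.neg_apply, smul_neg, Finset.sum_neg_distrib]
    rw [← h]; exact hv1

end ChevalleyGenerators

end TrialitySeries

namespace TrialitySeries
open HurwitzAlgebra TrialityModel

/-! ### From Chevalley relations to a Cartan subalgebra and a base of the root system. -/

section Generators

open LieAlgebra LieAlgebra.IsKilling LieModule

variable {n : ℕ} {L : Type} [LieRing L] [LieAlgebra ℂ L]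

/-- `e` and `f` are Chevalley generators of `L` for the matrix `M`. -/
structure IsChevalley (M : Matrix (Fin n) (Fin n) ℤ) (e f : Fin n → L) : Prop where
  e_ne_zero : ∀ i, e i ≠ 0
  diag : ∀ i, M i i = 2
  -- The convention is `M i j = αᵢ(hⱼ)`: rows are indexed by roots, columns by coroots.
  lie_lie_e : ∀ i j, ⁅⁅e j, f j⁆, e i⁆ = (M i j : ℂ) • e i
  lie_lie_f : ∀ i j, ⁅⁅e j, f j⁆, f i⁆ = -((M i j : ℂ) • f i)
  lie_e_f : ∀ i j, i ≠ j → ⁅e i, f j⁆ = 0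
  span : LieSubalgebra.lieSpan ℂ L (Set.range e ∪ Set.range f) = ⊤

variable {M C : Matrix (Fin n) (Fin n) ℤ} {c : ℤ} {e f : Fin n → L}

lemma det_ne_zero_of_mul_eq_smul_one (hc : 0 < c)
    (hMC : M * C = c • (1 : Matrix (Fin n) (Fin n) ℤ)) : M.det ≠ 0 := by
  intro h0
  have h := congrArg Matrix.det hMC
  rw [Matrix.det_mul, h0, zero_mul, Matrix.det_smul, Matrix.det_one, _root_.mul_one] at h
  exact (pow_pos hc _).ne h

/-- Chevalley generators with a nondegenerate matrix as a basis in the sense of Mathlib. -/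
def IsChevalley.basis (hg : IsChevalley M e f) (hM : M.det ≠ 0) :
    LieAlgebra.Basis (Fin n)
      (LieSubalgebra.lieSpan ℂ L (Set.range fun i => ⁅e i, f i⁆)) where
  A := M
  h i := ⁅e i, f i⁆
  e := e
  f := f
  cartan_eq_lieSpan := rfl
  span_ef := hg.span
  linInd := by
    rw [Fintype.linearIndependent_iff]
    intro g hgs
    -- Applying a linear relation between the coroots to `eᵢ` yields the `i`-th entry of `M g`.
    -- Independence thus follows from the invertibility of `M`.
    have h1 : (M.map (Int.cast : ℤ → ℂ)).mulVec g = 0 := by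
      ext i
      have h2 := congrArg (fun x => ⁅x, e i⁆) hgs
      simp only [LieRing.of_associative_ring_bracket, sum_lie, smul_lie, hg.lie_lie_e, zero_lie,
        smul_smul, ← Finset.sum_smul] at h2
      have h3 := (smul_eq_zero.1 h2).resolve_right (hg.e_ne_zero i)
      simpa [Matrix.mulVec, dotProduct, mul_comm] using h3
    have hdet : (M.map (Int.cast : ℤ → ℂ)).det ≠ 0 := by
      have := (Int.castRingHom ℂ).map_det M
      rw [RingHom.mapMatrix_apply] at this
      change (M.map (Int.castRingHom ℂ)).det ≠ 0
      rw [← this]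
      simpa using hM
    exact fun i => congrFun (Matrix.eq_zero_of_mulVec_eq_zero hdet h1) i
  nondegen := Matrix.nondegenerate_of_det_ne_zero hM
  sl2 i := by
    have h1 := hg.lie_lie_e i i
    have h2 := hg.lie_lie_f i i
    rw [hg.diag] at h1 h2
    push_cast at h1 h2
    refine ⟨fun h0 => hg.e_ne_zero i ?_, rfl, ?_, ?_⟩
    · rw [h0, zero_lie] at h1
      simpa using h1.symm
    · rw [h1, two_smul, two_nsmul]
    · rw [h2, two_smul, two_nsmul]
  lie_h_h i j := by
    rw [leibniz_lie, hg.lie_lie_e, hg.lie_lie_f]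
    simp
  lie_h_e i j := by rw [hg.lie_lie_e, Int.cast_smul_eq_zsmul]
  lie_h_f i j := by rw [hg.lie_lie_f, ← Int.cast_smul_eq_zsmul ℂ, Int.cast_neg, neg_smul]
  lie_e_f_ne := hg.lie_e_f

/-- An element acting on Chevalley generators by opposite scalars lies in the Cartan subalgebra. -/
lemma IsChevalley.mem_cartan [FiniteDimensional ℂ L] (hg : IsChevalley M e f) (hM : M.det ≠ 0)
    {x : L} (hx : ∀ i, ∃ k : ℂ, ⁅x, e i⁆ = k • e i ∧ ⁅x, f i⁆ = -(k • f i)) :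
    x ∈ LieSubalgebra.lieSpan ℂ L (Set.range fun i => ⁅e i, f i⁆) := by
  let b := hg.basis hM
  have := b.isLieAbelian_cartan
  -- By Jacobi the opposite scalars on `eᵢ` and `fᵢ` cancel on `[eᵢ, fᵢ]`. So `x` centralises the
  -- span of the coroots, and the zero root space of that span is the span itself.
  have hcomm : ∀ y ∈ LieSubalgebra.lieSpan ℂ L (Set.range fun i => ⁅e i, f i⁆), ⁅y, x⁆ = 0 := by
    intro y hy
    rw [← LieSubalgebra.mem_toSubmodule, b.coe_cartan_eq_span] at hy
    induction hy using Submodule.span_induction with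
    | mem y hy =>
      obtain ⟨i, rfl⟩ := hy
      obtain ⟨k, h1, h2⟩ := hx i
      change ⁅⁅e i, f i⁆, x⁆ = 0
      rw [← lie_skew, leibniz_lie, h1, h2]
      simp
    | zero => exact zero_lie _
    | add y z _ _ h h' => rw [add_lie, h, h', add_zero]
    | smul k y _ h => rw [smul_lie, h, smul_zero]
  have h1 : x ∈ rootSpace (LieSubalgebra.lieSpan ℂ L (Set.range fun i => ⁅e i, f i⁆)) 0 := by
    refine weightSpace_le_genWeightSpace _ _ ((mem_weightSpace _ _).2 fun y => ?_)
    rw [Pi.zero_apply, zero_smul]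
    exact hcomm y y.2
  rw [← b.cartan_eq] at h1
  exact h1

/-- The root system of a Lie algebra with Chevalley generators for a matrix with a non-negative
inverse. -/
lemma IsChevalley.exists_base [FiniteDimensional ℂ L] (hg : IsChevalley M e f) (hc : 0 < c)
    (hC : ∀ i j, 0 ≤ C i j) (hMC : M * C = c • (1 : Matrix (Fin n) (Fin n) ℤ)) :
    ∃ (_ : IsKilling ℂ L) (T : LieSubalgebra ℂ L) (_ : T.IsCartanSubalgebra)
      (b : (rootSystem T).Base) (σ : Fin n ≃ b.support),
      (∀ i j, b.cartanMatrix (σ i) (σ j) = M i j) ∧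
      (∀ x : L, (∀ i, ∃ k : ℂ, ⁅x, e i⁆ = k • e i ∧ ⁅x, f i⁆ = -(k • f i)) → x ∈ T) ∧
      ∀ (x : T) i (k : ℂ), ⁅(x : L), e i⁆ = k • e i → (rootSystem T).root (σ i) x = k := by
  have hM := det_ne_zero_of_mul_eq_smul_one hc hMC
  let b := hg.basis hM
  have hrad : HasTrivialRadical ℂ L := hasTrivialRadical_of_basis b hc hC hMC
  -- The Cartan subalgebra is the span of the coroots. The value of a simple root is found as the
  -- eigenvalue on the generator `eᵢ`.
  refine ⟨inferInstance, _, b.isCartanSubalgebra, b.base, b.baseSupportEquiv, fun i j => ?_,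
    fun x hx => hg.mem_cartan hM hx, fun x i k hk => ?_⟩
  · rw [b.cartanMatrix_base_eq]
    simp only [Matrix.reindex_apply, Matrix.submatrix_apply, Equiv.symm_apply_apply]
    rfl
  · have h1 := b.baseSupp_apply_smul_e i x
    change _ = ⁅(x : L), e i⁆ at h1
    rw [hk] at h1
    exact smul_left_injective ℂ (hg.e_ne_zero i) h1

/-- An element of a Cartan subalgebra is determined by the values of the simple roots. -/
lemma eq_of_simpleRoot_eq [FiniteDimensional ℂ L] [IsKilling ℂ L] {T : LieSubalgebra ℂ L}
    [T.IsCartanSubalgebra] (b : (rootSystem T).Base) {x y : T}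
    (h : ∀ i : b.support, (rootSystem T).root i x = (rootSystem T).root i y) : x = y := by
  rw [← sub_eq_zero]
  have hspan : Submodule.span ℂ ((rootSystem T).root '' b.support) = ⊤ := by
    rw [b.span_root_support]
    exact RootPairing.IsRootSystem.span_root_eq_top
  refine (Module.forall_dual_apply_eq_zero_iff ℂ _).1 fun φ => ?_
  have hφ : φ ∈ Submodule.span ℂ ((rootSystem T).root '' b.support) := hspan ▸ Submodule.mem_top
  induction hφ using Submodule.span_induction with
  | mem φ hφ =>
    obtain ⟨i, hi, rfl⟩ := hφ
    rw [LinearMap.map_sub, h ⟨i, hi⟩, sub_self]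
  | zero => rfl
  | add φ ψ _ _ h h' => rw [LinearMap.add_apply, h, h', add_zero]
  | smul c φ _ h => rw [LinearMap.smul_apply, h, smul_zero]

lemma IsSl2.map {L' : Type} [LieRing L'] [LieAlgebra ℂ L'] (φ : L →ₗ⁅ℂ⁆ L') {x y z : L}
    (h : IsSl2 x y z) : IsSl2 (φ x) (φ y) (φ z) := by
  obtain ⟨h1, h2, h3⟩ := h
  refine ⟨?_, ?_, ?_⟩
  · rw [← LieHom.map_lie, h1]
  · rw [← LieHom.map_lie, h2, map_smul]
  · rw [← LieHom.map_lie, h3, map_neg, map_smul]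

end Generators

end TrialitySeries

namespace TrialitySeries
open HurwitzAlgebra TrialityModel

/-! ### Transport of a weighted diagram along a homomorphism. -/

section Diagram

open LieAlgebra LieAlgebra.IsKilling LieModule

variable {A : Type} [AddCommGroup A] [Module ℂ A] [HurwitzAlgebra A]

lemma inclusion_torusInclusion (θ : torus) :
    inclusion A AlgO (torusInclusion AlgR θ) = torusInclusion A θ := by
  apply TrialityModel.ext
  · rfl
  all_goals exact LinearMap.map_zero _

/-- `DiagramCorrespondsTo` for an arbitrary Lie algebra `L`, with a map `j` to `L`, where the values
of the weight `lam` and of the form `B` are given on a type `S`. -/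
def CorrespondsVia {L : Type} [LieRing L] [LieAlgebra ℂ L] [FiniteDimensional ℂ L]
    {S : Type} (B : S → S → ℂ) (lam : S → ℂ) (j : S → L) (O : Set L) {n : ℕ}
    (C : Matrix (Fin n) (Fin n) ℤ) (d : Fin n → ℕ) : Prop :=
  ∃ (_ : IsKilling ℂ L) (T : LieSubalgebra ℂ L) (_ : T.IsCartanSubalgebra)
    (hT : ∀ θ, j θ ∈ T) (b : (rootSystem T).Base) (σ : Fin n ≃ b.support) (hlam : S),
    (∀ i j, b.cartanMatrix (σ i) (σ j) = C i j) ∧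
    IsWeightedDiagram T b O (fun i => d (σ.symm i)) ∧
    (∀ θ, B hlam θ = lam θ) ∧
    ∀ i, (rootSystem T).root (σ i) ⟨j hlam, hT hlam⟩ = (d i : ℂ)

section

variable {L L' : Type} [LieRing L] [LieAlgebra ℂ L] [FiniteDimensional ℂ L] [LieRing L']
  [LieAlgebra ℂ L'] [FiniteDimensional ℂ L'] {S : Type} {B : S → S → ℂ} {lam : S → ℂ}
  {j : S → L}

/-- The semisimple element of an `sl₂`-triple defining a diagram which corresponds to a weight. -/
lemma CorrespondsVia.exists_isSl2 {O : Set L} {n : ℕ} {C : Matrix (Fin n) (Fin n) ℤ}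
    {d : Fin n → ℕ} (h : CorrespondsVia B lam j O C d) :
    ∃ (_ : IsKilling ℂ L) (t : S) (e f : L),
      (∀ θ, B t θ = lam θ) ∧ e ∈ O ∧ IsSl2 e (j t) f := by
  obtain ⟨hK, T, hT, htT, b, σ, t, -, ⟨e, he, h, f, hsl, hlab⟩, hform, hroot⟩ := h
  refine ⟨hK, t, e, f, hform, he, ?_⟩
  -- Both elements take the value of the label on each simple root. This moves the semisimple
  -- element of the triple into the image of `t`, where every later homomorphism can follow it.
  have h0 : h = ⟨j t, htT t⟩ := eq_of_simpleRoot_eq b fun i => by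
    have h2 := hroot (σ.symm i)
    rw [Equiv.apply_symm_apply] at h2
    rw [hlab, h2]
  rw [h0] at hsl
  exact hsl

/-- Chevalley generators of `L'` on which `t` acts by weights transport a diagram which
corresponds to a weight from `L` to `L'`. -/
lemma CorrespondsVia.map {X : L} {m n : ℕ} {C₀ : Matrix (Fin m) (Fin m) ℤ} {d₀ : Fin m → ℕ}
    (h : CorrespondsVia B lam j (adjointOrbit X) C₀ d₀) (φ : L →ₗ⁅ℂ⁆ L')
    {M C : Matrix (Fin n) (Fin n) ℤ} {c : ℤ}
    {e f : Fin n → L'} {d : Fin n → ℕ} (hg : IsChevalley M e f) (hc : 0 < c)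
    (hC : ∀ i j, 0 ≤ C i j) (hMC : M * C = c • (1 : Matrix (Fin n) (Fin n) ℤ))
    (hθ : ∀ (θ : S) i, ∃ k : ℂ, ⁅φ (j θ), e i⁆ = k • e i ∧ ⁅φ (j θ), f i⁆ = -(k • f i))
    (hd : ∀ θ : S, (∀ η, B θ η = lam η) → ∀ i, ⁅φ (j θ), e i⁆ = (d i : ℂ) • e i) :
    CorrespondsVia B lam (fun θ => φ (j θ)) (adjointOrbit (φ X)) M d := by
  obtain ⟨hK₀, t, e₀, f₀, hform, he₀, hsl⟩ := h.exists_isSl2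
  obtain ⟨hK, T, hcart, b, σ, hmat, hmem, hroot⟩ := hg.exists_base hc hC hMC
  have hT : ∀ θ, φ (j θ) ∈ T := fun θ => hmem _ (hθ θ)
  have hval : ∀ i, (rootSystem T).root (σ i) ⟨φ (j t), hT t⟩ = (d i : ℂ) :=
    fun i => hroot _ i _ (hd t hform i)
  refine ⟨hK, T, hcart, hT, b, σ, t, hmat, ⟨φ e₀, map_mem_adjointOrbit _ he₀,
    ⟨φ (j t), hT t⟩, φ f₀, hsl.map φ, fun i => ?_⟩, hform, hval⟩
  have h1 := hval (σ.symm i)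
  rw [Equiv.apply_symm_apply] at h1
  exact h1

end

attribute [local irreducible] torus trialityAlgebra

/-- The two sides agree by definition. The right one fits the transport argument for arbitrary Lie
algebras, which needs nothing about the triality model. -/
lemma diagramCorrespondsTo_iff [Module.Finite ℂ A] {X : TrialityModel A AlgO}
    {lam : Module.Dual ℂ torus} {n : ℕ} {C : Matrix (Fin n) (Fin n) ℤ} {d : Fin n → ℕ} :
    DiagramCorrespondsTo X lam C d ↔ CorrespondsVia torusForm lam (torusInclusion A) (adjointOrbit X) C d :=
  Iff.rfl

/-- Chevalley generators of `g̃(A, 𝕆)` on which `t` acts by weights transport a diagram which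
corresponds to a weight from `f₄` to `g̃(A, 𝕆)`. -/
lemma diagramCorrespondsTo_inclusion [Module.Finite ℂ A] {X : LieF₄}
    {lam : Module.Dual ℂ torus} {m n : ℕ} {C₀ : Matrix (Fin m) (Fin m) ℤ} {d₀ : Fin m → ℕ}
    (h : DiagramCorrespondsTo X lam C₀ d₀) {M C : Matrix (Fin n) (Fin n) ℤ} {c : ℤ}
    {e f : Fin n → TrialityModel A AlgO} {d : Fin n → ℕ} (hg : IsChevalley M e f) (hc : 0 < c)
    (hC : ∀ i j, 0 ≤ C i j) (hMC : M * C = c • (1 : Matrix (Fin n) (Fin n) ℤ))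
    (hθ : ∀ (θ : torus) i, ∃ k : ℂ, ⁅torusInclusion A θ, e i⁆ = k • e i ∧
      ⁅torusInclusion A θ, f i⁆ = -(k • f i))
    (hd : ∀ θ : torus, (∀ η, torusForm θ η = lam η) →
      ∀ i, ⁅torusInclusion A θ, e i⁆ = (d i : ℂ) • e i) :
    DiagramCorrespondsTo (inclusion A AlgO X) lam M d := by
  rw [diagramCorrespondsTo_iff] at h ⊢
  have h1 := h.map (inclusion A AlgO) (d := d) hg hc hC hMC
  simp only [inclusion_torusInclusion] at h1
  exact h1 hθ hd

end Diagram

end TrialitySeries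

namespace TrialitySeries
open HurwitzAlgebra TrialityModel

namespace TrialityModel

/-! ### The five summands of the triality model and their brackets. -/

section Inclusions

variable {A B : Type} [AddCommGroup A] [Module ℂ A] [HurwitzAlgebra A]
  [AddCommGroup B] [Module ℂ B] [HurwitzAlgebra B]

lemma ext' {x y : TrialityModel A B} (h0 : x.tri = y.tri) (h1 : x.one = y.one)
    (h2 : x.two = y.two) (h3 : x.three = y.three) : x = y :=
  TrialityModel.ext h0 h1 h2 h3

/-- The inclusion of `t(A)`. -/
def inl : trialityAlgebra A →ₗ[ℂ] TrialityModel A B where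
  toFun θ := ⟨(θ, 0), 0, 0, 0⟩
  map_add' θ η := by
    apply TrialityModel.ext <;> simp only [add_zero', add_one', add_two', add_three', add_zero,
      Prod.mk_add_mk]
  map_smul' c θ := by
    apply TrialityModel.ext <;> simp only [smul_zero', smul_one', smul_two', smul_three', smul_zero,
      Prod.smul_mk, RingHom.id_apply]

/-- The inclusion of `t(B)`. -/
def inr : trialityAlgebra B →ₗ[ℂ] TrialityModel A B where
  toFun θ := ⟨(0, θ), 0, 0, 0⟩
  map_add' θ η := by
    apply TrialityModel.ext <;> simp only [add_zero', add_one', add_two', add_three', add_zero,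
      Prod.mk_add_mk]
  map_smul' c θ := by
    apply TrialityModel.ext <;> simp only [smul_zero', smul_one', smul_two', smul_three', smul_zero,
      Prod.smul_mk, RingHom.id_apply]

/-- The inclusion of `A₁ ⊗ B₁`, as a bilinear map. -/
def in₁ : A →ₗ[ℂ] B →ₗ[ℂ] TrialityModel A B :=
  LinearMap.mk₂ ℂ (fun a b => ⟨0, a ⊗ₜ b, 0, 0⟩)
    (fun a a' b => by
      apply TrialityModel.ext <;> simp only [add_zero', add_one', add_two', add_three', add_zero,
        TensorProduct.add_tmul])
    (fun c a b => by
      apply TrialityModel.ext <;> simp only [smul_zero', smul_one', smul_two', smul_three',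
        smul_zero, TensorProduct.smul_tmul'])
    (fun a b b' => by
      apply TrialityModel.ext <;> simp only [add_zero', add_one', add_two', add_three', add_zero,
        TensorProduct.tmul_add])
    (fun c a b => by
      apply TrialityModel.ext <;> simp only [smul_zero', smul_one', smul_two', smul_three',
        smul_zero, TensorProduct.tmul_smul])

/-- The inclusion of `A₂ ⊗ B₂`, as a bilinear map. -/
def in₂ : A →ₗ[ℂ] B →ₗ[ℂ] TrialityModel A B :=
  LinearMap.mk₂ ℂ (fun a b => ⟨0, 0, a ⊗ₜ b, 0⟩)
    (fun a a' b => by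
      apply TrialityModel.ext <;> simp only [add_zero', add_one', add_two', add_three', add_zero,
        TensorProduct.add_tmul])
    (fun c a b => by
      apply TrialityModel.ext <;> simp only [smul_zero', smul_one', smul_two', smul_three',
        smul_zero, TensorProduct.smul_tmul'])
    (fun a b b' => by
      apply TrialityModel.ext <;> simp only [add_zero', add_one', add_two', add_three', add_zero,
        TensorProduct.tmul_add])
    (fun c a b => by
      apply TrialityModel.ext <;> simp only [smul_zero', smul_one', smul_two', smul_three',
        smul_zero, TensorProduct.tmul_smul])

/-- The inclusion of `A₃ ⊗ B₃`, as a bilinear map. -/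
def in₃ : A →ₗ[ℂ] B →ₗ[ℂ] TrialityModel A B :=
  LinearMap.mk₂ ℂ (fun a b => ⟨0, 0, 0, a ⊗ₜ b⟩)
    (fun a a' b => by
      apply TrialityModel.ext <;> simp only [add_zero', add_one', add_two', add_three', add_zero,
        TensorProduct.add_tmul])
    (fun c a b => by
      apply TrialityModel.ext <;> simp only [smul_zero', smul_one', smul_two', smul_three',
        smul_zero, TensorProduct.smul_tmul'])
    (fun a b b' => by
      apply TrialityModel.ext <;> simp only [add_zero', add_one', add_two', add_three', add_zero,
        TensorProduct.tmul_add])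
    (fun c a b => by
      apply TrialityModel.ext <;> simp only [smul_zero', smul_one', smul_two', smul_three',
        smul_zero, TensorProduct.tmul_smul])

variable (θ η : trialityAlgebra A) (φ ψ : trialityAlgebra B) (a a' : A) (b b' : B)

lemma inl_apply : (inl θ : TrialityModel A B) = ⟨(θ, 0), 0, 0, 0⟩ := rfl
lemma inr_apply : (inr φ : TrialityModel A B) = ⟨(0, φ), 0, 0, 0⟩ := rfl
lemma in₁_apply : in₁ a b = ⟨0, a ⊗ₜ b, 0, 0⟩ := rfl
lemma in₂_apply : in₂ a b = ⟨0, 0, a ⊗ₜ b, 0⟩ := rfl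
lemma in₃_apply : in₃ a b = ⟨0, 0, 0, a ⊗ₜ b⟩ := rfl

lemma lie_inl_inl : ⁅(inl θ : TrialityModel A B), (inl η : TrialityModel A B)⁆ = inl ⁅θ, η⁆ := by
  apply ext' <;> simp only [bracket_zero, bracket_one, bracket_two, bracket_three, inl_apply,
    LinearMap.map_zero, LinearMap.zero_apply, add_zero, sub_zero]
  exact Prod.ext rfl (zero_lie _)

lemma lie_inr_inr : ⁅(inr φ : TrialityModel A B), (inr ψ : TrialityModel A B)⁆ = inr ⁅φ, ψ⁆ := by
  apply ext' <;> simp only [bracket_zero, bracket_one, bracket_two, bracket_three, inr_apply,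
    LinearMap.map_zero, LinearMap.zero_apply, add_zero, sub_zero]
  exact Prod.ext (zero_lie _) rfl

lemma lie_inl_inr : ⁅(inl θ : TrialityModel A B), (inr φ : TrialityModel A B)⁆ = 0 := by
  apply ext' <;> simp only [bracket_zero, bracket_one, bracket_two, bracket_three, inl_apply,
    inr_apply, LinearMap.map_zero, LinearMap.zero_apply, add_zero, sub_zero]
  · exact Prod.ext (lie_zero _) (zero_lie _)
  all_goals rfl

lemma lie_inr_inl : ⁅(inr φ : TrialityModel A B), (inl θ : TrialityModel A B)⁆ = 0 := by
  rw [← lie_skew, lie_inl_inr, neg_zero]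

lemma lie_inl_in₁ : ⁅(inl θ : TrialityModel A B), in₁ a b⁆ = in₁ (comp₁ θ a) b := by
  apply ext' <;> simp only [bracket_zero, bracket_one, bracket_two, bracket_three, inl_apply,
    in₁_apply, LinearMap.map_zero, LinearMap.zero_apply, add_zero, sub_zero, lie_zero, act₁_tmul,
    TensorProduct.tmul_zero]

lemma lie_inl_in₃ : ⁅(inl θ : TrialityModel A B), in₃ a b⁆ = in₃ (comp₃ θ a) b := by
  apply ext' <;> simp only [bracket_zero, bracket_one, bracket_two, bracket_three, inl_apply,
    in₃_apply, LinearMap.map_zero, LinearMap.zero_apply, add_zero, sub_zero, lie_zero, act₃_tmul,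
    TensorProduct.tmul_zero]

lemma lie_inr_in₁ : ⁅(inr φ : TrialityModel A B), in₁ a b⁆ = in₁ a (comp₁ φ b) := by
  apply ext' <;> simp only [bracket_zero, bracket_one, bracket_two, bracket_three, inr_apply,
    in₁_apply, LinearMap.map_zero, LinearMap.zero_apply, zero_add, add_zero, sub_zero, lie_zero,
    act₁_tmul, TensorProduct.zero_tmul]

lemma lie_inr_in₃ : ⁅(inr φ : TrialityModel A B), in₃ a b⁆ = in₃ a (comp₃ φ b) := by
  apply ext' <;> simp only [bracket_zero, bracket_one, bracket_two, bracket_three, inr_apply,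
    in₃_apply, LinearMap.map_zero, LinearMap.zero_apply, zero_add, add_zero, sub_zero, lie_zero,
    act₃_tmul, TensorProduct.zero_tmul]

lemma lie_in₁_inl : ⁅in₁ a b, (inl θ : TrialityModel A B)⁆ = -in₁ (comp₁ θ a) b := by
  rw [← lie_skew, lie_inl_in₁]

lemma lie_in₃_inl : ⁅in₃ a b, (inl θ : TrialityModel A B)⁆ = -in₃ (comp₃ θ a) b := by
  rw [← lie_skew, lie_inl_in₃]

lemma lie_in₁_inr : ⁅in₁ a b, (inr φ : TrialityModel A B)⁆ = -in₁ a (comp₁ φ b) := by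
  rw [← lie_skew, lie_inr_in₁]

lemma lie_in₃_inr : ⁅in₃ a b, (inr φ : TrialityModel A B)⁆ = -in₃ a (comp₃ φ b) := by
  rw [← lie_skew, lie_inr_in₃]

lemma mk_eq_inl_add_inr : (⟨(θ, φ), 0, 0, 0⟩ : TrialityModel A B) = inl θ + inr φ := by
  apply ext' <;> simp only [add_zero', add_one', add_two', add_three', inl_apply, inr_apply,
    Prod.mk_add_mk, add_zero, zero_add]

lemma lie_in₁_in₁ : ⁅in₁ a b, in₁ a' b'⁆ =
    form b b' • inl (psi₁ a a') + form a a' • inr (psi₁ b b') := by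
  rw [← LinearMap.map_smul (inl : _ →ₗ[ℂ] TrialityModel A B),
    ← LinearMap.map_smul (inr : _ →ₗ[ℂ] TrialityModel A B), ← mk_eq_inl_add_inr]
  apply ext' <;> simp only [bracket_zero, bracket_one, bracket_two, bracket_three,
    in₁_apply, LinearMap.map_zero, LinearMap.zero_apply, zero_add, add_zero, sub_zero, lie_zero,
    pair₁_tmul]

lemma lie_in₂_in₂ : ⁅in₂ a b, in₂ a' b'⁆ =
    form b b' • inl (psi₂ a a') + form a a' • inr (psi₂ b b') := by
  rw [← LinearMap.map_smul (inl : _ →ₗ[ℂ] TrialityModel A B),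
    ← LinearMap.map_smul (inr : _ →ₗ[ℂ] TrialityModel A B), ← mk_eq_inl_add_inr]
  apply ext' <;> simp only [bracket_zero, bracket_one, bracket_two, bracket_three,
    in₂_apply, LinearMap.map_zero, LinearMap.zero_apply, zero_add, add_zero, sub_zero, lie_zero,
    pair₂_tmul]

lemma lie_in₃_in₃ : ⁅in₃ a b, in₃ a' b'⁆ =
    form b b' • inl (psi₃ a a') + form a a' • inr (psi₃ b b') := by
  rw [← LinearMap.map_smul (inl : _ →ₗ[ℂ] TrialityModel A B),
    ← LinearMap.map_smul (inr : _ →ₗ[ℂ] TrialityModel A B), ← mk_eq_inl_add_inr]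
  apply ext' <;> simp only [bracket_zero, bracket_one, bracket_two, bracket_three,
    in₃_apply, LinearMap.map_zero, LinearMap.zero_apply, zero_add, add_zero, sub_zero, lie_zero,
    pair₃_tmul]

lemma lie_in₁_in₂ : ⁅in₁ a b, in₂ a' b'⁆ = in₃ (mul a a') (mul b b') := by
  apply ext' <;> simp only [bracket_zero, bracket_one, bracket_two, bracket_three,
    in₁_apply, in₂_apply, in₃_apply, LinearMap.map_zero, LinearMap.zero_apply, zero_add, add_zero,
    sub_zero, lie_zero, prod₁₂_tmul]

lemma lie_in₂_in₃ : ⁅in₂ a b, in₃ a' b'⁆ = in₁ (mul a' (conj a)) (mul b' (conj b)) := by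
  apply ext' <;> simp only [bracket_zero, bracket_one, bracket_two, bracket_three,
    in₁_apply, in₂_apply, in₃_apply, LinearMap.map_zero, LinearMap.zero_apply, zero_add, add_zero,
    sub_zero, lie_zero, prod₂₃_tmul]

lemma lie_in₃_in₁ : ⁅in₃ a b, in₁ a' b'⁆ = in₂ (mul (conj a') a) (mul (conj b') b) := by
  apply ext' <;> simp only [bracket_zero, bracket_one, bracket_two, bracket_three,
    in₁_apply, in₂_apply, in₃_apply, LinearMap.map_zero, LinearMap.zero_apply, zero_add, add_zero,
    sub_zero, lie_zero, prod₃₁_tmul]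

lemma lie_in₁_in₃ : ⁅in₁ a b, in₃ a' b'⁆ = -in₂ (mul (conj a) a') (mul (conj b) b') := by
  rw [← lie_skew, lie_in₃_in₁]

/-- A subspace containing all summands of the triality model is everything. -/
lemma mem_of_forall_mem {S : Submodule ℂ (TrialityModel A B)} (hA : ∀ θ, inl θ ∈ S)
    (hB : ∀ φ, inr φ ∈ S) (h₁ : ∀ a b, in₁ a b ∈ S) (h₂ : ∀ a b, in₂ a b ∈ S)
    (h₃ : ∀ a b, in₃ a b ∈ S) (x : TrialityModel A B) : x ∈ S := by
  have e1 : ∀ t : A ⊗[ℂ] B, (⟨0, t, 0, 0⟩ : TrialityModel A B) ∈ S := by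
    refine ind₁ S.zero_mem (fun t t' ht ht' => ?_) h₁
    convert S.add_mem ht ht' using 1
    apply ext' <;> simp only [add_zero', add_one', add_two', add_three', add_zero]
  have e2 : ∀ t : A ⊗[ℂ] B, (⟨0, 0, t, 0⟩ : TrialityModel A B) ∈ S := by
    refine ind₁ S.zero_mem (fun t t' ht ht' => ?_) h₂
    convert S.add_mem ht ht' using 1
    apply ext' <;> simp only [add_zero', add_one', add_two', add_three', add_zero]
  have e3 : ∀ t : A ⊗[ℂ] B, (⟨0, 0, 0, t⟩ : TrialityModel A B) ∈ S := by
    refine ind₁ S.zero_mem (fun t t' ht ht' => ?_) h₃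
    convert S.add_mem ht ht' using 1
    apply ext' <;> simp only [add_zero', add_one', add_two', add_three', add_zero]
  obtain ⟨⟨θ, φ⟩, t1, t2, t3⟩ := x
  have h := S.add_mem (S.add_mem (S.add_mem (S.add_mem (hA θ) (hB φ)) (e1 t1)) (e2 t2)) (e3 t3)
  rw [← mk_eq_inl_add_inr] at h
  convert h using 1
  apply ext' <;> simp only [add_zero', add_one', add_two', add_three', add_zero, zero_add]

end Inclusions

end TrialityModel

end TrialitySeries

namespace TrialitySeries
open HurwitzAlgebra TrialityModel

/-! ### Isotropic bases of the composition algebras and their multiplication tables. -/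

section Frames

variable {V : Type} [AddCommGroup V] [Module ℂ V] [HurwitzAlgebra V]

/-- Two orthogonal idempotents with sum `1`, exchanged by the conjugation. -/
structure IsPairFrame (E : Fin 2 → V) : Prop where
  one_eq : (one : V) = E 0 + E 1
  conj_table : conj (E 0) = E 1 ∧ conj (E 1) = E 0
  form_table : form (E 0) (E 0) = 0 ∧ form (E 0) (E 1) = 1 / 2 ∧
    form (E 1) (E 0) = 1 / 2 ∧ form (E 1) (E 1) = 0
  mul_table : mul (E 0) (E 0) = E 0 ∧ mul (E 0) (E 1) = 0 ∧
    mul (E 1) (E 0) = 0 ∧ mul (E 1) (E 1) = E 1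
  expand : ∀ x, ∃ c : Fin 2 → ℂ, x = ∑ i, c i • E i

/-- A basis of isotropic vectors of the split quaternions, extending `IsPairFrame`. -/
structure IsQuaternionFrame (E : Fin 4 → V) : Prop where
  one_eq : (one : V) = E 0 + E 1
  conj_table : conj (E 0) = E 1 ∧ conj (E 1) = E 0 ∧ conj (E 2) = -E 2 ∧ conj (E 3) = -E 3
  form_table : form (E 0) (E 0) = 0 ∧ form (E 0) (E 1) = 1 / 2 ∧ form (E 0) (E 2) = 0 ∧ form (E 0) (E 3) = 0 ∧
    form (E 1) (E 0) = 1 / 2 ∧ form (E 1) (E 1) = 0 ∧ form (E 1) (E 2) = 0 ∧ form (E 1) (E 3) = 0 ∧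
    form (E 2) (E 0) = 0 ∧ form (E 2) (E 1) = 0 ∧ form (E 2) (E 2) = 0 ∧ form (E 2) (E 3) = 1 / 2 ∧
    form (E 3) (E 0) = 0 ∧ form (E 3) (E 1) = 0 ∧ form (E 3) (E 2) = 1 / 2 ∧ form (E 3) (E 3) = 0
  mul_table : mul (E 0) (E 0) = E 0 ∧ mul (E 0) (E 1) = 0 ∧ mul (E 0) (E 2) = E 2 ∧ mul (E 0) (E 3) = 0 ∧
    mul (E 1) (E 0) = 0 ∧ mul (E 1) (E 1) = E 1 ∧ mul (E 1) (E 2) = 0 ∧ mul (E 1) (E 3) = E 3 ∧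
    mul (E 2) (E 0) = 0 ∧ mul (E 2) (E 1) = E 2 ∧ mul (E 2) (E 2) = 0 ∧ mul (E 2) (E 3) = -E 0 ∧
    mul (E 3) (E 0) = E 3 ∧ mul (E 3) (E 1) = 0 ∧ mul (E 3) (E 2) = -E 1 ∧ mul (E 3) (E 3) = 0
  expand : ∀ x, ∃ c : Fin 4 → ℂ, x = ∑ i, c i • E i

/-- A basis of isotropic vectors of the split octonions, extending `IsQuaternionFrame`. -/
structure IsOctonionFrame (E : Fin 8 → V) : Prop where
  one_eq : (one : V) = E 0 + E 1
  conj_table : conj (E 0) = E 1 ∧ conj (E 1) = E 0 ∧ conj (E 2) = -E 2 ∧ conj (E 3) = -E 3 ∧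
    conj (E 4) = -E 4 ∧ conj (E 5) = -E 5 ∧ conj (E 6) = -E 6 ∧ conj (E 7) = -E 7
  form_table : form (E 0) (E 0) = 0 ∧ form (E 0) (E 1) = 1 / 2 ∧ form (E 0) (E 2) = 0 ∧ form (E 0) (E 3) = 0 ∧
    form (E 0) (E 4) = 0 ∧ form (E 0) (E 5) = 0 ∧ form (E 0) (E 6) = 0 ∧ form (E 0) (E 7) = 0 ∧
    form (E 1) (E 0) = 1 / 2 ∧ form (E 1) (E 1) = 0 ∧ form (E 1) (E 2) = 0 ∧ form (E 1) (E 3) = 0 ∧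
    form (E 1) (E 4) = 0 ∧ form (E 1) (E 5) = 0 ∧ form (E 1) (E 6) = 0 ∧ form (E 1) (E 7) = 0 ∧
    form (E 2) (E 0) = 0 ∧ form (E 2) (E 1) = 0 ∧ form (E 2) (E 2) = 0 ∧ form (E 2) (E 3) = 1 / 2 ∧
    form (E 2) (E 4) = 0 ∧ form (E 2) (E 5) = 0 ∧ form (E 2) (E 6) = 0 ∧ form (E 2) (E 7) = 0 ∧
    form (E 3) (E 0) = 0 ∧ form (E 3) (E 1) = 0 ∧ form (E 3) (E 2) = 1 / 2 ∧ form (E 3) (E 3) = 0 ∧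
    form (E 3) (E 4) = 0 ∧ form (E 3) (E 5) = 0 ∧ form (E 3) (E 6) = 0 ∧ form (E 3) (E 7) = 0 ∧
    form (E 4) (E 0) = 0 ∧ form (E 4) (E 1) = 0 ∧ form (E 4) (E 2) = 0 ∧ form (E 4) (E 3) = 0 ∧
    form (E 4) (E 4) = 0 ∧ form (E 4) (E 5) = 1 / 2 ∧ form (E 4) (E 6) = 0 ∧ form (E 4) (E 7) = 0 ∧
    form (E 5) (E 0) = 0 ∧ form (E 5) (E 1) = 0 ∧ form (E 5) (E 2) = 0 ∧ form (E 5) (E 3) = 0 ∧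
    form (E 5) (E 4) = 1 / 2 ∧ form (E 5) (E 5) = 0 ∧ form (E 5) (E 6) = 0 ∧ form (E 5) (E 7) = 0 ∧
    form (E 6) (E 0) = 0 ∧ form (E 6) (E 1) = 0 ∧ form (E 6) (E 2) = 0 ∧ form (E 6) (E 3) = 0 ∧
    form (E 6) (E 4) = 0 ∧ form (E 6) (E 5) = 0 ∧ form (E 6) (E 6) = 0 ∧ form (E 6) (E 7) = 1 / 2 ∧
    form (E 7) (E 0) = 0 ∧ form (E 7) (E 1) = 0 ∧ form (E 7) (E 2) = 0 ∧ form (E 7) (E 3) = 0 ∧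
    form (E 7) (E 4) = 0 ∧ form (E 7) (E 5) = 0 ∧ form (E 7) (E 6) = 1 / 2 ∧ form (E 7) (E 7) = 0
  mul_table : mul (E 0) (E 0) = E 0 ∧ mul (E 0) (E 1) = 0 ∧ mul (E 0) (E 2) = E 2 ∧ mul (E 0) (E 3) = 0 ∧
    mul (E 0) (E 4) = E 4 ∧ mul (E 0) (E 5) = 0 ∧ mul (E 0) (E 6) = E 6 ∧ mul (E 0) (E 7) = 0 ∧
    mul (E 1) (E 0) = 0 ∧ mul (E 1) (E 1) = E 1 ∧ mul (E 1) (E 2) = 0 ∧ mul (E 1) (E 3) = E 3 ∧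
    mul (E 1) (E 4) = 0 ∧ mul (E 1) (E 5) = E 5 ∧ mul (E 1) (E 6) = 0 ∧ mul (E 1) (E 7) = E 7 ∧
    mul (E 2) (E 0) = 0 ∧ mul (E 2) (E 1) = E 2 ∧ mul (E 2) (E 2) = 0 ∧ mul (E 2) (E 3) = -E 0 ∧
    mul (E 2) (E 4) = E 7 ∧ mul (E 2) (E 5) = 0 ∧ mul (E 2) (E 6) = -E 5 ∧ mul (E 2) (E 7) = 0 ∧
    mul (E 3) (E 0) = E 3 ∧ mul (E 3) (E 1) = 0 ∧ mul (E 3) (E 2) = -E 1 ∧ mul (E 3) (E 3) = 0 ∧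
    mul (E 3) (E 4) = 0 ∧ mul (E 3) (E 5) = E 6 ∧ mul (E 3) (E 6) = 0 ∧ mul (E 3) (E 7) = -E 4 ∧
    mul (E 4) (E 0) = 0 ∧ mul (E 4) (E 1) = E 4 ∧ mul (E 4) (E 2) = -E 7 ∧ mul (E 4) (E 3) = 0 ∧
    mul (E 4) (E 4) = 0 ∧ mul (E 4) (E 5) = -E 0 ∧ mul (E 4) (E 6) = E 3 ∧ mul (E 4) (E 7) = 0 ∧
    mul (E 5) (E 0) = E 5 ∧ mul (E 5) (E 1) = 0 ∧ mul (E 5) (E 2) = 0 ∧ mul (E 5) (E 3) = -E 6 ∧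
    mul (E 5) (E 4) = -E 1 ∧ mul (E 5) (E 5) = 0 ∧ mul (E 5) (E 6) = 0 ∧ mul (E 5) (E 7) = E 2 ∧
    mul (E 6) (E 0) = 0 ∧ mul (E 6) (E 1) = E 6 ∧ mul (E 6) (E 2) = E 5 ∧ mul (E 6) (E 3) = 0 ∧
    mul (E 6) (E 4) = -E 3 ∧ mul (E 6) (E 5) = 0 ∧ mul (E 6) (E 6) = 0 ∧ mul (E 6) (E 7) = -E 0 ∧
    mul (E 7) (E 0) = E 7 ∧ mul (E 7) (E 1) = 0 ∧ mul (E 7) (E 2) = 0 ∧ mul (E 7) (E 3) = E 4 ∧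
    mul (E 7) (E 4) = 0 ∧ mul (E 7) (E 5) = -E 2 ∧ mul (E 7) (E 6) = -E 1 ∧ mul (E 7) (E 7) = 0
  expand : ∀ x, ∃ c : Fin 8 → ℂ, x = ∑ i, c i • E i

/-- The frame of the complexification of `ℂ`. -/
def pairFrame : Fin 2 → AlgC :=
  ![(1 / 2, -Complex.I / 2), (1 / 2, Complex.I / 2)]

/-- The frame of a double. -/
def quaternionFrame (E : Fin 2 → V) : Fin 4 → V × V := ![(E 0, 0), (E 1, 0), (0, E 0), (0, E 1)]

/-- The frame of a double. -/
def octonionFrame (E : Fin 4 → V) : Fin 8 → V × V :=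
  ![(E 0, 0), (E 1, 0), (E 2, 0), (E 3, 0), (0, E 0), (0, E 1), (0, E 3), (0, E 2)]

/-- With `j = (0, 1)` and `j² = -1`, the vectors are `(1 ∓ i j)/2`, the two primitive idempotents of
the complexified `ℂ`. The coordinates of `x` in this basis are `x₁ ± i x₂`. -/
lemma isPairFrame_pairFrame : IsPairFrame pairFrame := by
  have hI := Complex.I_mul_I
  have e0 : pairFrame 0 = (1 / 2, -Complex.I / 2) := rfl
  have e1 : pairFrame 1 = (1 / 2, Complex.I / 2) := rfl
  refine ⟨?_, ?_, ?_, ?_, fun x => ⟨![x.1 + Complex.I * x.2, x.1 - Complex.I * x.2], ?_⟩⟩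
  · rw [double_one, e0, e1]
    ext1
    · change (1 : ℂ) = 1 / 2 + 1 / 2
      norm_num
    · change (0 : ℂ) = -Complex.I / 2 + Complex.I / 2
      ring
  · simp only [e0, e1, double_conj, conjR]
    constructor <;> ext1 <;> simp only [] <;> ring
  · simp only [e0, e1, double_form, formR]
    refine ⟨?_, ?_, ?_, ?_⟩ <;>
      first
      | linear_combination hI / 4
      | linear_combination -hI / 4
  · simp only [e0, e1, double_mul, mulR, conjR]
    refine ⟨?_, ?_, ?_, ?_⟩ <;> ext1 <;> simp only [Prod.fst_zero, Prod.snd_zero] <;>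
      first
      | ring1
      | linear_combination hI / 4
      | linear_combination -hI / 4
  · rw [Fin.sum_univ_two, e0, e1]
    ext1
    · change x.1 = (x.1 + Complex.I * x.2) * (1 / 2) + (x.1 - Complex.I * x.2) * (1 / 2)
      ring
    · change x.2 = (x.1 + Complex.I * x.2) * (-Complex.I / 2) +
        (x.1 - Complex.I * x.2) * (Complex.I / 2)
      linear_combination x.2 * hI

lemma IsPairFrame.quaternionFrame [IsAssoc V] {E : Fin 2 → V} (h : IsPairFrame E) :
    IsQuaternionFrame (quaternionFrame E) := by
  have e0 : TrialitySeries.quaternionFrame E 0 = (E 0, 0) := rfl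
  have e1 : TrialitySeries.quaternionFrame E 1 = (E 1, 0) := rfl
  have e2 : TrialitySeries.quaternionFrame E 2 = (0, E 0) := rfl
  have e3 : TrialitySeries.quaternionFrame E 3 = (0, E 1) := rfl
  refine ⟨?_, ?_, ?_, ?_, ?_⟩
  · rw [double_one, e0, e1, h.one_eq, Prod.mk_add_mk, add_zero]
  · simp only [e0, e1, e2, e3, double_conj, h.conj_table, LinearMap.map_zero, neg_zero,
      Prod.neg_mk, and_self]
  · simp only [e0, e1, e2, e3, double_form, h.form_table, LinearMap.map_zero, add_zero, zero_add,
      LinearMap.zero_apply, and_self]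
  · simp only [e0, e1, e2, e3, double_mul, h.conj_table, h.mul_table, LinearMap.map_zero, add_zero,
      zero_add, sub_zero, zero_sub, LinearMap.zero_apply, neg_zero, Prod.neg_mk, and_self,
      Prod.mk_zero_zero]
  · intro x
    obtain ⟨c, hc⟩ := h.expand x.1
    obtain ⟨d, hd⟩ := h.expand x.2
    refine ⟨![c 0, c 1, d 0, d 1], Prod.ext ?_ ?_⟩
    · simp [Fin.sum_univ_four, Fin.sum_univ_two, e0, e1, e2, e3, hc]
    · simp [Fin.sum_univ_four, Fin.sum_univ_two, e0, e1, e2, e3, hd]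

/-- The last two vectors of the double are taken in exchanged order, which amounts to the sign of
`ε₄`. With this order `E 0` has the weight `(ε₁ + ε₂ + ε₃ + ε₄)/2 = ω₄` in the third representation.
-/
lemma IsQuaternionFrame.octonionFrame [IsAssoc V] {E : Fin 4 → V} (h : IsQuaternionFrame E) :
    IsOctonionFrame (octonionFrame E) := by
  have e0 : TrialitySeries.octonionFrame E 0 = (E 0, 0) := rfl
  have e1 : TrialitySeries.octonionFrame E 1 = (E 1, 0) := rfl
  have e2 : TrialitySeries.octonionFrame E 2 = (E 2, 0) := rfl
  have e3 : TrialitySeries.octonionFrame E 3 = (E 3, 0) := rfl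
  have e4 : TrialitySeries.octonionFrame E 4 = (0, E 0) := rfl
  have e5 : TrialitySeries.octonionFrame E 5 = (0, E 1) := rfl
  have e6 : TrialitySeries.octonionFrame E 6 = (0, E 3) := rfl
  have e7 : TrialitySeries.octonionFrame E 7 = (0, E 2) := rfl
  refine ⟨?_, ?_, ?_, ?_, ?_⟩
  · rw [double_one, e0, e1, h.one_eq, Prod.mk_add_mk, add_zero]
  · simp only [e0, e1, e2, e3, e4, e5, e6, e7, double_conj, h.conj_table, LinearMap.map_zero,
      neg_zero, Prod.neg_mk, and_self]
  · simp only [e0, e1, e2, e3, e4, e5, e6, e7, double_form, h.form_table, LinearMap.map_zero,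
      add_zero, zero_add, LinearMap.zero_apply, and_self]
  · simp only [e0, e1, e2, e3, e4, e5, e6, e7, double_mul, h.conj_table, h.mul_table,
      LinearMap.map_zero, LinearMap.map_neg, LinearMap.neg_apply, add_zero, zero_add, sub_zero,
      zero_sub, LinearMap.zero_apply, neg_zero, neg_neg, Prod.neg_mk, and_self, Prod.mk_zero_zero]
  · intro x
    obtain ⟨c, hc⟩ := h.expand x.1
    obtain ⟨d, hd⟩ := h.expand x.2
    refine ⟨![c 0, c 1, c 2, c 3, d 0, d 1, d 3, d 2], Prod.ext ?_ ?_⟩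
    · simp [Fin.sum_univ_four, Fin.sum_univ_eight, e0, e1, e2, e3, e4, e5, e6, e7, hc]
    · simp [Fin.sum_univ_four, Fin.sum_univ_eight, e0, e1, e2, e3, e4, e5, e6, e7, hd]
      abel

end Frames

end TrialitySeries

namespace TrialitySeries
open HurwitzAlgebra

/-! ### The Cartan subalgebra of `t(𝕆)` and the weights of its three representations. -/

section Octonions

variable {V : Type} [AddCommGroup V] [Module ℂ V] [HurwitzAlgebra V] {E : Fin 8 → V}

/-- The elements of a Cartan subalgebra of `t(V)` dual to the weights `εⱼ`. -/
def octonionTorus (E : Fin 8 → V) : Fin 4 → trialityAlgebra V :=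
  ![(1 / 2 : ℂ) • psi₁ (E 1) (E 0), (1 / 2 : ℂ) • psi₁ (E 3) (E 2),
    (1 / 2 : ℂ) • psi₁ (E 5) (E 4), (1 / 2 : ℂ) • psi₁ (E 7) (E 6)]

/-- Twice the weights of `𝕆₁`. -/
def octonionWeight₁ : Fin 8 → Fin 4 → ℤ :=
  ![![2, 0, 0, 0], ![-2, 0, 0, 0], ![0, 2, 0, 0], ![0, -2, 0, 0],
    ![0, 0, 2, 0], ![0, 0, -2, 0], ![0, 0, 0, 2], ![0, 0, 0, -2]]

/-- Twice the weights of `𝕆₃`. -/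
def octonionWeight₃ : Fin 8 → Fin 4 → ℤ :=
  ![![1, 1, 1, 1], ![-1, -1, -1, -1], ![1, 1, -1, -1], ![-1, -1, 1, 1],
    ![1, -1, 1, -1], ![-1, 1, -1, 1], ![1, -1, -1, 1], ![-1, 1, 1, -1]]

namespace IsOctonionFrame

/-- Half of `psi₁` on a hyperbolic pair rotates that plane with eigenvalues `±1` and kills the other
planes. The tables contain doubled weights because those of `𝕆₃` are half-integral. -/
lemma comp₁_octonionTorus (h : IsOctonionFrame E) (a : Fin 8) (k : Fin 4) :
    comp₁ (octonionTorus E k) (E a) = ((octonionWeight₁ a k : ℤ) / 2 : ℂ) • E a := by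
  fin_cases k <;> fin_cases a <;>
    simp [octonionTorus, octonionWeight₁, comp₁_psi₁, rot_apply, h.form_table] <;> module

lemma comp₃_octonionTorus (h : IsOctonionFrame E) (a : Fin 8) (k : Fin 4) :
    comp₃ (octonionTorus E k) (E a) = ((octonionWeight₃ a k : ℤ) / 2 : ℂ) • E a := by
  fin_cases k <;> fin_cases a <;>
    simp [octonionTorus, octonionWeight₃, comp₃_psi₁, opA_apply, h.conj_table, h.mul_table] <;>
    module

/-- The associators of `c` with the pairs `(E 2, E 4)` and `(E 3, E 5)` already kill the coordinates
`2, …, 7` and force `k 0 = k 1`. The vanishing trace then kills these two. -/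
lemma eq_zero_of_nucleus (h : IsOctonionFrame E) {c : V} (h1 : form one c = 0)
    (hc : ∀ x y, mul (mul x y) c = mul x (mul y c)) : c = 0 := by
  obtain ⟨k, rfl⟩ := h.expand c
  have e1 := hc (E 2) (E 4)
  have e2 := hc (E 3) (E 5)
  simp only [h.one_eq, Fin.sum_univ_eight, LinearMap.map_add, LinearMap.map_smul, h.mul_table,
    h.form_table, smul_zero, add_zero, zero_add, LinearMap.add_apply, smul_eq_mul, mul_zero,
    LinearMap.map_neg, smul_neg] at e1 e2 h1
  have t1 := fun i => congrArg (form (E i)) e1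
  have t2 := fun i => congrArg (form (E i)) e2
  simp only [LinearMap.map_add, LinearMap.map_smul, LinearMap.map_neg, smul_eq_mul] at t1 t2
  have a0 := t1 0
  have a1 := t1 1
  have a2 := t1 2
  have a3 := t1 3
  have a4 := t1 4
  have a5 := t1 5
  have a6 := t1 6
  have a7 := t1 7
  have b0 := t2 0
  have b1 := t2 1
  have b2 := t2 2
  have b3 := t2 3
  have b4 := t2 4
  have b5 := t2 5
  have b6 := t2 6
  have b7 := t2 7
  clear t1 t2 e1 e2 hc
  simp only [h.form_table] at a0 a1 a2 a3 a4 a5 a6 a7 b0 b1 b2 b3 b4 b5 b6 b7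
  have k0 : k 0 = 0 := by grind
  have k1 : k 1 = 0 := by grind
  have k2 : k 2 = 0 := by grind
  have k3 : k 3 = 0 := by grind
  have k4 : k 4 = 0 := by grind
  have k5 : k 5 = 0 := by grind
  have k6 : k 6 = 0 := by grind
  have k7 : k 7 = 0 := by grind
  simp [Fin.sum_univ_eight, k0, k1, k2, k3, k4, k5, k6, k7]

end IsOctonionFrame

/-- A triality with `θ₁ = 0` is `(0, R, R)`, with the right multiplication by an imaginary element
of the right nucleus. -/
lemma comp₂_comp₃_of_comp₁_eq_zero {θ : trialityAlgebra V} (hθ : comp₁ θ = 0) :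
    form one (comp₂ θ one) = 0 ∧ (∀ x, comp₂ θ x = mul x (comp₂ θ one)) ∧
      (∀ x, comp₃ θ x = mul x (comp₂ θ one)) := by
  have h3 : ∀ x, comp₃ θ x = mul x (comp₂ θ one) := fun x => by
    have := comp₃_mul θ x one
    rwa [hθ, LinearMap.zero_apply, LinearMap.map_zero, LinearMap.zero_apply, zero_add,
      HurwitzAlgebra.mul_one] at this
  have h2 : ∀ x, comp₂ θ x = comp₃ θ x := fun x => by
    have := comp₃_mul θ one x
    rwa [hθ, LinearMap.zero_apply, LinearMap.map_zero, LinearMap.zero_apply, zero_add,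
      HurwitzAlgebra.one_mul, HurwitzAlgebra.one_mul, eq_comm] at this
  refine ⟨?_, fun x => (h2 x).trans (h3 x), h3⟩
  have h := skew₂ θ one one
  rw [form_symm] at h
  linear_combination h / 2

/-- With `θ₁ = 0` the triality relation reads `θ₃(xy) = x θ₂(y)`. As `θ₂` and `θ₃` are both right
multiplication by `θ₂(1)`, this is associativity with that last factor. -/
lemma mul_assoc_of_comp₁_eq_zero {θ : trialityAlgebra V} (hθ : comp₁ θ = 0) (x y : V) :
    mul (mul x y) (comp₂ θ one) = mul x (mul y (comp₂ θ one)) := by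
  obtain ⟨-, h2, h3⟩ := comp₂_comp₃_of_comp₁_eq_zero hθ
  rw [← h3, ← h2, comp₃_mul, hθ, LinearMap.zero_apply, LinearMap.map_zero, LinearMap.zero_apply,
    zero_add]

lemma eq_zero_of_comp₁_eq_zero_of_comp₂_one_eq_zero {θ : trialityAlgebra V} (hθ : comp₁ θ = 0)
    (h1 : comp₂ θ one = 0) : θ = 0 := by
  obtain ⟨-, h2, h3⟩ := comp₂_comp₃_of_comp₁_eq_zero hθ
  refine triality_ext (fun z => ?_) (fun z => ?_) (fun z => ?_)
  · rw [hθ, LinearMap.map_zero]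
  · rw [h2, h1, LinearMap.map_zero, LinearMap.map_zero, LinearMap.zero_apply]
  · rw [h3, h1, LinearMap.map_zero, LinearMap.map_zero, LinearMap.zero_apply]

namespace IsOctonionFrame

/-- A triality of the octonions is determined by its first component. -/
lemma eq_zero_of_comp₁_eq_zero (h : IsOctonionFrame E) {θ : trialityAlgebra V}
    (hθ : comp₁ θ = 0) : θ = 0 :=
  eq_zero_of_comp₁_eq_zero_of_comp₂_one_eq_zero hθ <|
    h.eq_zero_of_nucleus (comp₂_comp₃_of_comp₁_eq_zero hθ).1 (mul_assoc_of_comp₁_eq_zero hθ)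

lemma ext_comp₁ (h : IsOctonionFrame E) {θ η : trialityAlgebra V}
    (hθ : ∀ a, comp₁ θ (E a) = comp₁ η (E a)) : θ = η := by
  rw [← sub_eq_zero]
  refine h.eq_zero_of_comp₁_eq_zero (LinearMap.ext fun x => ?_)
  obtain ⟨c, rfl⟩ := h.expand x
  rw [map_sum, LinearMap.zero_apply]
  refine Finset.sum_eq_zero fun a _ => ?_
  rw [LinearMap.map_smul, LinearMap.map_sub, LinearMap.sub_apply, hθ, sub_self, smul_zero]

/-- A triality of the octonions is known from its first component, so the identity is checked there,
vector by vector. The coordinates coincide with the weight of `E 6` because the elements of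
`octonionTorus` are orthonormal for the invariant form. -/
lemma half_psi₃_six (h : IsOctonionFrame E) :
    (1 / 2 : ℂ) • psi₃ (E 7) (E 6) =
      ∑ k, ((octonionWeight₃ 6 k : ℤ) / 2 : ℂ) • octonionTorus E k := by
  refine h.ext_comp₁ fun a => ?_
  simp only [Fin.sum_univ_four, LinearMap.map_add, LinearMap.map_smul, LinearMap.add_apply,
    LinearMap.smul_apply, h.comp₁_octonionTorus, comp₁_psi₃, opA_apply]
  fin_cases a <;>
    simp [octonionWeight₁, octonionWeight₃, h.conj_table, h.mul_table] <;> module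

lemma half_psi₃_zero (h : IsOctonionFrame E) :
    (1 / 2 : ℂ) • psi₃ (E 1) (E 0) =
      ∑ k, ((octonionWeight₃ 0 k : ℤ) / 2 : ℂ) • octonionTorus E k := by
  refine h.ext_comp₁ fun a => ?_
  simp only [Fin.sum_univ_four, LinearMap.map_add, LinearMap.map_smul, LinearMap.add_apply,
    LinearMap.smul_apply, h.comp₁_octonionTorus, comp₁_psi₃, opA_apply]
  fin_cases a <;>
    simp [octonionWeight₁, octonionWeight₃, h.conj_table, h.mul_table]

end IsOctonionFrame

end Octonions

end TrialitySeries

namespace TrialitySeries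
open HurwitzAlgebra

/-! ### The standard torus in coordinates adapted to the isotropic frame. -/

section Torus

section

variable {V : Type} [AddCommGroup V] [Module ℂ V] [HurwitzAlgebra V] {E : Fin 8 → V}

/-- The first index of the `j`-th coordinate plane. -/
def evenIndex : Fin 4 → Fin 8 := ![0, 2, 4, 6]

/-- The second index of the `j`-th coordinate plane. -/
def oddIndex : Fin 4 → Fin 8 := ![1, 3, 5, 7]

lemma IsOctonionFrame.form_even (h : IsOctonionFrame E) (j : Fin 4) :
    form (E (evenIndex j)) (E (evenIndex j)) = 0 ∧ form (E (oddIndex j)) (E (oddIndex j)) = 0 ∧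
      form (E (evenIndex j)) (E (oddIndex j)) = 1 / 2 := by
  fin_cases j <;> simp [evenIndex, oddIndex, h.form_table]

/-- Skewness on `(e, e)` and `(f, f)` removes the off-diagonal coefficients, and on `(e, f)` it
makes the two eigenvalues opposite. -/
lemma comp₁_of_isotropic {θ : trialityAlgebra V} {e f : V} (he : form e e = 0) (hf : form f f = 0)
    (hef : form e f = 1 / 2) {α β γ δ : ℂ} (h1 : comp₁ θ e = α • e + β • f)
    (h2 : comp₁ θ f = γ • e + δ • f) :
    comp₁ θ e = (2 * form (comp₁ θ e) f) • e ∧ comp₁ θ f = -((2 * form (comp₁ θ e) f) • f) := by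
  have s1 := skew₁ θ e e
  have s2 := skew₁ θ f f
  have s3 := skew₁ θ e f
  rw [form_symm e (comp₁ θ e)] at s1
  rw [form_symm f (comp₁ θ f)] at s2
  simp only [h1, h2, LinearMap.map_add, LinearMap.map_smul, LinearMap.add_apply,
    LinearMap.smul_apply, smul_eq_mul, he, hf, hef, form_symm f e] at s1 s2 s3 ⊢
  have hβ : β = 0 := by linear_combination s1
  have hγ : γ = 0 := by linear_combination s2
  have hδ : δ = -α := by linear_combination 2 * s3
  subst hβ hγ hδ
  constructor <;> module

/-- Preserving the four hyperbolic planes means acting diagonally on the frame. Both sides then have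
the same first component, which determines a triality. -/
lemma IsOctonionFrame.eq_sum_octonionTorus (h : IsOctonionFrame E) {θ : trialityAlgebra V}
    (he : ∀ j, ∃ α β : ℂ, comp₁ θ (E (evenIndex j)) = α • E (evenIndex j) + β • E (oddIndex j))
    (ho : ∀ j, ∃ α β : ℂ, comp₁ θ (E (oddIndex j)) = α • E (evenIndex j) + β • E (oddIndex j)) :
    θ = ∑ j, (2 * form (comp₁ θ (E (evenIndex j))) (E (oddIndex j))) • octonionTorus E j := by
  have key : ∀ j, comp₁ θ (E (evenIndex j)) =
      (2 * form (comp₁ θ (E (evenIndex j))) (E (oddIndex j))) • E (evenIndex j) ∧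
      comp₁ θ (E (oddIndex j)) =
        -((2 * form (comp₁ θ (E (evenIndex j))) (E (oddIndex j))) • E (oddIndex j)) := by
    intro j
    obtain ⟨h1, h2, h3⟩ := h.form_even j
    obtain ⟨α, β, k1⟩ := he j
    obtain ⟨γ, δ, k2⟩ := ho j
    exact comp₁_of_isotropic h1 h2 h3 k1 k2
  generalize (fun j => 2 * form (comp₁ θ (E (evenIndex j))) (E (oddIndex j))) = c at key
  generalize hc : (fun j => 2 * form (comp₁ θ (E (evenIndex j))) (E (oddIndex j))) = c
  have hc' := fun j => congrFun hc j
  simp only [hc'] at key ⊢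
  refine h.ext_comp₁ fun a => ?_
  simp only [Fin.sum_univ_four, LinearMap.map_add, LinearMap.map_smul, LinearMap.add_apply,
    LinearMap.smul_apply, h.comp₁_octonionTorus]
  have h0 := key 0
  have h1 := key 1
  have h2 := key 2
  have h3 := key 3
  simp only [evenIndex, oddIndex, Matrix.cons_val] at h0 h1 h2 h3
  fin_cases a <;> simp [octonionWeight₁, h0, h1, h2, h3]

end

/-- The standard frame of the octonions. -/
def octonions : Fin 8 → AlgO := octonionFrame (quaternionFrame pairFrame)

lemma isOctonionFrame_octonions : IsOctonionFrame octonions :=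
  isPairFrame_pairFrame.quaternionFrame.octonionFrame

lemma plane_add (j : Fin 4) (z w : AlgC) : plane j (z + w) = plane j z + plane j w := by
  fin_cases j <;> simp [plane]

lemma plane_smul (j : Fin 4) (c : ℂ) (z : AlgC) : plane j (c • z) = c • plane j z := by
  fin_cases j <;> simp [plane]

/-- The sign in the definition of `eps`. -/
def planeSign : Fin 4 → ℂ := ![1, 1, 1, -1]

/-- The sign appears in the last plane only, where the frame lists its two isotropic vectors in the
exchanged order. -/
lemma octonions_evenIndex (j : Fin 4) :
    octonions (evenIndex j) = plane j (1 / 2, -(planeSign j * Complex.I) / 2) := by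
  fin_cases j <;> simp [octonions, octonionFrame, quaternionFrame, pairFrame, evenIndex, plane,
    planeSign] <;> rfl

lemma octonions_oddIndex (j : Fin 4) :
    octonions (oddIndex j) = plane j (1 / 2, (planeSign j * Complex.I) / 2) := by
  fin_cases j <;> simp [octonions, octonionFrame, quaternionFrame, pairFrame, oddIndex, plane,
    planeSign] <;> rfl

lemma planeSign_sq (j : Fin 4) : planeSign j * planeSign j = 1 := by
  fin_cases j <;> simp [planeSign]

lemma plane_eq (j : Fin 4) (z : AlgC) : plane j z =
    (z.1 + planeSign j * Complex.I * z.2) • octonions (evenIndex j) +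
      (z.1 - planeSign j * Complex.I * z.2) • octonions (oddIndex j) := by
  rw [octonions_evenIndex, octonions_oddIndex, ← plane_smul, ← plane_smul, ← plane_add]
  congr 1
  have h1 := planeSign_sq j
  have h2 := Complex.I_mul_I
  generalize planeSign j = s at *
  ext1
  · simp only [Prod.smul_mk, Prod.mk_add_mk, smul_eq_mul]
    ring
  · simp only [Prod.smul_mk, Prod.mk_add_mk, smul_eq_mul]
    linear_combination z.2 * s * s * h2 - z.2 * h1

end Torus

end TrialitySeries

namespace TrialitySeries
open HurwitzAlgebra

/-! ### The weights `εⱼ`, the invariant form and the element of `t` dual to `λ`. -/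

section TorusForm

lemma mem_torus_iff {θ : trialityAlgebra AlgO} :
    θ ∈ torus ↔ ∀ j z, ∃ w, comp₁ θ (plane j z) = plane j w :=
  Iff.rfl


section

variable {V : Type} [AddCommGroup V] [Module ℂ V] [HurwitzAlgebra V]

lemma octonionTorus_apply (E : Fin 8 → V) (k : Fin 4) : octonionTorus E k =
    (1 / 2 : ℂ) • psi₁ (E (oddIndex k)) (E (evenIndex k)) := by
  fin_cases k <;> rfl

/-- Reconciles `eps`, defined with the vectors `e + f` and `s i (e - f)` of a coordinate plane, with
the eigenvalue on the isotropic vector `e`. Skewness leaves only `(θ e, f)`, and `s² = 1`, `i² = -1`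
remove the factors. -/
lemma form_comp₁_plane (θ : trialityAlgebra V) (e f : V) {s : ℂ} (h1 : s * s = 1) :
    s * Complex.I * form (comp₁ θ ((1 + s * Complex.I * 0) • e + (1 - s * Complex.I * 0) • f))
      ((0 + s * Complex.I * 1) • e + (0 - s * Complex.I * 1) • f) = 2 * form (comp₁ θ e) f := by
  have s1 := skew₁ θ e e
  have s2 := skew₁ θ f f
  have s3 := skew₁ θ f e
  rw [form_symm e (comp₁ θ e)] at s1
  rw [form_symm f (comp₁ θ f)] at s2
  rw [form_symm f (comp₁ θ e)] at s3
  have h2 := Complex.I_mul_I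
  simp only [mul_zero, add_zero, sub_zero, zero_add, zero_sub, one_smul, LinearMap.map_add,
    LinearMap.map_smul, LinearMap.add_apply, LinearMap.smul_apply, smul_eq_mul, _root_.mul_one, s3]
  generalize form (comp₁ θ e) e = x at *
  generalize form (comp₁ θ f) f = y at *
  generalize form (comp₁ θ e) f = z at *
  have hx : x = 0 := by linear_combination s1 / 2
  have hy : y = 0 := by linear_combination s2 / 2
  subst hx hy
  linear_combination (-2 * z * s * s) * h2 + 2 * z * h1

/-- A rotation is a difference of two rank one maps, so the trace is a difference of two values of
the form. Skewness makes them add up. -/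
lemma trace_comp₁_comp_rot [Module.Finite ℂ V] (θ : trialityAlgebra V) (e f : V) :
    LinearMap.trace ℂ V (comp₁ θ ∘ₗ comp₁ ((1 / 2 : ℂ) • psi₁ f e)) =
      4 * form (comp₁ θ e) f := by
  have h1 : comp₁ θ ∘ₗ comp₁ ((1 / 2 : ℂ) • psi₁ f e) =
      (2 : ℂ) • ((form f).smulRight (comp₁ θ e) - (form e).smulRight (comp₁ θ f)) := by
    ext1 x
    simp only [LinearMap.comp_apply, LinearMap.smul_apply, LinearMap.map_smul, comp₁_psi₁,
      rot_apply, LinearMap.map_sub, LinearMap.sub_apply, LinearMap.smulRight_apply]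
    module
  rw [h1, LinearMap.map_smul, LinearMap.map_sub, LinearMap.trace_smulRight,
    LinearMap.trace_smulRight, form_symm e (comp₁ θ f), skew₁ θ f e,
    form_symm f (comp₁ θ e), smul_eq_mul]
  ring

end

attribute [local irreducible] torus trialityAlgebra

lemma eps_eq (j : Fin 4) (θ : torus) :
    eps j θ = 2 * form (comp₁ θ.1 (octonions (evenIndex j))) (octonions (oddIndex j)) := by
  change planeSign j * Complex.I * form (comp₁ θ.1 (plane j (1, 0))) (plane j (0, 1)) = _
  rw [plane_eq, plane_eq]
  exact form_comp₁_plane _ _ _ (planeSign_sq j)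

/-- Reduces every statement about `t` to the four elements of `octonionTorus`, whose action on all
generators is tabulated. -/
lemma torus_eq_sum (θ : torus) : θ.1 = ∑ j, eps j θ • octonionTorus octonions j := by
  simp only [eps_eq]
  refine isOctonionFrame_octonions.eq_sum_octonionTorus (fun j => ?_) (fun j => ?_)
  · obtain ⟨w, hw⟩ := mem_torus_iff.1 θ.2 j (1 / 2, -(planeSign j * Complex.I) / 2)
    rw [← octonions_evenIndex, plane_eq] at hw
    exact ⟨_, _, hw⟩
  · obtain ⟨w, hw⟩ := mem_torus_iff.1 θ.2 j (1 / 2, (planeSign j * Complex.I) / 2)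
    rw [← octonions_oddIndex, plane_eq] at hw
    exact ⟨_, _, hw⟩

lemma octonionWeight₁_even (j k : Fin 4) :
    octonionWeight₁ (evenIndex j) k = if j = k then 2 else 0 := by
  revert j k
  decide

lemma octonionTorus_mem (k : Fin 4) : octonionTorus octonions k ∈ torus := by
  refine mem_torus_iff.2 fun j z => ?_
  rw [plane_eq, LinearMap.map_add, LinearMap.map_smul, LinearMap.map_smul,
    isOctonionFrame_octonions.comp₁_octonionTorus, isOctonionFrame_octonions.comp₁_octonionTorus,
    octonions_evenIndex, octonions_oddIndex]
  simp only [← plane_smul, ← plane_add]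
  exact ⟨_, rfl⟩

lemma eps_octonionTorus (j k : Fin 4) :
    eps j ⟨octonionTorus octonions k, octonionTorus_mem k⟩ = if j = k then 1 else 0 := by
  rw [eps_eq]
  simp only [isOctonionFrame_octonions.comp₁_octonionTorus, LinearMap.map_smul,
    LinearMap.smul_apply, (isOctonionFrame_octonions.form_even j).2.2, octonionWeight₁_even]
  split_ifs <;> norm_num

/-- Pairing with the `k`-th basis element of `t` is `ε_k`, so the basis is orthonormal and the dual
of a weight has the coordinates of that weight. -/
lemma torusForm_octonionTorus (θ : torus) (k : Fin 4) :
    torusForm θ ⟨octonionTorus octonions k, octonionTorus_mem k⟩ = eps k θ := by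
  rw [eps_eq]
  change (1 / 2 : ℂ) * LinearMap.trace ℂ AlgO (comp₁ θ.1 ∘ₗ comp₁ (octonionTorus octonions k)) = _
  rw [octonionTorus_apply, trace_comp₁_comp_rot]
  ring

/-- The coordinates of the weight of `p ωg + q ωg₂ + r ωg₃ + s ωgQ` with respect to `εⱼ`. -/
lemma weight_eq (p q r s : ℕ) (θ : torus) :
    (p • ωg + q • ωg₂ + r • ωg₃ + s • ωgQ : Module.Dual ℂ torus) θ =
      (p + 2 * q + 3 * r + 2 * s : ℂ) * eps 0 θ + (p + q + r) * eps 1 θ + (q + r) * eps 2 θ -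
        r * eps 3 θ := by
  simp only [ωg, ωg₂, ωg₃, ωgQ, ω₁, ω₂, ω₃, ω₄, LinearMap.add_apply, LinearMap.smul_apply,
    LinearMap.sub_apply, nsmul_eq_mul, smul_eq_mul]
  push_cast
  ring

/-- The element of `t` which the invariant form identifies with a weight. -/
lemma eps_of_torusForm_eq {p q r s : ℕ} {θ : torus} (h : ∀ η, torusForm θ η =
    (p • ωg + q • ωg₂ + r • ωg₃ + s • ωgQ : Module.Dual ℂ torus) η) (k : Fin 4) :
    eps k θ = ((![p + 2 * q + 3 * r + 2 * s, p + q + r, q + r, -r] : Fin 4 → ℤ) k : ℂ) := by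
  have h1 := h ⟨octonionTorus octonions k, octonionTorus_mem k⟩
  rw [torusForm_octonionTorus, weight_eq] at h1
  simp only [eps_octonionTorus] at h1
  rw [h1]
  fin_cases k <;> simp

end TorusForm

end TrialitySeries

namespace TrialitySeries
open HurwitzAlgebra TrialityModel

/-! ### Chevalley relations and labels expressed by integer weight tables. -/

section Weighted

variable {A B : Type} [AddCommGroup A] [Module ℂ A] [HurwitzAlgebra A]
  [AddCommGroup B] [Module ℂ B] [HurwitzAlgebra B] {l m n : ℕ}

/-- Generators `e`, `f` of `g̃(A, B)` which are weight vectors for commuting elements `HA` of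
`t(A)` and `HB` of `t(B)`. The entries of `WA` and `WB` are twice the weights of `e`, and those of
`CA` and `CB` are twice the coordinates of the coroots. -/
structure IsWeighted (HA : Fin l → trialityAlgebra A) (HB : Fin m → trialityAlgebra B)
    (e f : Fin n → TrialityModel A B) (WA CA : Fin n → Fin l → ℤ) (WB CB : Fin n → Fin m → ℤ) :
    Prop where
  e_ne_zero : ∀ i, e i ≠ 0
  inl_e : ∀ i k, ⁅(inl (HA k) : TrialityModel A B), e i⁆ = ((WA i k : ℤ) / 2 : ℂ) • e i
  inl_f : ∀ i k, ⁅(inl (HA k) : TrialityModel A B), f i⁆ = -(((WA i k : ℤ) / 2 : ℂ) • f i)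
  inr_e : ∀ i k, ⁅(inr (HB k) : TrialityModel A B), e i⁆ = ((WB i k : ℤ) / 2 : ℂ) • e i
  inr_f : ∀ i k, ⁅(inr (HB k) : TrialityModel A B), f i⁆ = -(((WB i k : ℤ) / 2 : ℂ) • f i)
  lie_self : ∀ i, ⁅e i, f i⁆ = inl (∑ k, ((CA i k : ℤ) / 2 : ℂ) • HA k) +
    inr (∑ k, ((CB i k : ℤ) / 2 : ℂ) • HB k)
  lie_e_f : ∀ i j, i ≠ j → ⁅e i, f j⁆ = 0
  span : LieSubalgebra.lieSpan ℂ (TrialityModel A B) (Set.range e ∪ Set.range f) = ⊤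

variable {HA : Fin l → trialityAlgebra A} {HB : Fin m → trialityAlgebra B}
  {e f : Fin n → TrialityModel A B} {WA CA : Fin n → Fin l → ℤ} {WB CB : Fin n → Fin m → ℤ}

lemma IsWeighted.lie_sum_inr_e (h : IsWeighted HA HB e f WA CA WB CB) (x : Fin m → ℂ) (i : Fin n) :
    ⁅(inr (∑ k, x k • HB k) : TrialityModel A B), e i⁆ =
      (∑ k, x k * ((WB i k : ℤ) / 2 : ℂ)) • e i := by
  simp only [map_sum, LinearMap.map_smul, sum_lie, smul_lie, h.inr_e, smul_smul, Finset.sum_smul]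

lemma IsWeighted.lie_sum_inr_f (h : IsWeighted HA HB e f WA CA WB CB) (x : Fin m → ℂ) (i : Fin n) :
    ⁅(inr (∑ k, x k • HB k) : TrialityModel A B), f i⁆ =
      -((∑ k, x k * ((WB i k : ℤ) / 2 : ℂ)) • f i) := by
  simp only [map_sum, LinearMap.map_smul, sum_lie, smul_lie, h.inr_f, smul_neg, smul_smul,
    Finset.sum_smul, Finset.sum_neg_distrib]

lemma IsWeighted.lie_sum_inl_e (h : IsWeighted HA HB e f WA CA WB CB) (x : Fin l → ℂ) (i : Fin n) :
    ⁅(inl (∑ k, x k • HA k) : TrialityModel A B), e i⁆ =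
      (∑ k, x k * ((WA i k : ℤ) / 2 : ℂ)) • e i := by
  simp only [map_sum, LinearMap.map_smul, sum_lie, smul_lie, h.inl_e, smul_smul, Finset.sum_smul]

lemma IsWeighted.lie_sum_inl_f (h : IsWeighted HA HB e f WA CA WB CB) (x : Fin l → ℂ) (i : Fin n) :
    ⁅(inl (∑ k, x k • HA k) : TrialityModel A B), f i⁆ =
      -((∑ k, x k * ((WA i k : ℤ) / 2 : ℂ)) • f i) := by
  simp only [map_sum, LinearMap.map_smul, sum_lie, smul_lie, h.inl_f, smul_neg, smul_smul,
    Finset.sum_smul, Finset.sum_neg_distrib]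

/-- The entry `αᵢ(hⱼ)` is the product of the coroot coordinates of `j` with the weight of `i`. Both
tables are doubled, which accounts for the factor `4`. -/
lemma IsWeighted.isChevalley (h : IsWeighted HA HB e f WA CA WB CB)
    {M : Matrix (Fin n) (Fin n) ℤ} (hM2 : ∀ i, M i i = 2)
    (hM : ∀ i j, ∑ k, CA j k * WA i k + ∑ k, CB j k * WB i k = 4 * M i j) :
    IsChevalley M e f := by
  have hM' : ∀ i j, (∑ k, ((CA j k : ℤ) / 2 : ℂ) * ((WA i k : ℤ) / 2 : ℂ)) +
      (∑ k, ((CB j k : ℤ) / 2 : ℂ) * ((WB i k : ℤ) / 2 : ℂ)) = (M i j : ℂ) := by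
    intro i j
    have h1 := congrArg (Int.cast : ℤ → ℂ) (hM i j)
    push_cast at h1
    simp only [div_mul_div_comm, ← Finset.sum_div]
    linear_combination h1 / 4
  refine ⟨h.e_ne_zero, hM2, fun i j => ?_, fun i j => ?_, h.lie_e_f, h.span⟩
  · rw [h.lie_self, add_lie, h.lie_sum_inl_e, h.lie_sum_inr_e, ← add_smul, hM']
  · rw [h.lie_self, add_lie, h.lie_sum_inl_f, h.lie_sum_inr_f, ← neg_add, ← add_smul, hM']

end Weighted

section Diagram

variable {A : Type} [AddCommGroup A] [Module ℂ A] [HurwitzAlgebra A] {l n : ℕ}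
  {HA : Fin l → trialityAlgebra A} {e f : Fin n → TrialityModel A AlgO}
  {WA CA : Fin n → Fin l → ℤ} {WB CB : Fin n → Fin 4 → ℤ}

attribute [local irreducible] torus trialityAlgebra

lemma torusInclusion_eq_inr (θ : torus) : torusInclusion A θ = inr θ.1 :=
  (inr_apply _).symm

lemma torusInclusion_eq (θ : torus) :
    torusInclusion A θ = inr (∑ j, eps j θ • octonionTorus octonions j) :=
  (torusInclusion_eq_inr θ).trans (congrArg inr (torus_eq_sum θ))

/-- Turns the problem into arithmetic of integer matrices. In `hd` only `WB` enters, since the dual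
of `λ` lies in `t(𝕆)`. The coefficients are the `ε`-coordinates of `λ`, and the `2` comes from the
doubled weights. -/
lemma IsWeighted.diagramCorrespondsTo [Module.Finite ℂ A]
    (hw : IsWeighted HA (octonionTorus octonions) e f WA CA WB CB)
    {M C : Matrix (Fin n) (Fin n) ℤ} {c : ℤ} (hM2 : ∀ i, M i i = 2)
    (hM : ∀ i j, ∑ k, CA j k * WA i k + ∑ k, CB j k * WB i k = 4 * M i j) (hc : 0 < c)
    (hC : ∀ i j, 0 ≤ C i j) (hMC : M * C = c • (1 : Matrix (Fin n) (Fin n) ℤ))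
    {X : LieF₄} {p q r s m : ℕ} {C₀ : Matrix (Fin m) (Fin m) ℤ} {d₀ : Fin m → ℕ}
    (h : DiagramCorrespondsTo X (p • ωg + q • ωg₂ + r • ωg₃ + s • ωgQ) C₀ d₀)
    {d : Fin n → ℕ} (hd : ∀ i, (p + 2 * q + 3 * r + 2 * s) * WB i 0 + (p + q + r) * WB i 1 +
      (q + r) * WB i 2 - r * WB i 3 = 2 * d i) :
    DiagramCorrespondsTo (inclusion A AlgO X) (p • ωg + q • ωg₂ + r • ωg₃ + s • ωgQ) M d := by
  refine diagramCorrespondsTo_inclusion h (hw.isChevalley hM2 hM) hc hC hMC (fun θ i => ?_)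
    (fun θ hθ i => ?_)
  · rw [torusInclusion_eq]
    refine ⟨∑ k, eps k θ * ((WB i k : ℤ) / 2 : ℂ), ?_, ?_⟩
    · rw [hw.lie_sum_inr_e]
    · rw [hw.lie_sum_inr_f]
  · rw [torusInclusion_eq, hw.lie_sum_inr_e]
    congr 1
    simp only [eps_of_torusForm_eq hθ, Fin.sum_univ_four]
    have h1 := congrArg (Int.cast : ℤ → ℂ) (hd i)
    push_cast at h1
    simp only [Matrix.cons_val]
    push_cast
    linear_combination h1 / 2

end Diagram

end TrialitySeries

namespace TrialitySeries
open HurwitzAlgebra TrialityModel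

/-! ### Root vectors built from hyperbolic pairs of weight vectors. -/

section WeightPairs

variable {l : ℕ}

/-- `v` and `v'` are weight vectors of opposite weights for the operators `T`; `w` is twice the
weight of `v`. -/
def IsWeightPair {W : Type} [AddCommGroup W] [Module ℂ W] (T : Fin l → Module.End ℂ W)
    (w : Fin l → ℤ) (v v' : W) : Prop :=
  ∀ k, T k v = ((w k : ℤ) / 2 : ℂ) • v ∧ T k v' = -(((w k : ℤ) / 2 : ℂ) • v')

/-- `IsWeightPair` for the adjoint action of elements `H` of a Lie algebra. -/
def IsRootPair {L : Type} [LieRing L] [LieAlgebra ℂ L] (H : Fin l → L) (w : Fin l → ℤ)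
    (e f : L) : Prop :=
  ∀ k, ⁅H k, e⁆ = ((w k : ℤ) / 2 : ℂ) • e ∧ ⁅H k, f⁆ = -(((w k : ℤ) / 2 : ℂ) • f)

variable {A B : Type} [AddCommGroup A] [Module ℂ A] [HurwitzAlgebra A]
  [AddCommGroup B] [Module ℂ B] [HurwitzAlgebra B]
  {HA : Fin l → trialityAlgebra A} {HB : Fin l → trialityAlgebra B} {w w' : Fin l → ℤ}
  {a a' c c' : A} {b b' d d' : B}

lemma IsWeightPair.inl_in₁ (h : IsWeightPair (fun k => comp₁ (HA k)) w a a') (b b' : B) :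
    IsRootPair (fun k => (inl (HA k) : TrialityModel A B)) w (in₁ a b) (-in₁ a' b') := fun k => by
  simp only [lie_neg, lie_inl_in₁, (h k).1, (h k).2, LinearMap.map_smul, LinearMap.map_neg,
    LinearMap.smul_apply, LinearMap.neg_apply, smul_neg, and_self]

lemma IsWeightPair.inl_in₃ (h : IsWeightPair (fun k => comp₃ (HA k)) w a a') (b b' : B) :
    IsRootPair (fun k => (inl (HA k) : TrialityModel A B)) w (in₃ a b) (-in₃ a' b') := fun k => by
  simp only [lie_neg, lie_inl_in₃, (h k).1, (h k).2, LinearMap.map_smul, LinearMap.map_neg,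
    LinearMap.smul_apply, LinearMap.neg_apply, smul_neg, and_self]

lemma IsWeightPair.inr_in₁ (h : IsWeightPair (fun k => comp₁ (HB k)) w b b') (a a' : A) :
    IsRootPair (fun k => (inr (HB k) : TrialityModel A B)) w (in₁ a b) (-in₁ a' b') := fun k => by
  simp only [lie_neg, lie_inr_in₁, (h k).1, (h k).2, LinearMap.map_smul, LinearMap.map_neg,
    smul_neg, and_self]

lemma IsWeightPair.inr_in₃ (h : IsWeightPair (fun k => comp₃ (HB k)) w b b') (a a' : A) :
    IsRootPair (fun k => (inr (HB k) : TrialityModel A B)) w (in₃ a b) (-in₃ a' b') := fun k => by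
  simp only [lie_neg, lie_inr_in₃, (h k).1, (h k).2, LinearMap.map_smul, LinearMap.map_neg,
    smul_neg, and_self]

/-- Equivariance of `psi₁` makes the weights add. The factor `-1/4` plays no role here; it
normalises the bracket of the two vectors to a coroot. -/
lemma IsWeightPair.psi₁ (h : IsWeightPair (fun k => comp₁ (HA k)) w a a')
    (h' : IsWeightPair (fun k => comp₁ (HA k)) w' c c') :
    IsRootPair HA (w + w') (psi₁ a c) (-((1 / 4 : ℂ) • psi₁ a' c')) := fun k => by
  simp only [lie_neg, lie_smul, lie_psi₁, (h k).1, (h k).2, (h' k).1, (h' k).2, LinearMap.map_smul,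
    LinearMap.map_neg, LinearMap.smul_apply, LinearMap.neg_apply, Pi.add_apply, Int.cast_add]
  constructor <;> module

lemma IsWeightPair.psi₂ (h : IsWeightPair (fun k => comp₂ (HA k)) w a a')
    (h' : IsWeightPair (fun k => comp₂ (HA k)) w' c c') :
    IsRootPair HA (w + w') (psi₂ a c) (-((1 / 4 : ℂ) • psi₂ a' c')) := fun k => by
  simp only [lie_neg, lie_smul, lie_psi₂, (h k).1, (h k).2, (h' k).1, (h' k).2, LinearMap.map_smul,
    LinearMap.map_neg, LinearMap.smul_apply, LinearMap.neg_apply, Pi.add_apply, Int.cast_add]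
  constructor <;> module

lemma IsRootPair.inl {e f : trialityAlgebra A} (h : IsRootPair HA w e f) :
    IsRootPair (fun k => (inl (HA k) : TrialityModel A B)) w (inl e) (inl f) := fun k => by
  simp only [lie_inl_inl, (h k).1, (h k).2, LinearMap.map_smul, LinearMap.map_neg, and_self]

lemma IsRootPair.inr {e f : trialityAlgebra B} (h : IsRootPair HB w e f) :
    IsRootPair (fun k => (inr (HB k) : TrialityModel A B)) w (inr e) (inr f) := fun k => by
  simp only [lie_inr_inr, (h k).1, (h k).2, LinearMap.map_smul, LinearMap.map_neg, and_self]

lemma isRootPair_inl_inr (e f : trialityAlgebra B) :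
    IsRootPair (fun k => (TrialityModel.inl (HA k) : TrialityModel A B)) 0
      (TrialityModel.inr e) (TrialityModel.inr f) := fun k => by
  simp [lie_inl_inr]

lemma isRootPair_inr_inl (e f : trialityAlgebra A) :
    IsRootPair (fun k => (TrialityModel.inr (HB k) : TrialityModel A B)) 0
      (TrialityModel.inl e) (TrialityModel.inl f) := fun k => by
  simp [lie_inr_inl]

/-- A hyperbolic pair of isotropic vectors. -/
structure IsHyperbolicPair (a a' : A) : Prop where
  left : form a a = 0
  right : form a' a' = 0
  pairing : form a a' = 1 / 2

/-- The pairings `1/2` and the minus sign are what makes this bracket the coroot, without further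
scaling of the generators. -/
lemma lie_in₁_neg_in₁ (ha : IsHyperbolicPair a a') (hb : IsHyperbolicPair b b') :
    ⁅in₁ a b, -in₁ a' b'⁆ = TrialityModel.inl ((1 / 2 : ℂ) • HurwitzAlgebra.psi₁ a' a) +
      TrialityModel.inr ((1 / 2 : ℂ) • HurwitzAlgebra.psi₁ b' b) := by
  rw [lie_neg, lie_in₁_in₁, ha.pairing, hb.pairing, psi₁_swap a, psi₁_swap b]
  simp only [LinearMap.map_neg, LinearMap.map_smul]
  module

lemma lie_in₃_neg_in₃ (ha : IsHyperbolicPair a a') (hb : IsHyperbolicPair b b') :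
    ⁅in₃ a b, -in₃ a' b'⁆ = TrialityModel.inl ((1 / 2 : ℂ) • psi₃ a' a) +
      TrialityModel.inr ((1 / 2 : ℂ) • psi₃ b' b) := by
  rw [lie_neg, lie_in₃_in₃, ha.pairing, hb.pairing, psi₃_swap a, psi₃_swap b]
  simp only [LinearMap.map_neg, LinearMap.map_smul]
  module

/-- By equivariance the bracket is computed by a rotation acting on `a'` and `c'`. Orthogonality
kills the cross terms, and `4 · (1/2) · (1/4)` gives the coefficients `1/2`. -/
lemma lie_psi₁_neg_psi₁ (ha : IsHyperbolicPair a a') (hc : IsHyperbolicPair c c')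
    (h1 : form a c' = 0) (h2 : form c a' = 0) :
    ⁅HurwitzAlgebra.psi₁ a c, -((1 / 4 : ℂ) • HurwitzAlgebra.psi₁ a' c')⁆ =
      (1 / 2 : ℂ) • HurwitzAlgebra.psi₁ a' a + (1 / 2 : ℂ) • HurwitzAlgebra.psi₁ c' c := by
  rw [lie_neg, lie_smul, lie_psi₁, comp₁_psi₁, rot_apply, rot_apply, ha.pairing, hc.pairing, h1,
    h2, psi₁_swap c' c]
  simp only [mul_zero, zero_smul, LinearMap.map_sub, LinearMap.map_smul, LinearMap.sub_apply,
    LinearMap.smul_apply, LinearMap.map_zero, LinearMap.zero_apply]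
  module

lemma lie_psi₂_neg_psi₂ (ha : IsHyperbolicPair a a') (hc : IsHyperbolicPair c c')
    (h1 : form a c' = 0) (h2 : form c a' = 0) :
    ⁅HurwitzAlgebra.psi₂ a c, -((1 / 4 : ℂ) • HurwitzAlgebra.psi₂ a' c')⁆ =
      (1 / 2 : ℂ) • HurwitzAlgebra.psi₂ a' a + (1 / 2 : ℂ) • HurwitzAlgebra.psi₂ c' c := by
  rw [lie_neg, lie_smul, lie_psi₂, comp₂_psi₂, rot_apply, rot_apply, ha.pairing, hc.pairing, h1,
    h2, psi₂_swap c' c]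
  simp only [mul_zero, zero_smul, LinearMap.map_sub, LinearMap.map_smul, LinearMap.sub_apply,
    LinearMap.smul_apply, LinearMap.map_zero, LinearMap.zero_apply]
  module

/-- The first component sends `a'` to `2 c`, which pairs to `1` with `c'`. -/
lemma psi₁_ne_zero (ha : IsHyperbolicPair a a') (hc : IsHyperbolicPair c c')
    (h2 : form c a' = 0) : HurwitzAlgebra.psi₁ a c ≠ 0 := by
  intro h
  have h3 := congrArg (fun θ => form (comp₁ θ a') c') h
  simp only [comp₁_psi₁, rot_apply, ha.pairing, h2, LinearMap.map_sub, LinearMap.map_smul,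
    LinearMap.sub_apply, LinearMap.smul_apply, hc.pairing, LinearMap.map_zero,
    LinearMap.zero_apply, smul_eq_mul] at h3
  norm_num at h3

lemma psi₂_ne_zero (ha : IsHyperbolicPair a a') (hc : IsHyperbolicPair c c')
    (h2 : form c a' = 0) : HurwitzAlgebra.psi₂ a c ≠ 0 := by
  intro h
  have h3 := congrArg (fun θ => form (comp₂ θ a') c') h
  simp only [comp₂_psi₂, rot_apply, ha.pairing, h2, LinearMap.map_sub, LinearMap.map_smul,
    LinearMap.sub_apply, LinearMap.smul_apply, hc.pairing, LinearMap.map_zero,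
    LinearMap.zero_apply, smul_eq_mul] at h3
  norm_num at h3

lemma inl_ne_zero {θ : trialityAlgebra A} (h : θ ≠ 0) :
    (TrialityModel.inl θ : TrialityModel A B) ≠ 0 :=
  fun h0 => h (congrArg (fun x => x.tri.1) h0)

lemma inr_ne_zero {θ : trialityAlgebra B} (h : θ ≠ 0) :
    (TrialityModel.inr θ : TrialityModel A B) ≠ 0 :=
  fun h0 => h (congrArg (fun x => x.tri.2) h0)

lemma tmul_ne_zero_of_form (ha : form a a' ≠ 0) (hb : form b b' ≠ 0) : a ⊗ₜ[ℂ] b ≠ 0 := by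
  intro h
  have h1 := congrArg (TensorProduct.lid ℂ ℂ ∘ TensorProduct.map (form.flip a') (form.flip b')) h
  simp only [Function.comp_apply, TensorProduct.map_tmul, LinearMap.flip_apply,
    TensorProduct.lid_tmul, smul_eq_mul, LinearMap.map_zero, LinearEquiv.map_zero] at h1
  exact mul_ne_zero ha hb h1

lemma in₁_ne_zero (ha : IsHyperbolicPair a a') (hb : IsHyperbolicPair b b') : in₁ a b ≠ 0 :=
  fun h0 => tmul_ne_zero_of_form (a' := a') (b' := b') (by rw [ha.pairing]; norm_num)
    (by rw [hb.pairing]; norm_num) (congrArg TrialityModel.one h0)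

lemma in₃_ne_zero (ha : IsHyperbolicPair a a') (hb : IsHyperbolicPair b b') : in₃ a b ≠ 0 :=
  fun h0 => tmul_ne_zero_of_form (a' := a') (b' := b') (by rw [ha.pairing]; norm_num)
    (by rw [hb.pairing]; norm_num) (congrArg TrialityModel.three h0)

end WeightPairs

section OctonionPairs

variable {V : Type} [AddCommGroup V] [Module ℂ V] [HurwitzAlgebra V] {E : Fin 8 → V}

/-- The index of the vector of opposite weight. -/
def oppositeIndex : Fin 8 → Fin 8 := ![1, 0, 3, 2, 5, 4, 7, 6]

namespace IsOctonionFrame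

lemma isHyperbolicPair (h : IsOctonionFrame E) (a : Fin 8) :
    IsHyperbolicPair (E a) (E (oppositeIndex a)) := by
  fin_cases a <;> constructor <;> simp [oppositeIndex, h.form_table]

lemma isWeightPair₁ (h : IsOctonionFrame E) (a : Fin 8) :
    IsWeightPair (fun k => comp₁ (octonionTorus E k)) (octonionWeight₁ a) (E a)
      (E (oppositeIndex a)) := by
  have h1 : ∀ a k, octonionWeight₁ (oppositeIndex a) k = -octonionWeight₁ a k := by decide
  intro k
  simp only [h.comp₁_octonionTorus, h1, Int.cast_neg, true_and]
  module

lemma isWeightPair₃ (h : IsOctonionFrame E) (a : Fin 8) :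
    IsWeightPair (fun k => comp₃ (octonionTorus E k)) (octonionWeight₃ a) (E a)
      (E (oppositeIndex a)) := by
  have h1 : ∀ a k, octonionWeight₃ (oppositeIndex a) k = -octonionWeight₃ a k := by decide
  intro k
  simp only [h.comp₃_octonionTorus, h1, Int.cast_neg, true_and]
  module

lemma half_psi₁ (_ : IsOctonionFrame E) (a : Fin 8) :
    (1 / 2 : ℂ) • psi₁ (E (oppositeIndex a)) (E a) =
      ∑ k, ((octonionWeight₁ a k : ℤ) / 2 : ℂ) • octonionTorus E k := by
  have h1 := psi₁_swap (E 0) (E 1)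
  have h2 := psi₁_swap (E 2) (E 3)
  have h3 := psi₁_swap (E 4) (E 5)
  have h4 := psi₁_swap (E 6) (E 7)
  fin_cases a <;>
    simp [oppositeIndex, octonionWeight₁, octonionTorus, Fin.sum_univ_four, h1, h2, h3, h4]

end IsOctonionFrame

end OctonionPairs

end TrialitySeries

namespace TrialitySeries
open HurwitzAlgebra

/-! ### The triality algebra is spanned by the images of `psi₁` and `psi₂`. -/

section TrialitySpan

variable {V : Type} [AddCommGroup V] [Module ℂ V] [HurwitzAlgebra V]

variable (V) in
/-- The images of `Ψ₁` and `Ψ₂` span `t(V)`. -/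
def SpannedByPsi : Prop :=
  ∀ T : Submodule ℂ (trialityAlgebra V), (∀ u v, psi₁ u v ∈ T) → (∀ u v, psi₂ u v ∈ T) →
    ∀ θ, θ ∈ T

lemma mem_of_expand {n : ℕ} {E : Fin n → V} (hE : ∀ x, ∃ c : Fin n → ℂ, x = ∑ i, c i • E i)
    {T : Submodule ℂ V} (h : ∀ i, E i ∈ T) (x : V) : x ∈ T := by
  obtain ⟨c, rfl⟩ := hE x
  exact T.sum_mem fun i _ => T.smul_mem _ (h i)

/-- A skew map is a sum of rotations over dual bases. Each of the two terms of `rot` contributes `2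
g`, the second one through skewness and the transposed expansion `hE'`. -/
lemma sum_rot_of_dual {n : ℕ} {E E' : Fin n → V}
    (hE : ∀ z, ∑ a, form (E' a) z • E a = (1 / 2 : ℂ) • z) {g : Module.End ℂ V} (hg : IsSkew g) :
    ∑ a, rot (E' a) (g (E a)) = (4 : ℂ) • g := by
  have hE' : ∀ z, ∑ a, form (E a) z • E' a = (1 / 2 : ℂ) • z := fun z => ext_form fun w => by
    have h1 := congrArg (form z) (hE w)
    simp only [map_sum, LinearMap.sum_apply, LinearMap.map_smul, LinearMap.smul_apply,
      smul_eq_mul] at h1 ⊢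
    rw [← h1]
    exact Finset.sum_congr rfl fun a _ => by rw [form_symm z, mul_comm]
  ext1 z
  have h2 := congrArg g (hE z)
  have h3 := hE' (g z)
  simp only [map_sum, LinearMap.map_smul] at h2
  simp only [LinearMap.sum_apply, rot_apply, Finset.sum_sub_distrib, mul_smul, hg _ z,
    LinearMap.smul_apply, ← Finset.smul_sum, h2, neg_smul, Finset.sum_neg_distrib, h3, smul_neg]
  module

/-- Subtracting suitable values of `psi₁` makes the first component zero, and such a triality is
determined by `θ₂(1)`. It then suffices that the span contains an element `η` with `η₁ = 0` and
`η₂(1)` a non-zero multiple of `θ₂(1)`. -/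
lemma spannedByPsi_of_dual {n : ℕ} {E E' : Fin n → V}
    (hE : ∀ z, ∑ a, form (E' a) z • E a = (1 / 2 : ℂ) • z)
    (h : ∀ θ : trialityAlgebra V, comp₁ θ = 0 → ∃ (κ : ℂ) (η : trialityAlgebra V), κ ≠ 0 ∧
      comp₁ η = 0 ∧ comp₂ η one = κ • comp₂ θ one ∧
      ∀ T : Submodule ℂ (trialityAlgebra V), (∀ u v, psi₁ u v ∈ T) → (∀ u v, psi₂ u v ∈ T) →
        η ∈ T) :
    SpannedByPsi V := by
  intro T h1 h2 θ
  have h3 : ∀ θ : trialityAlgebra V, comp₁ θ = 0 → θ ∈ T := by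
    intro θ hθ
    obtain ⟨κ, η, hκ, hη, hc, hT⟩ := h θ hθ
    have h4 : κ • θ - η = 0 := by
      refine eq_zero_of_comp₁_eq_zero_of_comp₂_one_eq_zero ?_ ?_
      · rw [LinearMap.map_sub, LinearMap.map_smul, hθ, hη, smul_zero, sub_zero]
      · rw [LinearMap.map_sub, LinearMap.map_smul, LinearMap.sub_apply, LinearMap.smul_apply, hc,
          sub_self]
    rw [sub_eq_zero] at h4
    exact (T.smul_mem_iff hκ).1 (h4 ▸ hT T h1 h2)
  have h5 := h3 (θ - (1 / 4 : ℂ) • ∑ a, psi₁ (E' a) (comp₁ θ (E a))) (by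
    rw [LinearMap.map_sub, LinearMap.map_smul, map_sum]
    simp only [comp₁_psi₁]
    rw [sum_rot_of_dual hE (skew₁ θ), smul_smul]
    norm_num)
  have h6 := T.add_mem h5 (T.smul_mem (1 / 4 : ℂ) (T.sum_mem (t := Finset.univ) fun a _ =>
    h1 (E' a) (comp₁ θ (E a))))
  rwa [sub_add_cancel] at h6

lemma IsOctonionFrame.spannedByPsi {E : Fin 8 → V} (h : IsOctonionFrame E) : SpannedByPsi V := by
  refine spannedByPsi_of_dual (E := E) (E' := fun a => E (oppositeIndex a)) (fun z => ?_)
    (fun θ hθ => ⟨1, 0, one_ne_zero, LinearMap.map_zero _, ?_, fun T _ _ => T.zero_mem⟩)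
  · obtain ⟨c, rfl⟩ := h.expand z
    simp [Fin.sum_univ_eight, oppositeIndex, h.form_table]
    module
  · rw [h.eq_zero_of_comp₁_eq_zero hθ]
    simp

lemma IsPairFrame.spannedByPsi {E : Fin 2 → V} (h : IsPairFrame E) : SpannedByPsi V := by
  refine spannedByPsi_of_dual (E := E) (E' := ![E 1, E 0]) (fun z => ?_) (fun θ hθ => ?_)
  · obtain ⟨c, rfl⟩ := h.expand z
    simp [Fin.sum_univ_two, h.form_table]
    module
  · obtain ⟨h1, -, -⟩ := comp₂_comp₃_of_comp₁_eq_zero hθ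
    generalize comp₂ θ one = c at h1 ⊢
    obtain ⟨k, rfl⟩ := h.expand c
    simp [Fin.sum_univ_two, h.one_eq, h.form_table] at h1
    have hk : k 1 = -k 0 := by linear_combination 2 * h1
    -- For imaginary `c`, `psi₂ 1 c` has the first component `-2 R_c` and sends `1` to `4 c` in the
    -- second. The `psi₁` term cancels the former and subtracts `c` from the latter, whence `3`.
    refine ⟨3, psi₂ one (∑ i, k i • E i) + k 0 • psi₁ (E 1) (E 0), three_ne_zero, ?_, ?_,
      fun T t1 t2 => T.add_mem (t2 _ _) (T.smul_mem _ (t1 _ _))⟩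
    · ext1 x
      obtain ⟨c, rfl⟩ := h.expand x
      simp [Fin.sum_univ_two, h.one_eq, hk, comp₁_psi₁, comp₁_psi₂, rot_apply, opD_apply,
        h.form_table, h.mul_table, h.conj_table]
      module
    · simp [Fin.sum_univ_two, h.one_eq, hk, comp₂_psi₁, comp₂_psi₂, rot_apply, opB_apply,
        h.form_table, h.mul_table, h.conj_table]
      module

lemma IsQuaternionFrame.spannedByPsi {E : Fin 4 → V} (h : IsQuaternionFrame E) :
    SpannedByPsi V := by
  refine spannedByPsi_of_dual (E := E) (E' := ![E 1, E 0, E 3, E 2]) (fun z => ?_)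
    (fun θ hθ => ?_)
  · obtain ⟨c, rfl⟩ := h.expand z
    simp [Fin.sum_univ_four, h.form_table]
    module
  · obtain ⟨h1, -, -⟩ := comp₂_comp₃_of_comp₁_eq_zero hθ
    generalize comp₂ θ one = c at h1 ⊢
    obtain ⟨k, rfl⟩ := h.expand c
    simp [Fin.sum_univ_four, h.one_eq, h.form_table] at h1
    have hk : k 1 = -k 0 := by linear_combination 2 * h1
    -- As for the complexified `ℂ`: the `psi₁` terms have the first component `2 R_c`, but now they
    -- change the second component at `1` by `-2 c`, so that `4 c - 2 c = 2 c` remains.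
    refine ⟨2, psi₂ one (∑ i, k i • E i) + k 0 • (psi₁ (E 1) (E 0) + psi₁ (E 2) (E 3)) +
      k 2 • psi₁ (E 1) (E 2) + k 3 • psi₁ (E 0) (E 3), two_ne_zero, ?_, ?_,
      fun T t1 t2 => T.add_mem (T.add_mem (T.add_mem (t2 _ _) (T.smul_mem _
        (T.add_mem (t1 _ _) (t1 _ _)))) (T.smul_mem _ (t1 _ _))) (T.smul_mem _ (t1 _ _))⟩
    · ext1 x
      obtain ⟨c, rfl⟩ := h.expand x
      simp [Fin.sum_univ_four, h.one_eq, hk, comp₁_psi₁, comp₁_psi₂, rot_apply, opD_apply,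
        h.form_table, h.mul_table, h.conj_table]
      module
    · simp [Fin.sum_univ_four, h.one_eq, hk, comp₂_psi₁, comp₂_psi₂, rot_apply, opB_apply,
        h.form_table, h.mul_table, h.conj_table]
      module

end TrialitySpan

/-! ### Generation of the triality model by few root vectors. -/

section Generation

open TrialitySeries.TrialityModel

variable {A B : Type} [AddCommGroup A] [Module ℂ A] [HurwitzAlgebra A]
  [AddCommGroup B] [Module ℂ B] [HurwitzAlgebra B]

lemma mem_of_lie_eq_smul {L : Type} [LieRing L] [LieAlgebra ℂ L] {S : LieSubalgebra ℂ L}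
    {x y z : L} {c : ℂ} (hx : x ∈ S) (hy : y ∈ S) (h : ⁅x, y⁆ = c • z) (hc : c ≠ 0) : z ∈ S := by
  have h1 := S.lie_mem hx hy
  rw [h] at h1
  exact (S.toSubmodule.smul_mem_iff hc).1 h1

/-- A subalgebra containing the three summands `Aᵢ ⊗ Bᵢ` is everything. -/
lemma eq_top_of_in_mem (hA : SpannedByPsi A) (hB : SpannedByPsi B)
    {S : LieSubalgebra ℂ (TrialityModel A B)} (h₁ : ∀ a b, in₁ a b ∈ S) (h₂ : ∀ a b, in₂ a b ∈ S)
    (h₃ : ∀ a b, in₃ a b ∈ S) : S = ⊤ := by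
  -- Since `psi₁ 1 1 = 0`, the bracket of `u ⊗ 1` and `v ⊗ 1` has no component in `t(B)` and equals
  -- `psi₁ u v`; likewise for `psi₂`. These span `t(A)`.
  have hl : ∀ θ, (inl θ : TrialityModel A B) ∈ S := by
    refine hA (S.toSubmodule.comap inl) (fun u v => ?_) (fun u v => ?_)
    · refine mem_of_lie_eq_smul (h₁ u HurwitzAlgebra.one) (h₁ v HurwitzAlgebra.one) (c := 1) ?_
        one_ne_zero
      rw [lie_in₁_in₁, psi_one_one.1, form_one, LinearMap.map_zero, smul_zero, add_zero]
    · refine mem_of_lie_eq_smul (h₂ u HurwitzAlgebra.one) (h₂ v HurwitzAlgebra.one) (c := 1) ?_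
        one_ne_zero
      rw [lie_in₂_in₂, psi_one_one.2.1, form_one, LinearMap.map_zero, smul_zero, add_zero]
  have hr : ∀ θ, (inr θ : TrialityModel A B) ∈ S := by
    refine hB (S.toSubmodule.comap inr) (fun u v => ?_) (fun u v => ?_)
    · refine mem_of_lie_eq_smul (h₁ HurwitzAlgebra.one u) (h₁ HurwitzAlgebra.one v) (c := 1) ?_
        one_ne_zero
      rw [lie_in₁_in₁, psi_one_one.1, form_one, LinearMap.map_zero, smul_zero, zero_add]
    · refine mem_of_lie_eq_smul (h₂ HurwitzAlgebra.one u) (h₂ HurwitzAlgebra.one v) (c := 1) ?_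
        one_ne_zero
      rw [lie_in₂_in₂, psi_one_one.2.1, form_one, LinearMap.map_zero, smul_zero, zero_add]
  rw [eq_top_iff]
  exact fun x _ => mem_of_forall_mem (S := S.toSubmodule) hl hr h₁ h₂ h₃ x

section

variable {S : LieSubalgebra ℂ (TrialityModel A B)} {b b' b'' : B} {c : ℂ}

lemma in₁_mem_of_inr {φ : trialityAlgebra B} (hφ : inr φ ∈ S) (h : ∀ a, in₁ a b ∈ S)
    (hb : comp₁ φ b = c • b') (hc : c ≠ 0) (a : A) : in₁ a b' ∈ S :=
  mem_of_lie_eq_smul hφ (h a) (by rw [lie_inr_in₁, hb, LinearMap.map_smul]) hc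

/-- Taking the unit of `A` as one of the two first factors keeps the other one arbitrary, so whole
blocks `A ⊗ b` are propagated by products in `B` alone. -/
lemma in₃_mem_of_mul (h : ∀ a, in₁ a b ∈ S) (h' : ∀ a, in₂ a b' ∈ S)
    (hb : mul b b' = c • b'') (hc : c ≠ 0) (a : A) : in₃ a b'' ∈ S :=
  mem_of_lie_eq_smul (h HurwitzAlgebra.one) (h' a)
    (by rw [lie_in₁_in₂, hb, LinearMap.map_smul, HurwitzAlgebra.one_mul]) hc

lemma in₂_mem_of_mul (h : ∀ a, in₁ a b ∈ S) (h' : ∀ a, in₃ a b' ∈ S)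
    (hb : mul (conj b) b' = c • b'') (hc : c ≠ 0) (a : A) : in₂ a b'' ∈ S :=
  mem_of_lie_eq_smul (h' a) (h HurwitzAlgebra.one)
    (by rw [lie_in₃_in₁, hb, LinearMap.map_smul, conj_one, HurwitzAlgebra.one_mul]) hc

lemma in₁_mem_of_mul (h : ∀ a, in₂ a b ∈ S) (h' : ∀ a, in₃ a b' ∈ S)
    (hb : mul b' (conj b) = c • b'') (hc : c ≠ 0) (a : A) : in₁ a b'' ∈ S :=
  mem_of_lie_eq_smul (h HurwitzAlgebra.one) (h' a)
    (by rw [lie_in₂_in₃, hb, LinearMap.map_smul, conj_one, HurwitzAlgebra.mul_one]) hc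

end

/-- The subalgebra generated by a set of short and long root vectors of `f₄` is everything. -/
lemma eq_top_of_mem (hA : SpannedByPsi A) {F : Fin 8 → B} (hF : IsOctonionFrame F)
    {S : LieSubalgebra ℂ (TrialityModel A B)} (hP : inr (psi₁ (F 2) (F 5)) ∈ S)
    (hP' : inr (psi₁ (F 3) (F 4)) ∈ S) (hQ : inr (psi₁ (F 4) (F 6)) ∈ S)
    (hQ' : inr (psi₁ (F 5) (F 7)) ∈ S) (hR : ∀ a, in₁ a (F 7) ∈ S) (hR' : ∀ a, in₁ a (F 6) ∈ S)
    (hS : ∀ a, in₃ a (F 6) ∈ S) (hS' : ∀ a, in₃ a (F 7) ∈ S) : S = ⊤ := by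
  have hm := hF.mul_table
  have hc := hF.conj_table
  have hn : (-2 : ℂ) ≠ 0 := by norm_num
  have hn1 : (-1 : ℂ) ≠ 0 := by norm_num
  -- The long root vectors carry `F 6`, `F 7` in the first summand to `F 2, …, F 5`.
  have h14 := in₁_mem_of_inr (b' := F 4) hQ hR
    (by simp [comp₁_psi₁, rot_apply, hF.form_table]; norm_num) hn
  have h15 := in₁_mem_of_inr (b' := F 5) hQ' hR'
    (by simp [comp₁_psi₁, rot_apply, hF.form_table]; norm_num) hn
  have h12 := in₁_mem_of_inr (b' := F 2) hP h14
    (by simp [comp₁_psi₁, rot_apply, hF.form_table]; norm_num) hn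
  have h13 := in₁_mem_of_inr (b' := F 3) hP' h15
    (by simp [comp₁_psi₁, rot_apply, hF.form_table]; norm_num) hn
  -- Products of the blocks of the first summand with `F 6`, `F 7` of the third fill six of the
  -- eight places of the second. Products back into the third, first and second summands fill the
  -- rest.
  have h24 := in₂_mem_of_mul (b'' := F 4) h13 hS' (by simp [hm, hc]) one_ne_zero
  have h22 := in₂_mem_of_mul (b'' := F 2) h15 hS' (by simp [hm, hc]) hn1
  have h20 := in₂_mem_of_mul (b'' := F 0) hR' hS' (by simp [hm, hc]) one_ne_zero
  have h25 := in₂_mem_of_mul (b'' := F 5) h12 hS (by simp [hm, hc]) one_ne_zero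
  have h23 := in₂_mem_of_mul (b'' := F 3) h14 hS (by simp [hm, hc]) hn1
  have h21 := in₂_mem_of_mul (b'' := F 1) hR hS (by simp [hm, hc]) one_ne_zero
  have h30 := in₃_mem_of_mul (b'' := F 0) h12 h23 (by simp [hm]) hn1
  have h31 := in₃_mem_of_mul (b'' := F 1) h13 h22 (by simp [hm]) hn1
  have h32 := in₃_mem_of_mul (b'' := F 2) h12 h21 (by simp [hm]) one_ne_zero
  have h33 := in₃_mem_of_mul (b'' := F 3) h13 h20 (by simp [hm]) one_ne_zero
  have h34 := in₃_mem_of_mul (b'' := F 4) h14 h21 (by simp [hm]) one_ne_zero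
  have h35 := in₃_mem_of_mul (b'' := F 5) h15 h20 (by simp [hm]) one_ne_zero
  have h10 := in₁_mem_of_mul (b'' := F 0) h23 h32 (by simp [hm, hc]) one_ne_zero
  have h11 := in₁_mem_of_mul (b'' := F 1) h22 h33 (by simp [hm, hc]) one_ne_zero
  have h26 := in₂_mem_of_mul (b'' := F 6) hR' h31 (by simp [hm, hc]) hn1
  have h27 := in₂_mem_of_mul (b'' := F 7) hR h30 (by simp [hm, hc]) hn1
  refine eq_top_of_in_mem hA hF.spannedByPsi (fun a => ?_) (fun a => ?_) (fun a => ?_)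
  · refine mem_of_expand hF.expand (T := S.toSubmodule.comap (in₁ a)) fun i => ?_
    fin_cases i
    exacts [h10 a, h11 a, h12 a, h13 a, h14 a, h15 a, hR' a, hR a]
  · refine mem_of_expand hF.expand (T := S.toSubmodule.comap (in₂ a)) fun i => ?_
    fin_cases i
    exacts [h20 a, h21 a, h22 a, h23 a, h24 a, h25 a, h26 a, h27 a]
  · refine mem_of_expand hF.expand (T := S.toSubmodule.comap (in₃ a)) fun i => ?_
    fin_cases i
    exacts [h30 a, h31 a, h32 a, h33 a, h34 a, h35 a, hS a, hS' a]

end Generation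

end TrialitySeries

namespace TrialitySeries
open HurwitzAlgebra

/-! ### Pairs of opposite generators common to the three exceptional algebras. -/

section Generators

variable {A B : Type} [AddCommGroup A] [Module ℂ A] [HurwitzAlgebra A]
  [AddCommGroup B] [Module ℂ B] [HurwitzAlgebra B] {l m n : ℕ}
  {HA : Fin l → trialityAlgebra A} {HB : Fin m → trialityAlgebra B}
  {wA wA' cA cA' : Fin l → ℤ} {wB wB' cB cB' : Fin m → ℤ} {a a' c c' : A} {b b' d d' : B}

/-- A pair of generators as in `IsWeighted`. -/
structure IsWeightedPair (HA : Fin l → trialityAlgebra A) (HB : Fin m → trialityAlgebra B)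
    (e f : TrialityModel A B) (wA cA : Fin l → ℤ) (wB cB : Fin m → ℤ) : Prop where
  ne_zero : e ≠ 0
  left : IsRootPair (fun k => (TrialityModel.inl (HA k) : TrialityModel A B)) wA e f
  right : IsRootPair (fun k => (TrialityModel.inr (HB k) : TrialityModel A B)) wB e f
  lie : ⁅e, f⁆ = TrialityModel.inl (∑ k, ((cA k : ℤ) / 2 : ℂ) • HA k) +
    TrialityModel.inr (∑ k, ((cB k : ℤ) / 2 : ℂ) • HB k)

lemma isWeighted_of_pairs {e f : Fin n → TrialityModel A B} {WA CA : Fin n → Fin l → ℤ}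
    {WB CB : Fin n → Fin m → ℤ}
    (h : ∀ i, IsWeightedPair HA HB (e i) (f i) (WA i) (CA i) (WB i) (CB i))
    (h0 : ∀ i j, i ≠ j → ⁅e i, f j⁆ = 0)
    (hS : LieSubalgebra.lieSpan ℂ (TrialityModel A B) (Set.range e ∪ Set.range f) = ⊤) :
    IsWeighted HA HB e f WA CA WB CB where
  e_ne_zero i := (h i).ne_zero
  inl_e i k := ((h i).left k).1
  inl_f i k := ((h i).left k).2
  inr_e i k := ((h i).right k).1
  inr_f i k := ((h i).right k).2
  lie_self i := (h i).lie
  lie_e_f := h0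
  span := hS

lemma IsWeightPair.symm {W : Type} [AddCommGroup W] [Module ℂ W] {T : Fin l → Module.End ℂ W}
    {w : Fin l → ℤ} {v v' : W} (h : IsWeightPair T w v v') : IsWeightPair T (-w) v' v := fun k => by
  rw [(h k).1, (h k).2, Pi.neg_apply, Int.cast_neg]
  constructor <;> module

lemma IsHyperbolicPair.symm (h : IsHyperbolicPair a a') : IsHyperbolicPair a' a :=
  ⟨h.right, h.left, by rw [form_symm, h.pairing]⟩

lemma isWeightedPair_in₁ (hA : IsWeightPair (fun k => comp₁ (HA k)) wA a a')
    (hB : IsWeightPair (fun k => comp₁ (HB k)) wB b b') (ha : IsHyperbolicPair a a')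
    (hb : IsHyperbolicPair b b')
    (hcA : (1 / 2 : ℂ) • psi₁ a' a = ∑ k, ((cA k : ℤ) / 2 : ℂ) • HA k)
    (hcB : (1 / 2 : ℂ) • psi₁ b' b = ∑ k, ((cB k : ℤ) / 2 : ℂ) • HB k) :
    IsWeightedPair HA HB (TrialityModel.in₁ a b) (-TrialityModel.in₁ a' b') wA cA wB cB where
  ne_zero := in₁_ne_zero ha hb
  left := hA.inl_in₁ _ _
  right := hB.inr_in₁ _ _
  lie := by rw [lie_in₁_neg_in₁ ha hb, hcA, hcB]

lemma isWeightedPair_in₃ (hA : IsWeightPair (fun k => comp₃ (HA k)) wA a a')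
    (hB : IsWeightPair (fun k => comp₃ (HB k)) wB b b') (ha : IsHyperbolicPair a a')
    (hb : IsHyperbolicPair b b')
    (hcA : (1 / 2 : ℂ) • psi₃ a' a = ∑ k, ((cA k : ℤ) / 2 : ℂ) • HA k)
    (hcB : (1 / 2 : ℂ) • psi₃ b' b = ∑ k, ((cB k : ℤ) / 2 : ℂ) • HB k) :
    IsWeightedPair HA HB (TrialityModel.in₃ a b) (-TrialityModel.in₃ a' b') wA cA wB cB where
  ne_zero := in₃_ne_zero ha hb
  left := hA.inl_in₃ _ _
  right := hB.inr_in₃ _ _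
  lie := by rw [lie_in₃_neg_in₃ ha hb, hcA, hcB]

lemma sum_half_add_smul {M : Type} [AddCommGroup M] [Module ℂ M] (x y : Fin l → ℤ)
    (z : Fin l → M) : ∑ k, (((x + y) k : ℤ) / 2 : ℂ) • z k =
      ∑ k, ((x k : ℤ) / 2 : ℂ) • z k + ∑ k, ((y k : ℤ) / 2 : ℂ) • z k := by
  simp only [Pi.add_apply, Int.cast_add, add_div, add_smul, Finset.sum_add_distrib]

lemma isWeightedPair_inl_psi₁ (hA : IsWeightPair (fun k => comp₁ (HA k)) wA a a')
    (hA' : IsWeightPair (fun k => comp₁ (HA k)) wA' c c') (ha : IsHyperbolicPair a a')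
    (hc : IsHyperbolicPair c c') (h1 : form a c' = 0) (h2 : form c a' = 0)
    (hcA : (1 / 2 : ℂ) • psi₁ a' a = ∑ k, ((cA k : ℤ) / 2 : ℂ) • HA k)
    (hcA' : (1 / 2 : ℂ) • psi₁ c' c = ∑ k, ((cA' k : ℤ) / 2 : ℂ) • HA k) :
    IsWeightedPair HA HB (TrialityModel.inl (psi₁ a c))
      (TrialityModel.inl (-((1 / 4 : ℂ) • psi₁ a' c'))) (wA + wA') (cA + cA') 0 0 where
  ne_zero := inl_ne_zero (psi₁_ne_zero ha hc h2)
  left := (hA.psi₁ hA').inl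
  right := isRootPair_inr_inl _ _
  lie := by
    rw [TrialityModel.lie_inl_inl, lie_psi₁_neg_psi₁ ha hc h1 h2, hcA, hcA', sum_half_add_smul]
    simp

lemma isWeightedPair_inl_psi₂ (hA : IsWeightPair (fun k => comp₂ (HA k)) wA a a')
    (hA' : IsWeightPair (fun k => comp₂ (HA k)) wA' c c') (ha : IsHyperbolicPair a a')
    (hc : IsHyperbolicPair c c') (h1 : form a c' = 0) (h2 : form c a' = 0)
    (hcA : (1 / 2 : ℂ) • psi₂ a' a = ∑ k, ((cA k : ℤ) / 2 : ℂ) • HA k)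
    (hcA' : (1 / 2 : ℂ) • psi₂ c' c = ∑ k, ((cA' k : ℤ) / 2 : ℂ) • HA k) :
    IsWeightedPair HA HB (TrialityModel.inl (psi₂ a c))
      (TrialityModel.inl (-((1 / 4 : ℂ) • psi₂ a' c'))) (wA + wA') (cA + cA') 0 0 where
  ne_zero := inl_ne_zero (psi₂_ne_zero ha hc h2)
  left := (hA.psi₂ hA').inl
  right := isRootPair_inr_inl _ _
  lie := by
    rw [TrialityModel.lie_inl_inl, lie_psi₂_neg_psi₂ ha hc h1 h2, hcA, hcA', sum_half_add_smul]
    simp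

lemma isWeightedPair_inr_psi₁ (hB : IsWeightPair (fun k => comp₁ (HB k)) wB b b')
    (hB' : IsWeightPair (fun k => comp₁ (HB k)) wB' d d') (hb : IsHyperbolicPair b b')
    (hd : IsHyperbolicPair d d') (h1 : form b d' = 0) (h2 : form d b' = 0)
    (hcB : (1 / 2 : ℂ) • psi₁ b' b = ∑ k, ((cB k : ℤ) / 2 : ℂ) • HB k)
    (hcB' : (1 / 2 : ℂ) • psi₁ d' d = ∑ k, ((cB' k : ℤ) / 2 : ℂ) • HB k) :
    IsWeightedPair HA HB (TrialityModel.inr (psi₁ b d))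
      (TrialityModel.inr (-((1 / 4 : ℂ) • psi₁ b' d'))) 0 0 (wB + wB') (cB + cB') where
  ne_zero := inr_ne_zero (psi₁_ne_zero hb hd h2)
  left := isRootPair_inl_inr _ _
  right := (hB.psi₁ hB').inr
  lie := by
    rw [TrialityModel.lie_inr_inr, lie_psi₁_neg_psi₁ hb hd h1 h2, hcB, hcB', sum_half_add_smul]
    simp

section

variable {F : Fin 8 → B}

lemma IsOctonionFrame.isWeightedPair_inr (hF : IsOctonionFrame F) (i j : Fin 8)
    (h1 : form (F i) (F (oppositeIndex j)) = 0) (h2 : form (F j) (F (oppositeIndex i)) = 0) :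
    IsWeightedPair HA (octonionTorus F) (TrialityModel.inr (psi₁ (F i) (F j)))
      (TrialityModel.inr (-((1 / 4 : ℂ) • psi₁ (F (oppositeIndex i)) (F (oppositeIndex j)))))
      0 0 (octonionWeight₁ i + octonionWeight₁ j) (octonionWeight₁ i + octonionWeight₁ j) :=
  isWeightedPair_inr_psi₁ (hF.isWeightPair₁ i) (hF.isWeightPair₁ j) (hF.isHyperbolicPair i)
    (hF.isHyperbolicPair j) h1 h2 (hF.half_psi₁ i) (hF.half_psi₁ j)

/-- This pair and the three that follow have the `t`-weights `ε₂ - ε₃`, `ε₃ + ε₄`, `-ε₄` and `(ε₁ -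
ε₂ - ε₃ + ε₄)/2`, a base of F₄ on which `λ` takes the values `p, q, r, s`. -/
lemma IsOctonionFrame.isWeightedPair_long (hF : IsOctonionFrame F) :
    IsWeightedPair HA (octonionTorus F) (TrialityModel.inr (psi₁ (F 2) (F 5)))
      (TrialityModel.inr (-((1 / 4 : ℂ) • psi₁ (F 3) (F 4)))) 0 0 ![0, 2, -2, 0] ![0, 2, -2, 0] := by
  have h : octonionWeight₁ 2 + octonionWeight₁ 5 = ![0, 2, -2, 0] := by decide
  exact h ▸ hF.isWeightedPair_inr 2 5 (by simp [oppositeIndex, hF.form_table])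
    (by simp [oppositeIndex, hF.form_table])

lemma IsOctonionFrame.isWeightedPair_long' (hF : IsOctonionFrame F) :
    IsWeightedPair HA (octonionTorus F) (TrialityModel.inr (psi₁ (F 4) (F 6)))
      (TrialityModel.inr (-((1 / 4 : ℂ) • psi₁ (F 5) (F 7)))) 0 0 ![0, 0, 2, 2] ![0, 0, 2, 2] := by
  have h : octonionWeight₁ 4 + octonionWeight₁ 6 = ![0, 0, 2, 2] := by decide
  exact h ▸ hF.isWeightedPair_inr 4 6 (by simp [oppositeIndex, hF.form_table])
    (by simp [oppositeIndex, hF.form_table])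

lemma IsOctonionFrame.isWeightedPair_in₁ (hF : IsOctonionFrame F)
    (hA : IsWeightPair (fun k => comp₁ (HA k)) wA a a') (ha : IsHyperbolicPair a a')
    (hcA : (1 / 2 : ℂ) • psi₁ a' a = ∑ k, ((cA k : ℤ) / 2 : ℂ) • HA k) :
    IsWeightedPair HA (octonionTorus F) (TrialityModel.in₁ a (F 7)) (-TrialityModel.in₁ a' (F 6))
      wA cA ![0, 0, 0, -2] ![0, 0, 0, -2] :=
  TrialitySeries.isWeightedPair_in₁ hA (hF.isWeightPair₁ 7) ha (hF.isHyperbolicPair 7) hcA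
    (hF.half_psi₁ 7)

lemma IsOctonionFrame.isWeightedPair_in₃ (hF : IsOctonionFrame F)
    (hA : IsWeightPair (fun k => comp₃ (HA k)) wA a a') (ha : IsHyperbolicPair a a')
    (hcA : (1 / 2 : ℂ) • psi₃ a' a = ∑ k, ((cA k : ℤ) / 2 : ℂ) • HA k) :
    IsWeightedPair HA (octonionTorus F) (TrialityModel.in₃ a (F 6)) (-TrialityModel.in₃ a' (F 7))
      wA cA ![1, -1, -1, 1] ![1, -1, -1, 1] :=
  TrialitySeries.isWeightedPair_in₃ hA (hF.isWeightPair₃ 6) ha (hF.isHyperbolicPair 6) hcA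
    hF.half_psi₃_six

end

open TrialitySeries.TrialityModel (inl inr in₁ in₃ lie_inr_inr lie_inr_in₁ lie_inr_in₃
  lie_in₁_inr lie_in₃_inr lie_in₁_in₃ lie_in₃_in₁)

/-- Vanishing brackets of generators of `g̃(A, 𝕆)` with distinct weights for `t(𝕆)`. -/
lemma IsOctonionFrame.lie_eq_zero {F : Fin 8 → B} (hF : IsOctonionFrame F) :
    ⁅(inr (psi₁ (F 2) (F 5)) : TrialityModel A B),
      (inr (-((1 / 4 : ℂ) • psi₁ (F 5) (F 7))) : TrialityModel A B)⁆ = 0 ∧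
    ⁅(inr (psi₁ (F 4) (F 6)) : TrialityModel A B),
      (inr (-((1 / 4 : ℂ) • psi₁ (F 3) (F 4))) : TrialityModel A B)⁆ = 0 ∧
    (∀ a : A, ⁅(inr (psi₁ (F 2) (F 5)) : TrialityModel A B), -in₁ a (F 6)⁆ = 0) ∧
    (∀ a : A, ⁅(inr (psi₁ (F 2) (F 5)) : TrialityModel A B), -in₃ a (F 7)⁆ = 0) ∧
    (∀ a : A, ⁅(inr (psi₁ (F 4) (F 6)) : TrialityModel A B), -in₁ a (F 6)⁆ = 0) ∧
    (∀ a : A, ⁅(inr (psi₁ (F 4) (F 6)) : TrialityModel A B), -in₃ a (F 7)⁆ = 0) ∧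
    (∀ a : A, ⁅in₁ a (F 7),
      (inr (-((1 / 4 : ℂ) • psi₁ (F 3) (F 4))) : TrialityModel A B)⁆ = 0) ∧
    (∀ a : A, ⁅in₁ a (F 7),
      (inr (-((1 / 4 : ℂ) • psi₁ (F 5) (F 7))) : TrialityModel A B)⁆ = 0) ∧
    (∀ a : A, ⁅in₃ a (F 6),
      (inr (-((1 / 4 : ℂ) • psi₁ (F 3) (F 4))) : TrialityModel A B)⁆ = 0) ∧
    (∀ a : A, ⁅in₃ a (F 6),
      (inr (-((1 / 4 : ℂ) • psi₁ (F 5) (F 7))) : TrialityModel A B)⁆ = 0) ∧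
    (∀ a a' : A, ⁅in₁ a (F 7), -in₃ a' (F 7)⁆ = 0) ∧
    (∀ a a' : A, ⁅in₃ a (F 6), -in₁ a' (F 6)⁆ = 0) := by
  simp [lie_inr_inr, lie_inr_in₁, lie_inr_in₃, lie_in₁_inr, lie_in₃_inr, lie_in₁_in₃, lie_in₃_in₁,
    lie_psi₁, comp₁_psi₁, comp₃_psi₁, rot_apply, opA_apply, hF.form_table, hF.mul_table,
    hF.conj_table]

lemma psi₁_self (x : A) : psi₁ x x = 0 := TrialityModel.self_eq_zero (psi₁_swap _ _)

lemma psi₃_self (x : A) : psi₃ x x = 0 := TrialityModel.self_eq_zero (psi₃_swap _ _)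

/-- The cyclic identity with the middle entry `1`. It expresses the coroots of the third summand in
a torus built from `psi₁` and `psi₂`. -/
lemma psi₃_eq (a c : A) : psi₃ a c = psi₁ a c + psi₂ one (mul (conj a) c) := by
  have h := psi_cyclic a one c
  rw [HurwitzAlgebra.mul_one, conj_one, HurwitzAlgebra.mul_one, psi₁_swap c,
    psi₂_swap _ one] at h
  rw [← sub_eq_zero, ← h]
  abel

lemma inl_mem_of_neg_smul {S : LieSubalgebra ℂ (TrialityModel A B)} {θ : trialityAlgebra A}
    (h : TrialityModel.inl (-((1 / 4 : ℂ) • θ)) ∈ S) : TrialityModel.inl θ ∈ S := by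
  rw [LinearMap.map_neg, LinearMap.map_smul, neg_mem_iff] at h
  exact (S.toSubmodule.smul_mem_iff (by norm_num)).1 h

lemma inr_mem_of_neg_smul {S : LieSubalgebra ℂ (TrialityModel A B)} {θ : trialityAlgebra B}
    (h : TrialityModel.inr (-((1 / 4 : ℂ) • θ)) ∈ S) : TrialityModel.inr θ ∈ S := by
  rw [LinearMap.map_neg, LinearMap.map_smul, neg_mem_iff] at h
  exact (S.toSubmodule.smul_mem_iff (by norm_num)).1 h

end Generators

end TrialitySeries

namespace TrialitySeries
open HurwitzAlgebra

/-! ### Generators of `e₆`. -/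

section E₆

open TrialitySeries.TrialityModel (inl inr in₁ in₃ lie_inl_inl lie_inl_inr lie_inr_inl
  lie_inr_inr lie_inl_in₁ lie_inl_in₃ lie_inr_in₁ lie_inr_in₃ lie_in₁_inl lie_in₃_inl lie_in₁_inr
  lie_in₃_inr lie_in₁_in₁ lie_in₃_in₃ lie_in₁_in₃ lie_in₃_in₁)

variable {A B : Type} [AddCommGroup A] [Module ℂ A] [HurwitzAlgebra A]
  [AddCommGroup B] [Module ℂ B] [HurwitzAlgebra B] {E : Fin 2 → A} {F : Fin 8 → B}

/-- A basis of a Cartan subalgebra of `t(A)` for the complexification `A` of `ℂ`. -/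
def pairTorus (E : Fin 2 → A) : Fin 2 → trialityAlgebra A :=
  ![(1 / 2 : ℂ) • psi₁ (E 1) (E 0), (1 / 2 : ℂ) • psi₂ (E 1) (E 0)]

namespace IsPairFrame

lemma isHyperbolicPair (h : IsPairFrame E) : IsHyperbolicPair (E 0) (E 1) := by
  constructor <;> simp only [h.form_table]

/-- Here `t(A)` is a two-dimensional torus while `psi₁` yields one dimension only, so a value of
`psi₂` completes the basis. This basis is not orthonormal, and the coordinates of coroots differ
from those of weights. -/
lemma isWeightPair₁ (h : IsPairFrame E) :
    IsWeightPair (fun k => comp₁ (pairTorus E k)) ![2, -1] (E 0) (E 1) := by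
  intro k
  fin_cases k <;> simp [pairTorus, comp₁_psi₁, comp₁_psi₂, rot_apply, opD_apply, h.form_table,
    h.mul_table, h.conj_table] <;> constructor <;> module

lemma isWeightPair₃ (h : IsPairFrame E) :
    IsWeightPair (fun k => comp₃ (pairTorus E k)) ![1, 1] (E 0) (E 1) := by
  intro k
  fin_cases k <;> simp [pairTorus, comp₃_psi₁, comp₃_psi₂, opA_apply, opC_apply,
    h.mul_table, h.conj_table]

lemma half_psi₁ (_ : IsPairFrame E) :
    (1 / 2 : ℂ) • psi₁ (E 1) (E 0) =
      ∑ k, (((![2, 0] : Fin 2 → ℤ) k : ℤ) / 2 : ℂ) • pairTorus E k := by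
  simp [pairTorus, Fin.sum_univ_two]

lemma half_psi₁' (_ : IsPairFrame E) :
    (1 / 2 : ℂ) • psi₁ (E 0) (E 1) =
      ∑ k, (((![-2, 0] : Fin 2 → ℤ) k : ℤ) / 2 : ℂ) • pairTorus E k := by
  simp [pairTorus, Fin.sum_univ_two, psi₁_swap (E 0)]

lemma half_psi₃ (h : IsPairFrame E) :
    (1 / 2 : ℂ) • psi₃ (E 1) (E 0) =
      ∑ k, (((![2, 2] : Fin 2 → ℤ) k : ℤ) / 2 : ℂ) • pairTorus E k := by
  have h0 : psi₂ (E 0) (E 0) = 0 := TrialityModel.self_eq_zero (psi₂_swap _ _)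
  simp [pairTorus, Fin.sum_univ_two, psi₃_eq, h.one_eq, h.conj_table, h.mul_table, h0]

lemma half_psi₃' (h : IsPairFrame E) :
    (1 / 2 : ℂ) • psi₃ (E 0) (E 1) =
      ∑ k, (((![-2, -2] : Fin 2 → ℤ) k : ℤ) / 2 : ℂ) • pairTorus E k := by
  rw [psi₃_swap, smul_neg, h.half_psi₃]
  simp [Fin.sum_univ_two]
  abel

end IsPairFrame

/-- The positive generators of `e₆`. -/
def genE₆ (E : Fin 2 → A) (F : Fin 8 → B) : Fin 6 → TrialityModel A B :=
  ![in₃ (E 1) (F 6), inr (psi₁ (F 2) (F 5)), in₁ (E 0) (F 7), inr (psi₁ (F 4) (F 6)),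
    in₁ (E 1) (F 7), in₃ (E 0) (F 6)]

/-- The negative generators of `e₆`. -/
def genE₆' (E : Fin 2 → A) (F : Fin 8 → B) : Fin 6 → TrialityModel A B :=
  ![-in₃ (E 0) (F 7), inr (-((1 / 4 : ℂ) • psi₁ (F 3) (F 4))), -in₁ (E 1) (F 6),
    inr (-((1 / 4 : ℂ) • psi₁ (F 5) (F 7))), -in₁ (E 0) (F 6), -in₃ (E 1) (F 7)]

-- Pairs with distinct `t`-weights are covered by `IsOctonionFrame.lie_eq_zero`. Nodes with the same
-- `t`-weight differ by `E 0` and `E 1`, and their mixed bracket vanishes because these vectors are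
-- isotropic and `psi` is alternating.
set_option maxHeartbeats 1000000 in
lemma lie_genE₆ (hE : IsPairFrame E) (hF : IsOctonionFrame F) (i j : Fin 6) (hij : i ≠ j) :
    ⁅genE₆ E F i, genE₆' E F j⁆ = 0 := by
  have h1 : ⁅in₁ (E 0) (F 7), -in₁ (E 0) (F 6)⁆ = 0 := by
    simp [lie_in₁_in₁, psi₁_self, hE.form_table]
  have h2 : ⁅in₁ (E 1) (F 7), -in₁ (E 1) (F 6)⁆ = 0 := by
    simp [lie_in₁_in₁, psi₁_self, hE.form_table]
  have h3 : ⁅in₃ (E 0) (F 6), -in₃ (E 0) (F 7)⁆ = 0 := by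
    simp [lie_in₃_in₃, psi₃_self, hE.form_table]
  have h4 : ⁅in₃ (E 1) (F 6), -in₃ (E 1) (F 7)⁆ = 0 := by
    simp [lie_in₃_in₃, psi₃_self, hE.form_table]
  obtain ⟨k1, k2, k3, k4, k5, k6, k7, k8, k9, k10, k11, k12⟩ := hF.lie_eq_zero (A := A)
  have e0 : genE₆ E F 0 = in₃ (E 1) (F 6) := rfl
  have e1 : genE₆ E F 1 = inr (psi₁ (F 2) (F 5)) := rfl
  have e2 : genE₆ E F 2 = in₁ (E 0) (F 7) := rfl
  have e3 : genE₆ E F 3 = inr (psi₁ (F 4) (F 6)) := rfl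
  have e4 : genE₆ E F 4 = in₁ (E 1) (F 7) := rfl
  have e5 : genE₆ E F 5 = in₃ (E 0) (F 6) := rfl
  have f0 : genE₆' E F 0 = -in₃ (E 0) (F 7) := rfl
  have f1 : genE₆' E F 1 = inr (-((1 / 4 : ℂ) • psi₁ (F 3) (F 4))) := rfl
  have f2 : genE₆' E F 2 = -in₁ (E 1) (F 6) := rfl
  have f3 : genE₆' E F 3 = inr (-((1 / 4 : ℂ) • psi₁ (F 5) (F 7))) := rfl
  have f4 : genE₆' E F 4 = -in₁ (E 0) (F 6) := rfl
  have f5 : genE₆' E F 5 = -in₃ (E 1) (F 7) := rfl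
  fin_cases i <;> fin_cases j <;>
  first
  | exact absurd rfl hij
  | skip
  all_goals
    simp only [Fin.reduceFinMk, Fin.isValue, Fin.zero_eta, Fin.mk_one, e0, e1, e2, e3, e4, e5,
      f0, f1, f2, f3, f4, f5]
    first
    | simp only [h1, h2, h3, h4, k1, k2, k3, k4, k5, k6, k7, k8, k9, k10, k11, k12]

/-- Since `E 0` and `E 1` both occur with each short root of F₄, the generators contain whole blocks
`A ⊗ F 6` and `A ⊗ F 7`, as `eq_top_of_mem` requires. -/
lemma span_genE₆ (hE : IsPairFrame E) (hF : IsOctonionFrame F) :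
    LieSubalgebra.lieSpan ℂ (TrialityModel A B)
      (Set.range (genE₆ E F) ∪ Set.range (genE₆' E F)) = ⊤ := by
  set S := LieSubalgebra.lieSpan ℂ (TrialityModel A B)
    (Set.range (genE₆ E F) ∪ Set.range (genE₆' E F)) with hS
  have he : ∀ i, genE₆ E F i ∈ S := fun i => LieSubalgebra.subset_lieSpan (Or.inl ⟨i, rfl⟩)
  have hf : ∀ i, genE₆' E F i ∈ S := fun i => LieSubalgebra.subset_lieSpan (Or.inr ⟨i, rfl⟩)
  have r0 : in₁ (E 1) (F 6) ∈ S := neg_mem_iff.1 (hf 2)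
  have r1 : in₁ (E 0) (F 6) ∈ S := neg_mem_iff.1 (hf 4)
  have s0 : in₃ (E 1) (F 7) ∈ S := neg_mem_iff.1 (hf 5)
  have s1 : in₃ (E 0) (F 7) ∈ S := neg_mem_iff.1 (hf 0)
  refine eq_top_of_mem hE.spannedByPsi hF (he 1) (inr_mem_of_neg_smul (hf 1)) (he 3)
    (inr_mem_of_neg_smul (hf 3)) ?_ ?_ ?_ ?_
  · refine mem_of_expand hE.expand (T := S.toSubmodule.comap (in₁.flip (F 7))) fun i => ?_
    fin_cases i
    exacts [he 2, he 4]
  · refine mem_of_expand hE.expand (T := S.toSubmodule.comap (in₁.flip (F 6))) fun i => ?_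
    fin_cases i
    exacts [r1, r0]
  · refine mem_of_expand hE.expand (T := S.toSubmodule.comap (in₃.flip (F 6))) fun i => ?_
    fin_cases i
    exacts [he 5, he 0]
  · refine mem_of_expand hE.expand (T := S.toSubmodule.comap (in₃.flip (F 7))) fun i => ?_
    fin_cases i
    exacts [s1, s0]

lemma isWeighted_genE₆ (hE : IsPairFrame E) (hF : IsOctonionFrame F) :
    IsWeighted (pairTorus E) (octonionTorus F) (genE₆ E F) (genE₆' E F)
      ![-![1, 1], 0, ![2, -1], 0, -![2, -1], ![1, 1]]
      ![![-2, -2], 0, ![2, 0], 0, ![-2, 0], ![2, 2]]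
      ![![1, -1, -1, 1], ![0, 2, -2, 0], ![0, 0, 0, -2], ![0, 0, 2, 2], ![0, 0, 0, -2],
        ![1, -1, -1, 1]]
      ![![1, -1, -1, 1], ![0, 2, -2, 0], ![0, 0, 0, -2], ![0, 0, 2, 2], ![0, 0, 0, -2],
        ![1, -1, -1, 1]] := by
  refine isWeighted_of_pairs (fun i => ?_) (lie_genE₆ hE hF) (span_genE₆ hE hF)
  fin_cases i
  · exact hF.isWeightedPair_in₃ hE.isWeightPair₃.symm hE.isHyperbolicPair.symm hE.half_psi₃'
  · exact hF.isWeightedPair_long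
  · exact hF.isWeightedPair_in₁ hE.isWeightPair₁ hE.isHyperbolicPair hE.half_psi₁
  · exact hF.isWeightedPair_long'
  · exact hF.isWeightedPair_in₁ hE.isWeightPair₁.symm hE.isHyperbolicPair.symm hE.half_psi₁'
  · exact hF.isWeightedPair_in₃ hE.isWeightPair₃ hE.isHyperbolicPair hE.half_psi₃

/-- Three times the inverse of the Cartan matrix of `E₆`. -/
def inverseE₆ : Matrix (Fin 6) (Fin 6) ℕ :=
  !![4, 3, 5, 6, 4, 2;
     3, 6, 6, 9, 6, 3;
     5, 6, 10, 12, 8, 4;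
     6, 9, 12, 18, 12, 6;
     4, 6, 8, 12, 10, 5;
     2, 3, 4, 6, 5, 4]

/-- Nodes 3 and 5 restrict to the same short root on `t`, and so do nodes 1 and 6: each pair
consists of the two weight lines of `A₁` or `A₃`. This is the folding of E₆ to F₄. -/
lemma diagramCorrespondsTo_E₆ {X : LieF₄} {p q r s m : ℕ} {C₀ : Matrix (Fin m) (Fin m) ℤ}
    {d₀ : Fin m → ℕ}
    (h : DiagramCorrespondsTo X (p • ωg + q • ωg₂ + r • ωg₃ + s • ωgQ) C₀ d₀) :
    DiagramCorrespondsTo (inclusion AlgC AlgO X) (p • ωg + q • ωg₂ + r • ωg₃ + s • ωgQ)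
      CartanMatrix.E₆ ![s, p, r, q, r, s] := by
  refine (isWeighted_genE₆ isPairFrame_pairFrame isOctonionFrame_octonions).diagramCorrespondsTo
    (C := inverseE₆.map Nat.cast) (c := 3) (by decide) (by decide) (by decide)
    (fun _ _ => Int.natCast_nonneg _) (by decide) h ?_
  intro i
  fin_cases i <;> simp <;> ring

end E₆

end TrialitySeries

namespace TrialitySeries
open HurwitzAlgebra

/-! ### Generators of `e₇`. -/

section E₇

open TrialitySeries.TrialityModel (inl inr in₁ in₃ lie_inl_inl lie_inl_inr lie_inr_inl
  lie_inr_inr lie_inl_in₁ lie_inl_in₃ lie_inr_in₁ lie_inr_in₃ lie_in₁_inl lie_in₃_inl lie_in₁_inr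
  lie_in₃_inr lie_in₁_in₁ lie_in₃_in₃ lie_in₁_in₃ lie_in₃_in₁)

variable {A B : Type} [AddCommGroup A] [Module ℂ A] [HurwitzAlgebra A]
  [AddCommGroup B] [Module ℂ B] [HurwitzAlgebra B] {E : Fin 4 → A} {F : Fin 8 → B}

lemma in₁_mem_of_inl {S : LieSubalgebra ℂ (TrialityModel A B)} {θ : trialityAlgebra A} {a a' : A}
    {b : B} {c : ℂ} (hθ : inl θ ∈ S) (h : in₁ a b ∈ S) (ha : comp₁ θ a = c • a') (hc : c ≠ 0) :
    in₁ a' b ∈ S :=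
  mem_of_lie_eq_smul hθ h (by rw [lie_inl_in₁, ha, LinearMap.map_smul, LinearMap.smul_apply]) hc

lemma in₃_mem_of_inl {S : LieSubalgebra ℂ (TrialityModel A B)} {θ : trialityAlgebra A} {a a' : A}
    {b : B} {c : ℂ} (hθ : inl θ ∈ S) (h : in₃ a b ∈ S) (ha : comp₃ θ a = c • a') (hc : c ≠ 0) :
    in₃ a' b ∈ S :=
  mem_of_lie_eq_smul hθ h (by rw [lie_inl_in₃, ha, LinearMap.map_smul, LinearMap.smul_apply]) hc

/-- A basis of a Cartan subalgebra of `t(A)` for the complexification `A` of `ℍ`. -/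
def quaternionTorus (E : Fin 4 → A) : Fin 3 → trialityAlgebra A :=
  ![(1 / 2 : ℂ) • psi₁ (E 1) (E 0), (1 / 2 : ℂ) • psi₁ (E 3) (E 2),
    (1 / 2 : ℂ) • psi₂ (E 1) (E 0)]

namespace IsQuaternionFrame

lemma isHyperbolicPair (h : IsQuaternionFrame E) : IsHyperbolicPair (E 0) (E 1) := by
  constructor <;> simp only [h.form_table]

lemma isHyperbolicPair' (h : IsQuaternionFrame E) : IsHyperbolicPair (E 2) (E 3) := by
  constructor <;> simp only [h.form_table]

lemma isWeightPair₁ (h : IsQuaternionFrame E) :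
    IsWeightPair (fun k => comp₁ (quaternionTorus E k)) ![2, 0, -1] (E 0) (E 1) := by
  intro k
  fin_cases k <;> simp [quaternionTorus, comp₁_psi₁, comp₁_psi₂, rot_apply, opD_apply,
    h.form_table, h.mul_table, h.conj_table] <;> constructor <;> module

lemma isWeightPair₁' (h : IsQuaternionFrame E) :
    IsWeightPair (fun k => comp₁ (quaternionTorus E k)) ![0, 2, 1] (E 2) (E 3) := by
  intro k
  fin_cases k <;> simp [quaternionTorus, comp₁_psi₁, comp₁_psi₂, rot_apply, opD_apply,
    h.form_table, h.mul_table, h.conj_table] <;> constructor <;> module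

lemma isWeightPair₂ (h : IsQuaternionFrame E) :
    IsWeightPair (fun k => comp₂ (quaternionTorus E k)) ![-1, 1, 2] (E 0) (E 1) := by
  intro k
  fin_cases k <;> simp [quaternionTorus, comp₂_psi₁, comp₂_psi₂, rot_apply, opB_apply,
    h.form_table, h.mul_table, h.conj_table] <;> constructor <;> module

lemma isWeightPair₂' (h : IsQuaternionFrame E) :
    IsWeightPair (fun k => comp₂ (quaternionTorus E k)) ![-1, 1, 0] (E 2) (E 3) := by
  intro k
  fin_cases k <;> simp [quaternionTorus, comp₂_psi₁, comp₂_psi₂, rot_apply, opB_apply,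
    h.form_table, h.mul_table, h.conj_table] <;> constructor <;> module

lemma isWeightPair₃ (h : IsQuaternionFrame E) :
    IsWeightPair (fun k => comp₃ (quaternionTorus E k)) ![1, 1, 1] (E 0) (E 1) := by
  intro k
  fin_cases k <;> simp [quaternionTorus, comp₃_psi₁, comp₃_psi₂, opA_apply, opC_apply,
    h.mul_table, h.conj_table]

lemma half_psi₁ (_ : IsQuaternionFrame E) :
    (1 / 2 : ℂ) • psi₁ (E 1) (E 0) =
      ∑ k, (((![2, 0, 0] : Fin 3 → ℤ) k : ℤ) / 2 : ℂ) • quaternionTorus E k := by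
  simp [quaternionTorus, Fin.sum_univ_three]

lemma half_psi₁_neg (_ : IsQuaternionFrame E) :
    (1 / 2 : ℂ) • psi₁ (E 0) (E 1) =
      ∑ k, (((![-2, 0, 0] : Fin 3 → ℤ) k : ℤ) / 2 : ℂ) • quaternionTorus E k := by
  simp [quaternionTorus, Fin.sum_univ_three, psi₁_swap (E 0)]

lemma half_psi₁' (_ : IsQuaternionFrame E) :
    (1 / 2 : ℂ) • psi₁ (E 3) (E 2) =
      ∑ k, (((![0, 2, 0] : Fin 3 → ℤ) k : ℤ) / 2 : ℂ) • quaternionTorus E k := by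
  simp [quaternionTorus, Fin.sum_univ_three]

lemma half_psi₁'_neg (_ : IsQuaternionFrame E) :
    (1 / 2 : ℂ) • psi₁ (E 2) (E 3) =
      ∑ k, (((![0, -2, 0] : Fin 3 → ℤ) k : ℤ) / 2 : ℂ) • quaternionTorus E k := by
  simp [quaternionTorus, Fin.sum_univ_three, psi₁_swap (E 2)]

lemma half_psi₂ (_ : IsQuaternionFrame E) :
    (1 / 2 : ℂ) • psi₂ (E 1) (E 0) =
      ∑ k, (((![0, 0, 2] : Fin 3 → ℤ) k : ℤ) / 2 : ℂ) • quaternionTorus E k := by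
  simp [quaternionTorus, Fin.sum_univ_three]

lemma psi₃_eq_add (h : IsQuaternionFrame E) :
    psi₃ (E 1) (E 0) = psi₁ (E 1) (E 0) + psi₂ (E 1) (E 0) := by
  have h0 : psi₂ (E 0) (E 0) = 0 := TrialityModel.self_eq_zero (psi₂_swap _ _)
  simp [psi₃_eq, h.one_eq, h.conj_table, h.mul_table, h0]

/-- Follows from the cyclic identity at `(-E 3, E 2, E 0)`: as `-E 3 · E 2 = E 1`, it relates `psi₂
(E 2) (E 3)` to `psi₃ (E 1) (E 0)` and `psi₁ (E 2) (E 3)`. -/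
lemma half_psi₂'_neg (h : IsQuaternionFrame E) :
    (1 / 2 : ℂ) • psi₂ (E 2) (E 3) =
      ∑ k, (((![2, -2, 2] : Fin 3 → ℤ) k : ℤ) / 2 : ℂ) • quaternionTorus E k := by
  have h1 := psi_cyclic (-E 3) (E 2) (E 0)
  simp [h.conj_table, h.mul_table, h.psi₃_eq_add, psi₁_swap (E 2), psi₂_swap (E 3)] at h1
  simp [quaternionTorus, Fin.sum_univ_three]
  linear_combination (norm := module) (-1 / 2 : ℂ) • h1

lemma half_psi₃_neg (h : IsQuaternionFrame E) :
    (1 / 2 : ℂ) • psi₃ (E 0) (E 1) =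
      ∑ k, (((![-2, 0, -2] : Fin 3 → ℤ) k : ℤ) / 2 : ℂ) • quaternionTorus E k := by
  rw [psi₃_swap, h.psi₃_eq_add]
  simp [quaternionTorus, Fin.sum_univ_three]
  abel

/-- Vanishing brackets of generators of `t(A)` with distinct weights. -/
lemma lie_eq_zero (h : IsQuaternionFrame E) :
    ⁅psi₁ (E 0) (E 3), -((1 / 4 : ℂ) • psi₁ (E 1) (E 3))⁆ = 0 ∧
    ⁅psi₁ (E 0) (E 3), -((1 / 4 : ℂ) • psi₂ (E 1) (E 2))⁆ = 0 ∧
    ⁅psi₁ (E 0) (E 2), -((1 / 4 : ℂ) • psi₁ (E 1) (E 2))⁆ = 0 ∧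
    ⁅psi₁ (E 0) (E 2), -((1 / 4 : ℂ) • psi₂ (E 1) (E 2))⁆ = 0 ∧
    ⁅psi₂ (E 0) (E 3), -((1 / 4 : ℂ) • psi₁ (E 1) (E 2))⁆ = 0 ∧
    ⁅psi₂ (E 0) (E 3), -((1 / 4 : ℂ) • psi₁ (E 1) (E 3))⁆ = 0 := by
  have h1 : psi₁ (E 2) (E 2) = 0 := psi₁_self _
  have h2 : psi₁ (E 3) (E 3) = 0 := psi₁_self _
  have h3 : psi₁ (E 1) (E 1) = 0 := psi₁_self _
  have h4 : psi₂ (E 2) (E 2) = 0 := TrialityModel.self_eq_zero (psi₂_swap _ _)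
  have h5 : psi₂ (E 1) (E 1) = 0 := TrialityModel.self_eq_zero (psi₂_swap _ _)
  simp [lie_psi₁, lie_psi₂, comp₁_psi₁, comp₂_psi₁, comp₁_psi₂, rot_apply, opB_apply, opD_apply,
    h.form_table, h.mul_table, h.conj_table, h1, h2, h3, h4, h5]

/-- The action of root vectors of `t(A)` on highest and lowest weight vectors. -/
lemma comp_eq_zero (h : IsQuaternionFrame E) :
    (comp₁ (psi₁ (E 0) (E 3)) (E 0) = 0 ∧ comp₁ (psi₁ (E 0) (E 2)) (E 0) = 0 ∧
      comp₁ (psi₂ (E 0) (E 3)) (E 0) = 0) ∧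
    (comp₃ (psi₁ (E 0) (E 3)) (E 0) = 0 ∧ comp₃ (psi₁ (E 0) (E 2)) (E 0) = 0 ∧
      comp₃ (psi₂ (E 0) (E 3)) (E 0) = 0) ∧
    (comp₁ (psi₁ (E 1) (E 2)) (E 1) = 0 ∧ comp₁ (psi₁ (E 1) (E 3)) (E 1) = 0 ∧
      comp₁ (psi₂ (E 1) (E 2)) (E 1) = 0) ∧
    (comp₃ (psi₁ (E 1) (E 2)) (E 1) = 0 ∧ comp₃ (psi₁ (E 1) (E 3)) (E 1) = 0 ∧
      comp₃ (psi₂ (E 1) (E 2)) (E 1) = 0) := by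
  simp [comp₁_psi₁, comp₁_psi₂, comp₃_psi₁, comp₃_psi₂, rot_apply, opA_apply, opC_apply,
    opD_apply, h.form_table, h.mul_table, h.conj_table]

end IsQuaternionFrame

/-- The positive generators of `e₇`. -/
def genE₇ (E : Fin 4 → A) (F : Fin 8 → B) : Fin 7 → TrialityModel A B :=
  ![inr (psi₁ (F 2) (F 5)), inl (psi₁ (E 0) (E 3)), inr (psi₁ (F 4) (F 6)), in₁ (E 1) (F 7),
    inl (psi₁ (E 0) (E 2)), in₃ (E 1) (F 6), inl (psi₂ (E 0) (E 3))]

/-- The negative generators of `e₇`. -/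
def genE₇' (E : Fin 4 → A) (F : Fin 8 → B) : Fin 7 → TrialityModel A B :=
  ![inr (-((1 / 4 : ℂ) • psi₁ (F 3) (F 4))), inl (-((1 / 4 : ℂ) • psi₁ (E 1) (E 2))),
    inr (-((1 / 4 : ℂ) • psi₁ (F 5) (F 7))), -in₁ (E 0) (F 6),
    inl (-((1 / 4 : ℂ) • psi₁ (E 1) (E 3))), -in₃ (E 0) (F 7),
    inl (-((1 / 4 : ℂ) • psi₂ (E 1) (E 2)))]

-- Beyond the relations inside `t(B)` and those inside `t(A)`, the point is that the short
-- generators use a lowest weight vector `E 1` of `A₁` or `A₃` and their opposites the highest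
-- weight vector `E 0`, so raising operators kill the latter and lowering operators the former.
set_option maxHeartbeats 1000000 in
lemma lie_genE₇ (hE : IsQuaternionFrame E) (hF : IsOctonionFrame F) (i j : Fin 7) (hij : i ≠ j) :
    ⁅genE₇ E F i, genE₇' E F j⁆ = 0 := by
  obtain ⟨k1, k2, k3, k4, k5, k6, k7, k8, k9, k10, k11, k12⟩ := hF.lie_eq_zero (A := A)
  have e0 : genE₇ E F 0 = inr (psi₁ (F 2) (F 5)) := rfl
  have e1 : genE₇ E F 1 = inl (psi₁ (E 0) (E 3)) := rfl
  have e2 : genE₇ E F 2 = inr (psi₁ (F 4) (F 6)) := rfl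
  have e3 : genE₇ E F 3 = in₁ (E 1) (F 7) := rfl
  have e4 : genE₇ E F 4 = inl (psi₁ (E 0) (E 2)) := rfl
  have e5 : genE₇ E F 5 = in₃ (E 1) (F 6) := rfl
  have e6 : genE₇ E F 6 = inl (psi₂ (E 0) (E 3)) := rfl
  have f0 : genE₇' E F 0 = inr (-((1 / 4 : ℂ) • psi₁ (F 3) (F 4))) := rfl
  have f1 : genE₇' E F 1 = inl (-((1 / 4 : ℂ) • psi₁ (E 1) (E 2))) := rfl
  have f2 : genE₇' E F 2 = inr (-((1 / 4 : ℂ) • psi₁ (F 5) (F 7))) := rfl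
  have f3 : genE₇' E F 3 = -in₁ (E 0) (F 6) := rfl
  have f4 : genE₇' E F 4 = inl (-((1 / 4 : ℂ) • psi₁ (E 1) (E 3))) := rfl
  have f5 : genE₇' E F 5 = -in₃ (E 0) (F 7) := rfl
  have f6 : genE₇' E F 6 = inl (-((1 / 4 : ℂ) • psi₂ (E 1) (E 2))) := rfl
  fin_cases i <;> fin_cases j <;>
  first
  | exact absurd rfl hij
  | skip
  all_goals
    simp only [Fin.reduceFinMk, Fin.isValue, Fin.zero_eta, Fin.mk_one, e0, e1, e2, e3, e4, e5, e6,
      f0, f1, f2, f3, f4, f5, f6]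
    first
    | (simp only [lie_inl_inr, lie_inr_inl]; done)
    | (simp only [k1, k2, k3, k4, k5, k6, k7, k8, k9, k10, k11, k12]; done)
    | (simp only [lie_inl_inl, hE.lie_eq_zero, LinearMap.map_zero]; done)
    | simp only [lie_neg, lie_inl_in₁, lie_inl_in₃, lie_in₁_inl, lie_in₃_inl, LinearMap.map_neg,
        LinearMap.map_smul, LinearMap.neg_apply, LinearMap.smul_apply, lie_smul, hE.comp_eq_zero,
        LinearMap.map_zero, LinearMap.zero_apply, smul_zero, neg_zero]

lemma span_genE₇ (hE : IsQuaternionFrame E) (hF : IsOctonionFrame F) :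
    LieSubalgebra.lieSpan ℂ (TrialityModel A B)
      (Set.range (genE₇ E F) ∪ Set.range (genE₇' E F)) = ⊤ := by
  set S := LieSubalgebra.lieSpan ℂ (TrialityModel A B)
    (Set.range (genE₇ E F) ∪ Set.range (genE₇' E F)) with hS
  have he : ∀ i, genE₇ E F i ∈ S := fun i => LieSubalgebra.subset_lieSpan (Or.inl ⟨i, rfl⟩)
  have hf : ∀ i, genE₇' E F i ∈ S := fun i => LieSubalgebra.subset_lieSpan (Or.inr ⟨i, rfl⟩)
  have hn : (-2 : ℂ) ≠ 0 := by norm_num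
  have a1 : inl (psi₁ (E 0) (E 3)) ∈ S := he 1
  have a2 : inl (psi₁ (E 0) (E 2)) ∈ S := he 4
  have a3 : inl (psi₂ (E 0) (E 3)) ∈ S := he 6
  have b1 : inl (psi₁ (E 1) (E 2)) ∈ S := inl_mem_of_neg_smul (hf 1)
  have b2 : inl (psi₁ (E 1) (E 3)) ∈ S := inl_mem_of_neg_smul (hf 4)
  have b3 : inl (psi₂ (E 1) (E 2)) ∈ S := inl_mem_of_neg_smul (hf 6)
  have r1 : in₁ (E 1) (F 7) ∈ S := he 3
  -- The raising operators of `t(A)` carry the lowest weight vector `E 1` through the four weights.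
  -- Below, the lowering operators do the same from `E 0` in the opposite generators.
  have r2 := in₁_mem_of_inl (a' := E 2) a2 r1
    (by simp [comp₁_psi₁, rot_apply, hE.form_table]; norm_num) two_ne_zero
  have r3 := in₁_mem_of_inl (a' := E 3) a1 r1
    (by simp [comp₁_psi₁, rot_apply, hE.form_table]; norm_num) two_ne_zero
  have r0 := in₁_mem_of_inl (a' := E 0) a1 r2
    (by simp [comp₁_psi₁, rot_apply, hE.form_table]; norm_num) hn
  have t0 : in₁ (E 0) (F 6) ∈ S := neg_mem_iff.1 (hf 3)
  have t3 := in₁_mem_of_inl (a' := E 3) b2 t0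
    (by simp [comp₁_psi₁, rot_apply, hE.form_table]; norm_num) two_ne_zero
  have t2 := in₁_mem_of_inl (a' := E 2) b1 t0
    (by simp [comp₁_psi₁, rot_apply, hE.form_table]; norm_num) two_ne_zero
  have t1 := in₁_mem_of_inl (a' := E 1) b2 t2
    (by simp [comp₁_psi₁, rot_apply, hE.form_table]; norm_num) hn
  have s1 : in₃ (E 1) (F 6) ∈ S := he 5
  have s2 := in₃_mem_of_inl (a' := E 2) a2 s1
    (by simp [comp₃_psi₁, opA_apply, hE.mul_table, hE.conj_table]; module) two_ne_zero
  have s3 := in₃_mem_of_inl (a' := E 3) a3 s1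
    (by simp [comp₃_psi₂, opC_apply, hE.mul_table, hE.conj_table]; module) two_ne_zero
  have s0 := in₃_mem_of_inl (a' := E 0) a3 s2
    (by simp [comp₃_psi₂, opC_apply, hE.mul_table, hE.conj_table]; module) hn
  have u0 : in₃ (E 0) (F 7) ∈ S := neg_mem_iff.1 (hf 5)
  have u3 := in₃_mem_of_inl (a' := E 3) b2 u0
    (by simp [comp₃_psi₁, opA_apply, hE.mul_table, hE.conj_table]; module) two_ne_zero
  have u2 := in₃_mem_of_inl (a' := E 2) b3 u0
    (by simp [comp₃_psi₂, opC_apply, hE.mul_table, hE.conj_table]; module) two_ne_zero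
  have u1 := in₃_mem_of_inl (a' := E 1) b3 u3
    (by simp [comp₃_psi₂, opC_apply, hE.mul_table, hE.conj_table]; module) hn
  refine eq_top_of_mem hE.spannedByPsi hF (he 0) (inr_mem_of_neg_smul (hf 0)) (he 2)
    (inr_mem_of_neg_smul (hf 2)) ?_ ?_ ?_ ?_
  · refine mem_of_expand hE.expand (T := S.toSubmodule.comap (in₁.flip (F 7))) fun i => ?_
    fin_cases i
    exacts [r0, r1, r2, r3]
  · refine mem_of_expand hE.expand (T := S.toSubmodule.comap (in₁.flip (F 6))) fun i => ?_
    fin_cases i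
    exacts [t0, t1, t2, t3]
  · refine mem_of_expand hE.expand (T := S.toSubmodule.comap (in₃.flip (F 6))) fun i => ?_
    fin_cases i
    exacts [s0, s1, s2, s3]
  · refine mem_of_expand hE.expand (T := S.toSubmodule.comap (in₃.flip (F 7))) fun i => ?_
    fin_cases i
    exacts [u0, u1, u2, u3]

/-- Nodes 2, 5, 7 are the mutually orthogonal simple roots of `t(A)`, a product of three copies of
`sl₂`. Nodes 2 and 5 act on `A₁`, nodes 5 and 7 on `A₃`, which gives the shape of E₇. -/
lemma isWeighted_genE₇ (hE : IsQuaternionFrame E) (hF : IsOctonionFrame F) :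
    IsWeighted (quaternionTorus E) (octonionTorus F) (genE₇ E F) (genE₇' E F)
      ![0, ![2, 0, -1] + -![0, 2, 1], 0, -![2, 0, -1], ![2, 0, -1] + ![0, 2, 1], -![1, 1, 1],
        ![-1, 1, 2] + -![-1, 1, 0]]
      ![0, ![2, 0, 0] + ![0, -2, 0], 0, ![-2, 0, 0], ![2, 0, 0] + ![0, 2, 0], ![-2, 0, -2],
        ![0, 0, 2] + ![2, -2, 2]]
      ![![0, 2, -2, 0], 0, ![0, 0, 2, 2], ![0, 0, 0, -2], 0, ![1, -1, -1, 1], 0]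
      ![![0, 2, -2, 0], 0, ![0, 0, 2, 2], ![0, 0, 0, -2], 0, ![1, -1, -1, 1], 0] := by
  refine isWeighted_of_pairs (fun i => ?_) (lie_genE₇ hE hF) (span_genE₇ hE hF)
  fin_cases i
  · exact hF.isWeightedPair_long
  · exact isWeightedPair_inl_psi₁ hE.isWeightPair₁ hE.isWeightPair₁'.symm hE.isHyperbolicPair
      hE.isHyperbolicPair'.symm (by simp only [hE.form_table]) (by simp only [hE.form_table])
      hE.half_psi₁ hE.half_psi₁'_neg
  · exact hF.isWeightedPair_long'
  · exact hF.isWeightedPair_in₁ hE.isWeightPair₁.symm hE.isHyperbolicPair.symm hE.half_psi₁_neg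
  · exact isWeightedPair_inl_psi₁ hE.isWeightPair₁ hE.isWeightPair₁' hE.isHyperbolicPair
      hE.isHyperbolicPair' (by simp only [hE.form_table]) (by simp only [hE.form_table])
      hE.half_psi₁ hE.half_psi₁'
  · exact hF.isWeightedPair_in₃ hE.isWeightPair₃.symm hE.isHyperbolicPair.symm hE.half_psi₃_neg
  · exact isWeightedPair_inl_psi₂ hE.isWeightPair₂ hE.isWeightPair₂'.symm hE.isHyperbolicPair
      hE.isHyperbolicPair'.symm (by simp only [hE.form_table]) (by simp only [hE.form_table])
      hE.half_psi₂ hE.half_psi₂'_neg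

/-- Twice the inverse of the Cartan matrix of `E₇`. -/
def inverseE₇ : Matrix (Fin 7) (Fin 7) ℕ :=
  !![4, 4, 6, 8, 6, 4, 2;
     4, 7, 8, 12, 9, 6, 3;
     6, 8, 12, 16, 12, 8, 4;
     8, 12, 16, 24, 18, 12, 6;
     6, 9, 12, 18, 15, 10, 5;
     4, 6, 8, 12, 10, 8, 4;
     2, 3, 4, 6, 5, 4, 3]

/-- The three zeros are the simple roots of `t(A)`, which vanish on `t`. The other labels are the
values of `λ` on the base of F₄. -/
lemma diagramCorrespondsTo_E₇ {X : LieF₄} {p q r s m : ℕ} {C₀ : Matrix (Fin m) (Fin m) ℤ}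
    {d₀ : Fin m → ℕ}
    (h : DiagramCorrespondsTo X (p • ωg + q • ωg₂ + r • ωg₃ + s • ωgQ) C₀ d₀) :
    DiagramCorrespondsTo (inclusion AlgH AlgO X) (p • ωg + q • ωg₂ + r • ωg₃ + s • ωgQ)
      CartanMatrix.E₇ ![p, 0, q, r, 0, s, 0] := by
  refine (isWeighted_genE₇ isPairFrame_pairFrame.quaternionFrame
      isOctonionFrame_octonions).diagramCorrespondsTo
    (C := inverseE₇.map Nat.cast) (c := 2) (by decide) (by decide) (by decide)
    (fun _ _ => Int.natCast_nonneg _) (by decide) h ?_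
  intro i
  fin_cases i <;> simp <;> ring

end E₇

end TrialitySeries

namespace TrialitySeries
open HurwitzAlgebra

/-! ### Generators of `e₈`. -/

section E₈

open TrialitySeries.TrialityModel (inl inr in₁ in₃ lie_inl_inl lie_inl_inr lie_inr_inl
  lie_inr_inr lie_inl_in₁ lie_inl_in₃ lie_inr_in₁ lie_inr_in₃ lie_in₁_inl lie_in₃_inl lie_in₁_inr
  lie_in₃_inr lie_in₁_in₁ lie_in₃_in₃ lie_in₁_in₃ lie_in₃_in₁)

variable {A B : Type} [AddCommGroup A] [Module ℂ A] [HurwitzAlgebra A]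
  [AddCommGroup B] [Module ℂ B] [HurwitzAlgebra B] {E : Fin 8 → A} {F : Fin 8 → B}

namespace IsOctonionFrame

lemma isWeightedPair_inl {l : ℕ} {HB : Fin l → trialityAlgebra B} (hE : IsOctonionFrame E)
    (i j : Fin 8) (h1 : form (E i) (E (oppositeIndex j)) = 0)
    (h2 : form (E j) (E (oppositeIndex i)) = 0) :
    IsWeightedPair (octonionTorus E) HB (inl (psi₁ (E i) (E j)))
      (inl (-((1 / 4 : ℂ) • psi₁ (E (oppositeIndex i)) (E (oppositeIndex j)))))
      (octonionWeight₁ i + octonionWeight₁ j) (octonionWeight₁ i + octonionWeight₁ j) 0 0 :=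
  isWeightedPair_inl_psi₁ (hE.isWeightPair₁ i) (hE.isWeightPair₁ j) (hE.isHyperbolicPair i)
    (hE.isHyperbolicPair j) h1 h2 (hE.half_psi₁ i) (hE.half_psi₁ j)

lemma half_psi₁_zero_neg (h : IsOctonionFrame E) :
    (1 / 2 : ℂ) • psi₁ (E 0) (E 1) =
      ∑ k, (((-octonionWeight₁ 0) k : ℤ) / 2 : ℂ) • octonionTorus E k := by
  have h1 : -octonionWeight₁ 0 = octonionWeight₁ 1 := by decide
  exact h1 ▸ h.half_psi₁ 1

lemma half_psi₃_zero_neg (h : IsOctonionFrame E) :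
    (1 / 2 : ℂ) • psi₃ (E 0) (E 1) =
      ∑ k, (((-octonionWeight₃ 0) k : ℤ) / 2 : ℂ) • octonionTorus E k := by
  rw [psi₃_swap, smul_neg, h.half_psi₃_zero, ← Finset.sum_neg_distrib]
  refine Finset.sum_congr rfl fun k _ => ?_
  rw [Pi.neg_apply, Int.cast_neg]
  module

/-- Vanishing brackets of generators of `t(𝕆)` with distinct weights. -/
lemma lie_psi₁_eq_zero (h : IsOctonionFrame E) :
    ⁅psi₁ (E 4) (E 7), -((1 / 4 : ℂ) • psi₁ (E 5) (E 7))⁆ = 0 ∧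
    ⁅psi₁ (E 4) (E 7), -((1 / 4 : ℂ) • psi₁ (E 3) (E 4))⁆ = 0 ∧
    ⁅psi₁ (E 4) (E 7), -((1 / 4 : ℂ) • psi₁ (E 1) (E 2))⁆ = 0 ∧
    ⁅psi₁ (E 4) (E 6), -((1 / 4 : ℂ) • psi₁ (E 5) (E 6))⁆ = 0 ∧
    ⁅psi₁ (E 4) (E 6), -((1 / 4 : ℂ) • psi₁ (E 3) (E 4))⁆ = 0 ∧
    ⁅psi₁ (E 4) (E 6), -((1 / 4 : ℂ) • psi₁ (E 1) (E 2))⁆ = 0 ∧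
    ⁅psi₁ (E 2) (E 5), -((1 / 4 : ℂ) • psi₁ (E 5) (E 6))⁆ = 0 ∧
    ⁅psi₁ (E 2) (E 5), -((1 / 4 : ℂ) • psi₁ (E 5) (E 7))⁆ = 0 ∧
    ⁅psi₁ (E 2) (E 5), -((1 / 4 : ℂ) • psi₁ (E 1) (E 2))⁆ = 0 ∧
    ⁅psi₁ (E 0) (E 3), -((1 / 4 : ℂ) • psi₁ (E 5) (E 6))⁆ = 0 ∧
    ⁅psi₁ (E 0) (E 3), -((1 / 4 : ℂ) • psi₁ (E 5) (E 7))⁆ = 0 ∧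
    ⁅psi₁ (E 0) (E 3), -((1 / 4 : ℂ) • psi₁ (E 3) (E 4))⁆ = 0 := by
  simp [lie_psi₁, comp₁_psi₁, rot_apply, h.form_table, psi₁_self]

/-- The action of root vectors of `t(𝕆)` on highest and lowest weight vectors. -/
lemma comp_eq_zero (h : IsOctonionFrame E) :
    comp₁ (psi₁ (E 4) (E 7)) (E 0) = 0 ∧
    comp₁ (psi₁ (E 4) (E 6)) (E 0) = 0 ∧
    comp₁ (psi₁ (E 2) (E 5)) (E 0) = 0 ∧
    comp₁ (psi₁ (E 0) (E 3)) (E 0) = 0 ∧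
    comp₃ (psi₁ (E 4) (E 7)) (E 0) = 0 ∧
    comp₃ (psi₁ (E 4) (E 6)) (E 0) = 0 ∧
    comp₃ (psi₁ (E 2) (E 5)) (E 0) = 0 ∧
    comp₃ (psi₁ (E 0) (E 3)) (E 0) = 0 ∧
    comp₁ (psi₁ (E 5) (E 6)) (E 1) = 0 ∧
    comp₁ (psi₁ (E 5) (E 7)) (E 1) = 0 ∧
    comp₁ (psi₁ (E 3) (E 4)) (E 1) = 0 ∧
    comp₁ (psi₁ (E 1) (E 2)) (E 1) = 0 ∧
    comp₃ (psi₁ (E 5) (E 6)) (E 1) = 0 ∧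
    comp₃ (psi₁ (E 5) (E 7)) (E 1) = 0 ∧
    comp₃ (psi₁ (E 3) (E 4)) (E 1) = 0 ∧
    comp₃ (psi₁ (E 1) (E 2)) (E 1) = 0 := by
  simp [comp₁_psi₁, comp₃_psi₁, rot_apply, opA_apply, h.form_table, h.mul_table, h.conj_table]

end IsOctonionFrame

/-- The positive generators of `e₈`. -/
def genE₈ (E : Fin 8 → A) (F : Fin 8 → B) : Fin 8 → TrialityModel A B :=
  ![in₃ (E 1) (F 6), inl (psi₁ (E 4) (E 7)), inl (psi₁ (E 4) (E 6)),
    inl (psi₁ (E 2) (E 5)), inl (psi₁ (E 0) (E 3)), in₁ (E 1) (F 7),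
    inr (psi₁ (F 4) (F 6)), inr (psi₁ (F 2) (F 5))]

/-- The negative generators of `e₈`. -/
def genE₈' (E : Fin 8 → A) (F : Fin 8 → B) : Fin 8 → TrialityModel A B :=
  ![-in₃ (E 0) (F 7), inl (-((1 / 4 : ℂ) • psi₁ (E 5) (E 6))),
    inl (-((1 / 4 : ℂ) • psi₁ (E 5) (E 7))), inl (-((1 / 4 : ℂ) • psi₁ (E 3) (E 4))),
    inl (-((1 / 4 : ℂ) • psi₁ (E 1) (E 2))), -in₁ (E 0) (F 6),
    inr (-((1 / 4 : ℂ) • psi₁ (F 5) (F 7))), inr (-((1 / 4 : ℂ) • psi₁ (F 3) (F 4)))]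

-- The same mechanism as for `e₇`, with the four simple root vectors of `t(A)`, now of type D₄, and
-- the extremal vectors `E 0` and `E 1` of `A₁` and `A₃`.
set_option maxHeartbeats 1000000 in
lemma lie_genE₈ (hE : IsOctonionFrame E) (hF : IsOctonionFrame F) (i j : Fin 8) (hij : i ≠ j) :
    ⁅genE₈ E F i, genE₈' E F j⁆ = 0 := by
  obtain ⟨k1, k2, k3, k4, k5, k6, k7, k8, k9, k10, k11, k12⟩ := hF.lie_eq_zero (A := A)
  have e0 : genE₈ E F 0 = in₃ (E 1) (F 6) := rfl
  have e1 : genE₈ E F 1 = inl (psi₁ (E 4) (E 7)) := rfl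
  have e2 : genE₈ E F 2 = inl (psi₁ (E 4) (E 6)) := rfl
  have e3 : genE₈ E F 3 = inl (psi₁ (E 2) (E 5)) := rfl
  have e4 : genE₈ E F 4 = inl (psi₁ (E 0) (E 3)) := rfl
  have e5 : genE₈ E F 5 = in₁ (E 1) (F 7) := rfl
  have e6 : genE₈ E F 6 = inr (psi₁ (F 4) (F 6)) := rfl
  have e7 : genE₈ E F 7 = inr (psi₁ (F 2) (F 5)) := rfl
  have f0 : genE₈' E F 0 = -in₃ (E 0) (F 7) := rfl
  have f1 : genE₈' E F 1 = inl (-((1 / 4 : ℂ) • psi₁ (E 5) (E 6))) := rfl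
  have f2 : genE₈' E F 2 = inl (-((1 / 4 : ℂ) • psi₁ (E 5) (E 7))) := rfl
  have f3 : genE₈' E F 3 = inl (-((1 / 4 : ℂ) • psi₁ (E 3) (E 4))) := rfl
  have f4 : genE₈' E F 4 = inl (-((1 / 4 : ℂ) • psi₁ (E 1) (E 2))) := rfl
  have f5 : genE₈' E F 5 = -in₁ (E 0) (F 6) := rfl
  have f6 : genE₈' E F 6 = inr (-((1 / 4 : ℂ) • psi₁ (F 5) (F 7))) := rfl
  have f7 : genE₈' E F 7 = inr (-((1 / 4 : ℂ) • psi₁ (F 3) (F 4))) := rfl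
  fin_cases i <;> fin_cases j <;>
  first
  | exact absurd rfl hij
  | skip
  all_goals
    simp only [Fin.reduceFinMk, Fin.isValue, Fin.zero_eta, Fin.mk_one, e0, e1, e2, e3, e4, e5, e6,
      e7, f0, f1, f2, f3, f4, f5, f6, f7]
    first
    | (simp only [lie_inl_inr, lie_inr_inl]; done)
    | (simp only [k1, k2, k3, k4, k5, k6, k7, k8, k9, k10, k11, k12]; done)
    | (simp only [lie_inl_inl, hE.lie_psi₁_eq_zero, LinearMap.map_zero]; done)
    | simp only [lie_neg, lie_inl_in₁, lie_inl_in₃, lie_in₁_inl, lie_in₃_inl, LinearMap.map_neg,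
        LinearMap.map_smul, LinearMap.neg_apply, LinearMap.smul_apply, lie_smul, hE.comp_eq_zero,
        LinearMap.map_zero, LinearMap.zero_apply, smul_zero, neg_zero]

lemma span_genE₈ (hE : IsOctonionFrame E) (hF : IsOctonionFrame F) :
    LieSubalgebra.lieSpan ℂ (TrialityModel A B)
      (Set.range (genE₈ E F) ∪ Set.range (genE₈' E F)) = ⊤ := by
  set S := LieSubalgebra.lieSpan ℂ (TrialityModel A B)
    (Set.range (genE₈ E F) ∪ Set.range (genE₈' E F)) with hS
  have he : ∀ i, genE₈ E F i ∈ S := fun i => LieSubalgebra.subset_lieSpan (Or.inl ⟨i, rfl⟩)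
  have hf : ∀ i, genE₈' E F i ∈ S := fun i => LieSubalgebra.subset_lieSpan (Or.inr ⟨i, rfl⟩)
  have hn : (-2 : ℂ) ≠ 0 := by norm_num
  have a1 : inl (psi₁ (E 4) (E 7)) ∈ S := he 1
  have a2 : inl (psi₁ (E 4) (E 6)) ∈ S := he 2
  have a3 : inl (psi₁ (E 2) (E 5)) ∈ S := he 3
  have a4 : inl (psi₁ (E 0) (E 3)) ∈ S := he 4
  have b1 : inl (psi₁ (E 5) (E 6)) ∈ S := inl_mem_of_neg_smul (hf 1)
  have b2 : inl (psi₁ (E 5) (E 7)) ∈ S := inl_mem_of_neg_smul (hf 2)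
  have b3 : inl (psi₁ (E 3) (E 4)) ∈ S := inl_mem_of_neg_smul (hf 3)
  have b4 : inl (psi₁ (E 1) (E 2)) ∈ S := inl_mem_of_neg_smul (hf 4)
  have r1 : in₁ (E 1) (F 7) ∈ S := he 5
  -- Simple root vectors of `so₈` carry the lowest weight vector `E 1` through all eight weights of
  -- `A₁`; both middle vectors `E 6` and `E 7` are reached from `E 5`. The chain for `A₃` uses the
  -- simple roots permuted by triality.
  have r3 := in₁_mem_of_inl (a' := E 3) a4 r1
    (by simp [comp₁_psi₁, rot_apply, hE.form_table]; norm_num) two_ne_zero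
  have r5 := in₁_mem_of_inl (a' := E 5) a3 r3
    (by simp [comp₁_psi₁, rot_apply, hE.form_table]; norm_num) two_ne_zero
  have r6 := in₁_mem_of_inl (a' := E 6) a2 r5
    (by simp [comp₁_psi₁, rot_apply, hE.form_table]; norm_num) two_ne_zero
  have r7 := in₁_mem_of_inl (a' := E 7) a1 r5
    (by simp [comp₁_psi₁, rot_apply, hE.form_table]; norm_num) two_ne_zero
  have r4 := in₁_mem_of_inl (a' := E 4) a1 r6
    (by simp [comp₁_psi₁, rot_apply, hE.form_table]; norm_num) hn
  have r2 := in₁_mem_of_inl (a' := E 2) a3 r4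
    (by simp [comp₁_psi₁, rot_apply, hE.form_table]; norm_num) hn
  have r0 := in₁_mem_of_inl (a' := E 0) a4 r2
    (by simp [comp₁_psi₁, rot_apply, hE.form_table]; norm_num) hn
  have t0 : in₁ (E 0) (F 6) ∈ S := neg_mem_iff.1 (hf 5)
  have t2 := in₁_mem_of_inl (a' := E 2) b4 t0
    (by simp [comp₁_psi₁, rot_apply, hE.form_table]; norm_num) two_ne_zero
  have t4 := in₁_mem_of_inl (a' := E 4) b3 t2
    (by simp [comp₁_psi₁, rot_apply, hE.form_table]; norm_num) two_ne_zero
  have t7 := in₁_mem_of_inl (a' := E 7) b2 t4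
    (by simp [comp₁_psi₁, rot_apply, hE.form_table]; norm_num) two_ne_zero
  have t6 := in₁_mem_of_inl (a' := E 6) b1 t4
    (by simp [comp₁_psi₁, rot_apply, hE.form_table]; norm_num) two_ne_zero
  have t5 := in₁_mem_of_inl (a' := E 5) b1 t7
    (by simp [comp₁_psi₁, rot_apply, hE.form_table]; norm_num) hn
  have t3 := in₁_mem_of_inl (a' := E 3) b3 t5
    (by simp [comp₁_psi₁, rot_apply, hE.form_table]; norm_num) hn
  have t1 := in₁_mem_of_inl (a' := E 1) b4 t3
    (by simp [comp₁_psi₁, rot_apply, hE.form_table]; norm_num) hn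
  have s1 : in₃ (E 1) (F 6) ∈ S := he 0
  have s3 := in₃_mem_of_inl (a' := E 3) a2 s1
    (by simp [comp₃_psi₁, opA_apply, hE.mul_table, hE.conj_table]; module) two_ne_zero
  have s5 := in₃_mem_of_inl (a' := E 5) a3 s3
    (by simp [comp₃_psi₁, opA_apply, hE.mul_table, hE.conj_table]; module) two_ne_zero
  have s6 := in₃_mem_of_inl (a' := E 6) a4 s5
    (by simp [comp₃_psi₁, opA_apply, hE.mul_table, hE.conj_table]; module) two_ne_zero
  have s7 := in₃_mem_of_inl (a' := E 7) a1 s5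
    (by simp [comp₃_psi₁, opA_apply, hE.mul_table, hE.conj_table]; module) two_ne_zero
  have s4 := in₃_mem_of_inl (a' := E 4) a1 s6
    (by simp [comp₃_psi₁, opA_apply, hE.mul_table, hE.conj_table]; module) hn
  have s2 := in₃_mem_of_inl (a' := E 2) a3 s4
    (by simp [comp₃_psi₁, opA_apply, hE.mul_table, hE.conj_table]; module) hn
  have s0 := in₃_mem_of_inl (a' := E 0) a2 s2
    (by simp [comp₃_psi₁, opA_apply, hE.mul_table, hE.conj_table]; module) hn
  have u0 : in₃ (E 0) (F 7) ∈ S := neg_mem_iff.1 (hf 0)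
  have u2 := in₃_mem_of_inl (a' := E 2) b2 u0
    (by simp [comp₃_psi₁, opA_apply, hE.mul_table, hE.conj_table]; module) two_ne_zero
  have u4 := in₃_mem_of_inl (a' := E 4) b3 u2
    (by simp [comp₃_psi₁, opA_apply, hE.mul_table, hE.conj_table]; module) two_ne_zero
  have u7 := in₃_mem_of_inl (a' := E 7) b4 u4
    (by simp [comp₃_psi₁, opA_apply, hE.mul_table, hE.conj_table]; module) two_ne_zero
  have u6 := in₃_mem_of_inl (a' := E 6) b1 u4
    (by simp [comp₃_psi₁, opA_apply, hE.mul_table, hE.conj_table]; module) two_ne_zero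
  have u5 := in₃_mem_of_inl (a' := E 5) b1 u7
    (by simp [comp₃_psi₁, opA_apply, hE.mul_table, hE.conj_table]; module) hn
  have u3 := in₃_mem_of_inl (a' := E 3) b3 u5
    (by simp [comp₃_psi₁, opA_apply, hE.mul_table, hE.conj_table]; module) hn
  have u1 := in₃_mem_of_inl (a' := E 1) b2 u3
    (by simp [comp₃_psi₁, opA_apply, hE.mul_table, hE.conj_table]; module) hn
  refine eq_top_of_mem hE.spannedByPsi hF (he 7) (inr_mem_of_neg_smul (hf 7)) (he 6)
    (inr_mem_of_neg_smul (hf 6)) ?_ ?_ ?_ ?_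
  · refine mem_of_expand hE.expand (T := S.toSubmodule.comap (in₁.flip (F 7))) fun i => ?_
    fin_cases i
    exacts [r0, r1, r2, r3, r4, r5, r6, r7]
  · refine mem_of_expand hE.expand (T := S.toSubmodule.comap (in₁.flip (F 6))) fun i => ?_
    fin_cases i
    exacts [t0, t1, t2, t3, t4, t5, t6, t7]
  · refine mem_of_expand hE.expand (T := S.toSubmodule.comap (in₃.flip (F 6))) fun i => ?_
    fin_cases i
    exacts [s0, s1, s2, s3, s4, s5, s6, s7]
  · refine mem_of_expand hE.expand (T := S.toSubmodule.comap (in₃.flip (F 7))) fun i => ?_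
    fin_cases i
    exacts [u0, u1, u2, u3, u4, u5, u6, u7]

/-- Nodes 2 to 5 are `ε₃ - ε₄`, `ε₃ + ε₄`, `ε₂ - ε₃`, `ε₁ - ε₂` for `t(A)`. Node 6 involves the
lowest weight `-ε₁` of `A₁` and is joined to node 5; node 1 involves the lowest weight of `A₃` and
is joined to node 3. The torus bases are orthonormal here, so weights and coroots have equal tables.
-/
lemma isWeighted_genE₈ (hE : IsOctonionFrame E) (hF : IsOctonionFrame F) :
    IsWeighted (octonionTorus E) (octonionTorus F) (genE₈ E F) (genE₈' E F)
      ![-octonionWeight₃ 0,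
        octonionWeight₁ 4 + octonionWeight₁ 7, octonionWeight₁ 4 + octonionWeight₁ 6,
        octonionWeight₁ 2 + octonionWeight₁ 5, octonionWeight₁ 0 + octonionWeight₁ 3,
        -octonionWeight₁ 0, 0, 0]
      ![-octonionWeight₃ 0,
        octonionWeight₁ 4 + octonionWeight₁ 7, octonionWeight₁ 4 + octonionWeight₁ 6,
        octonionWeight₁ 2 + octonionWeight₁ 5, octonionWeight₁ 0 + octonionWeight₁ 3,
        -octonionWeight₁ 0, 0, 0]
      ![![1, -1, -1, 1], 0, 0, 0, 0, ![0, 0, 0, -2], ![0, 0, 2, 2], ![0, 2, -2, 0]]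
      ![![1, -1, -1, 1], 0, 0, 0, 0, ![0, 0, 0, -2], ![0, 0, 2, 2], ![0, 2, -2, 0]] := by
  have hl := hE.isWeightedPair_inl (HB := octonionTorus F)
  refine isWeighted_of_pairs (fun i => ?_) (lie_genE₈ hE hF) (span_genE₈ hE hF)
  fin_cases i
  · exact hF.isWeightedPair_in₃ (hE.isWeightPair₃ 0).symm (hE.isHyperbolicPair 0).symm
      hE.half_psi₃_zero_neg
  · exact hl 4 7 (by simp [oppositeIndex, hE.form_table]) (by simp [oppositeIndex, hE.form_table])
  · exact hl 4 6 (by simp [oppositeIndex, hE.form_table]) (by simp [oppositeIndex, hE.form_table])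
  · exact hl 2 5 (by simp [oppositeIndex, hE.form_table]) (by simp [oppositeIndex, hE.form_table])
  · exact hl 0 3 (by simp [oppositeIndex, hE.form_table]) (by simp [oppositeIndex, hE.form_table])
  · exact hF.isWeightedPair_in₁ (hE.isWeightPair₁ 0).symm (hE.isHyperbolicPair 0).symm
      hE.half_psi₁_zero_neg
  · exact hF.isWeightedPair_long'
  · exact hF.isWeightedPair_long

/-- The inverse of the Cartan matrix of `E₈`. -/
def inverseE₈ : Matrix (Fin 8) (Fin 8) ℕ :=
  !![4, 5, 7, 10, 8, 6, 4, 2;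
     5, 8, 10, 15, 12, 9, 6, 3;
     7, 10, 14, 20, 16, 12, 8, 4;
     10, 15, 20, 30, 24, 18, 12, 6;
     8, 12, 16, 24, 20, 15, 10, 5;
     6, 9, 12, 18, 15, 12, 8, 4;
     4, 6, 8, 12, 10, 8, 6, 3;
     2, 3, 4, 6, 5, 4, 3, 2]

lemma diagramCorrespondsTo_E₈ {X : LieF₄} {p q r s m : ℕ} {C₀ : Matrix (Fin m) (Fin m) ℤ}
    {d₀ : Fin m → ℕ}
    (h : DiagramCorrespondsTo X (p • ωg + q • ωg₂ + r • ωg₃ + s • ωgQ) C₀ d₀) :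
    DiagramCorrespondsTo (inclusion AlgO AlgO X) (p • ωg + q • ωg₂ + r • ωg₃ + s • ωgQ)
      CartanMatrix.E₈ ![s, 0, 0, 0, 0, r, q, p] := by
  refine (isWeighted_genE₈ isOctonionFrame_octonions
      isOctonionFrame_octonions).diagramCorrespondsTo
    -- The Cartan matrix of E₈ is unimodular, so no denominator has to be cleared, unlike the
    -- factors `3` for E₆ and `2` for E₇.
    (C := inverseE₈.map Nat.cast) (c := 1) (by decide) (by decide) (by decide)
    (fun _ _ => Int.natCast_nonneg _) (by decide) h ?_
  intro i
  fin_cases i <;> simp <;> ring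

end E₈

end TrialitySeries

end

theorem proposition2p3 (p q r s : ℕ) (X : LieF₄)
    (hX : IsNilpotent (LieAlgebra.ad ℂ LieF₄ X))
    (h : DiagramCorrespondsTo X (p • ωg + q • ωg₂ + r • ωg₃ + s • ωgQ)
      CartanMatrix.F₄ ![p, q, r, s]) :
    DiagramCorrespondsTo (inclusion AlgC AlgO X) (p • ωg + q • ωg₂ + r • ωg₃ + s • ωgQ)
        CartanMatrix.E₆ ![s, p, r, q, r, s] ∧
      DiagramCorrespondsTo (inclusion AlgH AlgO X) (p • ωg + q • ωg₂ + r • ωg₃ + s • ωgQ)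
        CartanMatrix.E₇ ![p, 0, q, r, 0, s, 0] ∧
      DiagramCorrespondsTo (inclusion AlgO AlgO X) (p • ωg + q • ωg₂ + r • ωg₃ + s • ωgQ)
        CartanMatrix.E₈ ![s, 0, 0, 0, 0, r, q, p] :=
  ⟨diagramCorrespondsTo_E₆ h, diagramCorrespondsTo_E₇ h, diagramCorrespondsTo_E₈ h⟩
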